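/- **Model.** Let $m,n,\ell,r,k$ be positive integers with $\ell>1$, $r>1$, $m\ell=nr$, $k\ge 1$. Let $\mathscr F,\mathscr G$ be probability distributions on $[0,1]$. Worker qualities $p_1,\dots,p_n$ are i.i.d. from $\mathscr F$ and task qualities $q_1,\dots,q_m$ are i.i.d. from $\mathscr G$. Put $\lambda_i=(2q_i-1)^2$ (difficulty), $t_i=\mathrm{sign}(2q_i-1)$ (true label), $\mu=\mathbb E_{\mathscr F}[2p-1]$, $\sigma^2=\mathbb E_{\mathscr F}[(2p-1)^2]$, $\rho^2=\mathbb E_{\mathscr G}[(2q-1)^2]$, $\hat\ell=\ell-1$, $\hat r=r-1$. Tasks are assigned by the $(\ell,r)$-regular configuration model: the $m\ell$ half-edges at the tasks ($\ell$ per task) are matched to the $nr$ half-edges at the workers ($r$ per worker) by a uniformly random bijection, and $E\subseteq[m]\times[n]$ is the resulting set of pairs (repeated edges are merged). Given the qualities and $E$, the responses $A_{ij}\in\{\pm1\}$, $(i,j)\in E$, are independent with $\mathbb P[A_{ij}=1]=q_ip_j+(1-q_i)(1-p_j)$. **Algorithm.** With $W_i=\{j:(i,j)\in E\}$ and $T_j=\{i:(i,j)\in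 E\}$, start from independent $y^{(0)}_{j\to i}\sim\mathcal N(1,1)$, independent of everything else, and iterate $x^{(s)}_{i\to j}=\sum_{j'\in W_i\setminus j}A_{ij'}\,y^{(s-1)}_{j'\to i}$, $\;y^{(s)}_{j\to i}=\sum_{i'\in T_j\setminus i}A_{i'j}\,x^{(s)}_{i'\to j}$. The output after $k$ iterations is $x^{(k)}_i=\sum_{j\in W_i}A_{ij}\,y^{(k-1)}_{j\to i}$, and the estimate is $\hat t^{(k)}_i=\mathrm{sign}(x^{(k)}_i)$. **Theorem.** Define $$\sigma_k^2=\frac{2\sigma^2}{\mu^2\big(\hat\ell\hat r(\rho^2\sigma^2)^2\big)^{k-1}}+3\Big(1+\frac1{\hat r\rho^2\sigma^2}\Big)\frac{1-1/\big(\hat\ell\hat r(\rho^2\sigma^2)^2\big)^{k-1}}{1-1/\big(\hat\ell\hat r(\rho^2\sigma^2)^2\big)}.$$ If $\mu>0$, $\hat\ell\hat r\rho^4\sigma^4>1$ and $\hat r\rho^2>1$, then for every task $i$, almost surely, $$\mathbb P\big[t_i\ne\hat t^{(k)}_i\,\big|\,\lambda_i\big]\le \exp\Big(-\frac{\ell\sigma^2\lambda_i}{2\sigma_k^2}\Big)+\frac{3\ell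 r}{m}(\hat\ell\hat r)^{2k-2}.$$ The same bound holds when one conditions on $q_i$ (that is, on both the difficulty and the label of task $i$) instead of $\lambda_i$. It also holds, conditionally on $\lambda_i$, for every fixed label vector $t\in\{\pm1\}^m$ when the difficulties $\lambda_1,\dots,\lambda_m$ are i.i.d. with the law of $(2q-1)^2$, $q\sim\mathscr G$, and the task qualities are those with these difficulties and labels, $2q_i-1=t_i\sqrt{\lambda_i}$. Consequently, a budget $\Gamma=m\ell$ of order $\frac{m}{\lambda_{\min}\sigma^2}\log(1/\varepsilon)$ suffices for this non-adaptive scheme. There is a universal constant $C>0$ such that the following holds whenever $\mu>0$, $\ell,r>1$, $\lambda_{\min}>0$ is a lower bound of $(2q-1)^2$ for $\mathscr G$-almost all $q$, $\hat r\rho^2>1$, $\hat r\rho^2\sigma^2\ge1$, $0<\varepsilon\le\frac12$ and $\ell\ge\frac{C}{\lambda_{\min}\sigma^2}\log(1/\varepsilon)$: for all sufficiently large $k$ there is an $M$ such that for all $m\ge M$ and all $n$ with $m\ell=nr$, in the i.i.d. model, $\frac1m\sum_{i=1}^m\mathbb P[t_i\ne\hat t^{(k)}_i]\le\varepsilon$.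 -/

import Mathlib

open MeasureTheory ProbabilityTheory

noncomputable section

namespace Crowdsourcing

/-! ### The random assignment graph -/

/-- An outcome of the `(ℓ, r)`-regular configuration model on `m` tasks and `n` workers: the `ℓ`
half-edges of every task are matched with the `r` half-edges of every worker. -/
abbrev Pairing (m n ℓ r : ℕ) : Type := (Fin m × Fin ℓ) ≃ (Fin n × Fin r)

instance instMeasurableSpacePairing (m n ℓ r : ℕ) : MeasurableSpace (Pairing m n ℓ r) := ⊤

/-- The edge set `E ⊆ [m] × [n]` of a pairing: task `i` is assigned to worker `j` when some half-edge
of `i` is matched with some half-edge of `j`. -/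
def edges {m n ℓ r : ℕ} (π : Pairing m n ℓ r) : Finset (Fin m × Fin n) :=
  Finset.univ.image fun e : Fin m × Fin ℓ => (e.1, (π e).1)

/-- `W_i`, the set of workers assigned to task `i`. -/
def workersOf {m n : ℕ} (E : Finset (Fin m × Fin n)) (i : Fin m) : Finset (Fin n) :=
  Finset.univ.filter fun j => (i, j) ∈ E

/-- `T_j`, the set of tasks assigned to worker `j`. -/
def tasksOf {m n : ℕ} (E : Finset (Fin m × Fin n)) (j : Fin n) : Finset (Fin m) :=
  Finset.univ.filter fun i => (i, j) ∈ E

/-! ### The message-passing algorithm -/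

/-- Update of the task messages: `x_{i → j} = ∑_{j' ∈ W_i \ j} A_{ij'} y_{j' → i}`. -/
def taskUpdate {m n : ℕ} (E : Finset (Fin m × Fin n)) (A : Fin m → Fin n → ℝ)
    (y : Fin n → Fin m → ℝ) : Fin m → Fin n → ℝ :=
  fun i j => ∑ j' ∈ (workersOf E i).erase j, A i j' * y j' i

/-- Update of the worker messages: `y_{j → i} = ∑_{i' ∈ T_j \ i} A_{i'j} x_{i' → j}`. -/
def workerUpdate {m n : ℕ} (E : Finset (Fin m × Fin n)) (A : Fin m → Fin n → ℝ)
    (x : Fin m → Fin n → ℝ) : Fin n → Fin m → ℝ :=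
  fun j i => ∑ i' ∈ (tasksOf E j).erase i, A i' j * x i' j

/-- The worker messages `y^{(k)}`, started from `y^{(0)} = z`. -/
def workerMessage {m n : ℕ} (E : Finset (Fin m × Fin n)) (A : Fin m → Fin n → ℝ)
    (z : Fin n → Fin m → ℝ) : ℕ → Fin n → Fin m → ℝ
  | 0 => z
  | k + 1 => workerUpdate E A (taskUpdate E A (workerMessage E A z k))

/-- The output after `k ≥ 1` iterations: `x_i^{(k)} = ∑_{j ∈ W_i} A_{ij} y_{j → i}^{(k-1)}`. -/
def score {m n : ℕ} (E : Finset (Fin m × Fin n)) (A : Fin m → Fin n → ℝ)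
    (z : Fin n → Fin m → ℝ) (k : ℕ) (i : Fin m) : ℝ :=
  ∑ j ∈ workersOf E i, A i j * workerMessage E A z (k - 1) j i

/-! ### The generalized Dawid-Skene model -/

/-- A response driven by an independent uniform variable `u`: it is `+1` with probability
`q p + (1 - q) (1 - p)` and `-1` otherwise. -/
def response (q p u : ℝ) : ℝ := if u ≤ q * p + (1 - q) * (1 - p) then 1 else -1

/-- The difficulty `λ = (2q - 1)²` of a task of quality `q`. -/
def difficulty (q : ℝ) : ℝ := (2 * q - 1) ^ 2

/-- `μ = E[2p - 1]`. -/
def crowdMean (F : Measure unitInterval) : ℝ := ∫ p, (2 * (p : ℝ) - 1) ∂F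

/-- `σ² = E[(2p - 1)²]`. -/
def crowdQuality (F : Measure unitInterval) : ℝ := ∫ p, (2 * (p : ℝ) - 1) ^ 2 ∂F

/-- `ρ² = E[(2q - 1)²]`. -/
def meanDifficulty (G : Measure unitInterval) : ℝ := ∫ q, difficulty (q : ℝ) ∂G

/-- The sample space: pairing, task qualities `q`, worker qualities `p`, uniform variables driving
the responses, and initial messages `z`. -/
abbrev Sample (m n ℓ r : ℕ) : Type :=
  Pairing m n ℓ r × (Fin m → unitInterval) × (Fin n → unitInterval) ×
    (Fin m → Fin n → unitInterval) × (Fin n → Fin m → ℝ)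

/-- The law of the model: a uniformly random pairing, `q_i` i.i.d. from `G`, `p_j` i.i.d. from `F`,
i.i.d. uniform variables on `[0, 1]` and i.i.d. `N(1, 1)` initial messages, all independent. -/
def law (m n ℓ r : ℕ) (F G : Measure unitInterval) : Measure (Sample m n ℓ r) :=
  (uniformOn (Set.univ : Set (Pairing m n ℓ r))).prod
    ((Measure.pi fun _ : Fin m => G).prod
      ((Measure.pi fun _ : Fin n => F).prod
        ((Measure.pi fun _ : Fin m => Measure.pi fun _ : Fin n =>
            (volume : Measure unitInterval)).prod
          (Measure.pi fun _ : Fin n => Measure.pi fun _ : Fin m => gaussianReal 1 1))))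

/-- The task quality `q_i` of an outcome. -/
def quality {m n ℓ r : ℕ} (ω : Sample m n ℓ r) (i : Fin m) : ℝ := (ω.2.1 i : ℝ)

/-- Task qualities with prescribed labels `t_i = ±1` and the difficulties `λ_i` of the outcome, that
is, `2 q_i - 1 = t_i √λ_i`. -/
def labelledQuality {m n ℓ r : ℕ} (t : Fin m → ℝ) (ω : Sample m n ℓ r) (i : Fin m) : ℝ :=
  (1 + t i * √(difficulty (quality ω i))) / 2

/-- The estimate `sign (x_i^{(k)})` when the tasks have qualities `q`. -/
def estimate {m n ℓ r : ℕ} (q : Fin m → ℝ) (k : ℕ) (ω : Sample m n ℓ r) (i : Fin m) : ℝ :=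
  Real.sign (score (edges ω.1) (fun i j => response (q i) (ω.2.2.1 j) (ω.2.2.2.1 i j))
    ω.2.2.2.2 k i)

/-- The event that the label `sign (2 q_i - 1)` of task `i` is estimated wrongly. -/
def errorEvent {m n ℓ r : ℕ} (k : ℕ) (i : Fin m) : Set (Sample m n ℓ r) :=
  {ω | Real.sign (2 * quality ω i - 1) ≠ estimate (quality ω) k ω i}

/-- The event that the label of task `i` is estimated wrongly when the labels are prescribed to be
`t`. -/
def labelledErrorEvent {m n ℓ r : ℕ} (t : Fin m → ℝ) (k : ℕ) (i : Fin m) :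
    Set (Sample m n ℓ r) :=
  {ω | t i ≠ estimate (labelledQuality t ω) k ω i}

/-! ### The error bound -/

/-- The effective variance `σ_k²`. -/
def effVariance (ℓ r k : ℕ) (F G : Measure unitInterval) : ℝ :=
  2 * crowdQuality F /
      (crowdMean F ^ 2 *
        (((ℓ : ℝ) - 1) * ((r : ℝ) - 1) * (meanDifficulty G * crowdQuality F) ^ 2) ^ (k - 1)) +
    3 * (1 + 1 / (((r : ℝ) - 1) * meanDifficulty G * crowdQuality F)) *
      ((1 - 1 / (((ℓ : ℝ) - 1) * ((r : ℝ) - 1) *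
            (meanDifficulty G * crowdQuality F) ^ 2) ^ (k - 1)) /
        (1 - 1 / (((ℓ : ℝ) - 1) * ((r : ℝ) - 1) * (meanDifficulty G * crowdQuality F) ^ 2)))

/-- `exp (-ℓ σ² λ / (2 σ_k²)) + (3 ℓ r / m) ((ℓ - 1) (r - 1))^(2k - 2)`. -/
def errorBound (m ℓ r k : ℕ) (F G : Measure unitInterval) (lam : ℝ) : ℝ :=
  Real.exp (-((ℓ : ℝ) * crowdQuality F * lam) / (2 * effVariance ℓ r k F G)) +
    3 * (ℓ : ℝ) * (r : ℝ) / (m : ℝ) * (((ℓ : ℝ) - 1) * ((r : ℝ) - 1)) ^ (2 * k - 2)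

end Crowdsourcing

end

/-! Two facts are combined: the neighbourhood of radius `2k - 1` of a task is a tree with high
probability, and on a tree the output is a sum of `ℓ` contributions, independent given the root
quality, whose exponential moments obey a closed recursion.

Tree-likeness. Walks from the task are coded by addresses. If two walks reach the same vertex,
consider the first such collision in breadth-first order. Just before it, the exit half-edge of the
later walk is unexplored, and exchanging its partner with any unexplored half-edge of the same
colour leaves the past of both walks unchanged. At most `deg - 1` of these half-edges lie at the
vertex to be hit, so the collision has probability at most `(deg - 1) / (mℓ - O(k))`
(`card_collision_le`). A union bound over pairs of addresses of equal parity
(`card_not_treeLike_le`) and the geometric growth of the levels give `uniformOn_not_isLocalTree_le`.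

Exponential moments. Call `θ = 2q - 1` or `2p - 1` the bias of a vertex. If `x` is the message of a
node of height `h` and `A` the response on the edge to its parent, then, with the bias `θ` of the
parent held fixed, `E exp(cAx) ≤ exp(e θ c + ζ c² / 2)` with `e = drift h`, `ζ = spread h`
(`lmarginal_subtreeVars_le`). At a leaf, Hoeffding's bound for `A` and the Gaussian variance give `e
= μ`, `ζ = 2`. For the induction, let the node above have bias `θ'` and `β` children. Integrating
out the subtrees of the children leaves `β e θ' cA + β ζ c² / 2`. As `A` has mean `θθ'`, Hoeffding
turns the first term into `θ'² (θx + x² / 2)` with `x = cβe`. For `|x| ≤ 1/2` a second-order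
expansion and `θ'⁴ ≤ θ'²` leave only the second moment `κ` of `θ'`, whence `e' = κβe` and `ζ' = βζ +
3κ(βe)²`. Above the leaves, which are workers, biases enter only through their squares. The labels
of the tasks are therefore irrelevant, and fixed label vectors are covered by the same argument.

Error bound. At the root the coefficient `c = -(e/ζ)θ` gives the Chernoff bound `exp(-ℓe²θ² /
(2ζ))`. It is small enough for the recursion at every height (`abs_mul_drift_le`), and `σ² ζ / e²`
is the effective variance (`spread_div_drift_sq`). The root quality stays frozen throughout, so the
estimate holds on every event defined by it (`Supercritical.law_inter_le`), which yields the
conditional statements (`Supercritical.condProb_le`).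

Budget. The growth rate of the signal-to-noise ratio is at least a multiple of `ℓ λ_min σ²`. For
large `k` the effective variance is then bounded by a constant, and the failure of tree-likeness
disappears as `m` grows. -/

namespace Crowdsourcing

/-! ### Addresses in a tree -/

/-- A list of natural numbers is the address of a node of the rooted tree in which every node of
depth `t` has `b t` children, the most recent choice coming first. -/
def IsAddress (b : ℕ → ℕ) : List ℕ → Prop
  | [] => True
  | a :: w => a < b w.length ∧ IsAddress b w

/-- The addresses of the nodes of depth `t`. -/
def addresses (b : ℕ → ℕ) : ℕ → Finset (List ℕ)
  | 0 => {[]}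
  | t + 1 => (Finset.range (b t) ×ˢ addresses b t).image fun p => p.1 :: p.2

theorem mem_addresses {b : ℕ → ℕ} {t : ℕ} {w : List ℕ} :
    w ∈ addresses b t ↔ IsAddress b w ∧ w.length = t := by
  induction t generalizing w with
  | zero =>
    cases w <;> simp [addresses, IsAddress]
  | succ t ih =>
    cases w with
    | nil => simp [addresses]
    | cons a w =>
      simp only [addresses, Finset.mem_image, Finset.mem_product, Finset.mem_range, ih, Prod.exists,
        List.cons.injEq, List.length_cons, IsAddress]
      constructor
      · rintro ⟨a', w', ⟨h1, h2, h3⟩, rfl, rfl⟩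
        exact ⟨⟨by rwa [h3], h2⟩, by rw [h3]⟩
      · rintro ⟨⟨h1, h2⟩, h3⟩
        have h4 : w.length = t := by omega
        exact ⟨a, w, ⟨by rwa [← h4], h2, h4⟩, rfl, rfl⟩

theorem card_addresses (b : ℕ → ℕ) (t : ℕ) :
    (addresses b t).card = ∏ s ∈ Finset.range t, b s := by
  induction t with
  | zero => simp [addresses]
  | succ t ih =>
    rw [addresses, Finset.card_image_of_injective _ (by rintro ⟨a, w⟩ ⟨a', w'⟩ h; simpa using h),
      Finset.card_product, Finset.card_range, ih, Finset.prod_range_succ, mul_comm]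

theorem IsAddress.of_suffix {b : ℕ → ℕ} {w w' : List ℕ} (h : w' <:+ w) (hw : IsAddress b w) :
    IsAddress b w' := by
  induction w with
  | nil => rw [List.suffix_nil.1 h]; trivial
  | cons a w ih =>
    rcases List.suffix_cons_iff.1 h with rfl | h
    · exact hw
    · exact ih h hw.2

/-- The addresses of depth at most `T` whose depth has parity `c`. -/
def parityAddresses (b : ℕ → ℕ) (T : ℕ) (c : Bool) : Finset (List ℕ) :=
  ((Finset.range (T + 1)).filter fun t => t.bodd = c).biUnion (addresses b)

theorem mem_parityAddresses {b : ℕ → ℕ} {T : ℕ} {c : Bool} {w : List ℕ} :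
    w ∈ parityAddresses b T c ↔ IsAddress b w ∧ w.length ≤ T ∧ w.length.bodd = c := by
  simp only [parityAddresses, Finset.mem_biUnion, Finset.mem_filter, Finset.mem_range,
    mem_addresses, Nat.lt_succ_iff]
  constructor
  · rintro ⟨t, ⟨h1, h2⟩, h3, rfl⟩
    exact ⟨h3, h1, h2⟩
  · rintro ⟨h1, h2, h3⟩
    exact ⟨_, ⟨h2, h3⟩, h1, rfl⟩

theorem card_parityAddresses_le (b : ℕ → ℕ) (T : ℕ) (c : Bool) :
    (parityAddresses b T c).card ≤
      ∑ t ∈ (Finset.range (T + 1)).filter (fun t => t.bodd = c), ∏ s ∈ Finset.range t, b s := by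
  refine Finset.card_biUnion_le.trans_eq ?_
  exact Finset.sum_congr rfl fun t _ => card_addresses b t

/-! ### Exploration of a random matching of half-edges -/

noncomputable section Exploration

theorem getD_toList_mem {α : Type*} {d : α} {S : Finset α} {a : ℕ} (ha : a < S.card) : S.toList.getD a d ∈ S := by
  rw [List.getD_eq_getElem _ _ (by simpa using ha)]
  exact Finset.mem_toList.1 (List.getElem_mem _)

theorem getD_toList_inj {α : Type*} {d : α} {S : Finset α} {a a' : ℕ} (ha : a < S.card) (ha' : a' < S.card)
    (h : S.toList.getD a d = S.toList.getD a' d) : a = a' := by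
  rw [List.getD_eq_getElem _ _ (by simpa using ha),
    List.getD_eq_getElem _ _ (by simpa using ha')] at h
  exact (S.nodup_toList.getElem_inj_iff).1 h

theorem exists_getD_toList {α : Type*} {d : α} {S : Finset α} {h : α} (hh : h ∈ S) :
    ∃ a < S.card, S.toList.getD a d = h := by
  obtain ⟨a, ha, rfl⟩ := List.getElem_of_mem (Finset.mem_toList.2 hh)
  exact ⟨a, by simpa using ha, List.getD_eq_getElem _ _ ha⟩

variable {H V : Type*} [Fintype H] [DecidableEq V]

/-- The half-edges at the vertex `x`. -/
def halfEdgesAt (vt : H → V) (x : V) : Finset H := Finset.univ.filter fun h => vt h = x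

theorem mem_halfEdgesAt {vt : H → V} {x : V} {h : H} : h ∈ halfEdgesAt vt x ↔ vt h = x := by
  simp [halfEdgesAt]

variable [DecidableEq H]

/-- The half-edge through which the walk with the given address leaves its last but one vertex. -/
def exitEdge (vt : H → V) (root : V) (d : H) (M : Equiv.Perm H) : List ℕ → H
  | [] => d
  | [a] => (halfEdgesAt vt root).toList.getD a d
  | a :: b :: w =>
    ((halfEdgesAt vt (vt (M (exitEdge vt root d M (b :: w))))).erase
      (M (exitEdge vt root d M (b :: w)))).toList.getD a d

/-- The vertex reached by the walk with the given address. -/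
def reached (vt : H → V) (root : V) (d : H) (M : Equiv.Perm H) : List ℕ → V
  | [] => root
  | a :: w => vt (M (exitEdge vt root d M (a :: w)))

/-- The half-edges through which the walk with the given address can be continued. -/
def freeEdges (vt : H → V) (root : V) (d : H) (M : Equiv.Perm H) : List ℕ → Finset H
  | [] => halfEdgesAt vt root
  | a :: w => (halfEdgesAt vt (reached vt root d M (a :: w))).erase
      (M (exitEdge vt root d M (a :: w)))

/-- A perfect matching of half-edges, joining vertices of different colours. -/
structure IsMatching (vt : H → V) (color : V → Bool) (M : Equiv.Perm H) : Prop where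
  invol : ∀ h, M (M h) = h
  color_apply : ∀ h, color (vt (M h)) = !color (vt h)

/-- The number of children of a vertex at distance `t` from the root. -/
def branching (deg : Bool → ℕ) (t : ℕ) : ℕ := if t = 0 then deg false else deg t.bodd - 1

/-- The exploration up to distance `T` meets no vertex twice. -/
def TreeLike (vt : H → V) (root : V) (d : H) (deg : Bool → ℕ) (T : ℕ) (M : Equiv.Perm H) : Prop :=
  Set.InjOn (reached vt root d M) {w | IsAddress (branching deg) w ∧ w.length ≤ T}

variable {vt : H → V} {root : V} {d : H} {M : Equiv.Perm H} {color : V → Bool} {deg : Bool → ℕ}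

theorem exitEdge_cons (a : ℕ) (w : List ℕ) :
    exitEdge vt root d M (a :: w) = (freeEdges vt root d M w).toList.getD a d := by
  cases w <;> rfl

theorem freeEdges_subset (w : List ℕ) :
    freeEdges vt root d M w ⊆ halfEdgesAt vt (reached vt root d M w) := by
  cases w with
  | nil => exact subset_rfl
  | cons a w => exact Finset.erase_subset _ _

/-- The two claims need a joint induction: the count shows that the exit half-edge is a genuine one
and not the default `d`, and this is what determines the colour of the next vertex. -/
theorem color_reached_and_card_freeEdges (hM : IsMatching vt color M)
    (hdeg : ∀ x, (halfEdgesAt vt x).card = deg (color x)) (hroot : color root = false)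
    {w : List ℕ} (hw : IsAddress (branching deg) w) :
    color (reached vt root d M w) = w.length.bodd ∧
      (freeEdges vt root d M w).card = branching deg w.length := by
  induction w with
  | nil => simp [reached, freeEdges, hroot, hdeg, branching]
  | cons a w ih =>
    obtain ⟨h1, h2⟩ := ih hw.2
    have h3 : exitEdge vt root d M (a :: w) ∈ freeEdges vt root d M w := by
      rw [exitEdge_cons]
      exact getD_toList_mem (h2 ▸ hw.1)
    have h4 := mem_halfEdgesAt.1 (freeEdges_subset w h3)
    have h5 : color (reached vt root d M (a :: w)) = (a :: w).length.bodd := by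
      rw [reached, hM.color_apply, h4, h1, List.length_cons, Nat.bodd_succ]
    refine ⟨h5, ?_⟩
    rw [freeEdges, Finset.card_erase_of_mem (mem_halfEdgesAt.2 (by rw [reached])), hdeg, h5]
    simp [branching]

theorem exitEdge_mem_freeEdges (hM : IsMatching vt color M)
    (hdeg : ∀ x, (halfEdgesAt vt x).card = deg (color x)) (hroot : color root = false)
    {a : ℕ} {w : List ℕ} (hw : IsAddress (branching deg) (a :: w)) :
    exitEdge vt root d M (a :: w) ∈ freeEdges vt root d M w := by
  rw [exitEdge_cons]
  exact getD_toList_mem ((color_reached_and_card_freeEdges hM hdeg hroot hw.2).2 ▸ hw.1)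

theorem vt_exitEdge (hM : IsMatching vt color M)
    (hdeg : ∀ x, (halfEdgesAt vt x).card = deg (color x)) (hroot : color root = false)
    {a : ℕ} {w : List ℕ} (hw : IsAddress (branching deg) (a :: w)) :
    vt (exitEdge vt root d M (a :: w)) = reached vt root d M w :=
  mem_halfEdgesAt.1 (freeEdges_subset w (exitEdge_mem_freeEdges hM hdeg hroot hw))

/-- The matching obtained from `M` by exchanging the roles of the half-edges `x` and `y`. -/
def relink (x y : H) (M : Equiv.Perm H) : Equiv.Perm H := Equiv.swap x y * M * Equiv.swap x y

/-- The half-edges used by the nonempty walks with addresses in `W`. -/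
def explored (vt : H → V) (root : V) (d : H) (M : Equiv.Perm H) (W : Finset (List ℕ)) : Finset H :=
  (W.erase []).image (exitEdge vt root d M) ∪ (W.erase []).image (fun w => M (exitEdge vt root d M w))

theorem exitEdge_mem_explored {W : Finset (List ℕ)} {w : List ℕ} (hw : w ∈ W) (h : w ≠ []) :
    exitEdge vt root d M w ∈ explored vt root d M W :=
  Finset.mem_union_left _ (Finset.mem_image_of_mem _ (Finset.mem_erase.2 ⟨h, hw⟩))

theorem apply_exitEdge_mem_explored {W : Finset (List ℕ)} {w : List ℕ} (hw : w ∈ W) (h : w ≠ []) :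
    M (exitEdge vt root d M w) ∈ explored vt root d M W :=
  Finset.mem_union_right _
    (Finset.mem_image_of_mem (fun w => M (exitEdge vt root d M w)) (Finset.mem_erase.2 ⟨h, hw⟩))

theorem mem_explored {W : Finset (List ℕ)} {h : H} :
    h ∈ explored vt root d M W ↔ ∃ w ∈ W, w ≠ [] ∧
      (h = exitEdge vt root d M w ∨ h = M (exitEdge vt root d M w)) := by
  simp only [explored, Finset.mem_union, Finset.mem_image, Finset.mem_erase]
  constructor
  · rintro (⟨w, ⟨h1, h2⟩, rfl⟩ | ⟨w, ⟨h1, h2⟩, rfl⟩)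
    · exact ⟨w, h2, h1, Or.inl rfl⟩
    · exact ⟨w, h2, h1, Or.inr rfl⟩
  · rintro ⟨w, h2, h1, rfl | rfl⟩
    · exact Or.inl ⟨w, ⟨h1, h2⟩, rfl⟩
    · exact Or.inr ⟨w, ⟨h1, h2⟩, rfl⟩

/-- The explored half-edges come in matched pairs, so the partner of an unexplored half-edge is
unexplored. -/
theorem apply_mem_explored (hM : IsMatching vt color M) {W : Finset (List ℕ)} {h : H}
    (hh : M h ∈ explored vt root d M W) : h ∈ explored vt root d M W := by
  obtain ⟨w, hw, hne, h1 | h1⟩ := mem_explored.1 hh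
  · exact mem_explored.2 ⟨w, hw, hne, Or.inr (by rw [← h1, hM.invol])⟩
  · exact mem_explored.2 ⟨w, hw, hne, Or.inl (M.injective h1)⟩

/-- A walk only consults the matching at half-edges it has explored, and the exchange fixes these.
Closure of `W` under passing to the parent lets the induction run along the walk. -/
theorem relink_explored {W : Finset (List ℕ)} (hW : ∀ a w, a :: w ∈ W → w ∈ W) {x y : H}
    (hx : x ∉ explored vt root d M W) (hy : y ∉ explored vt root d M W) {w : List ℕ} (hw : w ∈ W) :
    exitEdge vt root d (relink x y M) w = exitEdge vt root d M w ∧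
      reached vt root d (relink x y M) w = reached vt root d M w ∧
      (w ≠ [] → relink x y M (exitEdge vt root d M w) = M (exitEdge vt root d M w)) ∧
      freeEdges vt root d (relink x y M) w = freeEdges vt root d M w := by
  induction w with
  | nil => simp [exitEdge, reached, freeEdges]
  | cons a w ih =>
    obtain ⟨-, -, -, h4⟩ := ih (hW a w hw)
    have h5 : exitEdge vt root d (relink x y M) (a :: w) = exitEdge vt root d M (a :: w) := by
      rw [exitEdge_cons, exitEdge_cons, h4]
    have h6 := exitEdge_mem_explored (vt := vt) (root := root) (d := d) (M := M) hw (by simp)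
    have h7 := apply_exitEdge_mem_explored (vt := vt) (root := root) (d := d) (M := M) hw (by simp)
    have h8 : relink x y M (exitEdge vt root d M (a :: w)) = M (exitEdge vt root d M (a :: w)) := by
      simp only [relink, Equiv.Perm.mul_apply]
      rw [Equiv.swap_apply_of_ne_of_ne (ne_of_mem_of_not_mem h6 hx) (ne_of_mem_of_not_mem h6 hy),
        Equiv.swap_apply_of_ne_of_ne (ne_of_mem_of_not_mem h7 hx) (ne_of_mem_of_not_mem h7 hy)]
    have h9 : reached vt root d (relink x y M) (a :: w) = reached vt root d M (a :: w) := by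
      rw [reached, reached, h5, h8]
    exact ⟨h5, h9, fun _ => h8, by rw [freeEdges, freeEdges, h9, h5, h8]⟩

end Exploration

/-! ### Switchings and the probability that two walks collide. -/

noncomputable section Collisions

variable {H V : Type*} [Fintype H] [DecidableEq V] [DecidableEq H]
variable {vt : H → V} {root : V} {d : H} {M : Equiv.Perm H} {color : V → Bool} {deg : Bool → ℕ}

omit [Fintype H] in
theorem relink_relink (x y : H) (M : Equiv.Perm H) : relink x y (relink x y M) = M := by
  ext h
  simp [relink]

theorem explored_relink {W : Finset (List ℕ)} (hW : ∀ a w, a :: w ∈ W → w ∈ W) {x y : H}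
    (hx : x ∉ explored vt root d M W) (hy : y ∉ explored vt root d M W) :
    explored vt root d (relink x y M) W = explored vt root d M W := by
  have h1 : ∀ w ∈ W.erase [], exitEdge vt root d (relink x y M) w = exitEdge vt root d M w :=
    fun w hw => (relink_explored hW hx hy (Finset.mem_of_mem_erase hw)).1
  rw [explored, explored, Finset.image_congr h1]
  congr 1
  refine Finset.image_congr fun w hw => ?_
  have h2 := (relink_explored hW hx hy (Finset.mem_of_mem_erase hw)).2.2.1 (Finset.ne_of_mem_erase hw)
  rw [h1 w hw, h2]

/-- Each step uses one half-edge of each colour, so for a single colour the steps are counted once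
and not twice. -/
theorem card_explored_le (hM : IsMatching vt color M) (W : Finset (List ℕ)) (c : Bool) :
    ((explored vt root d M W).filter fun h => color (vt h) = c).card ≤ (W.erase []).card := by
  refine (Finset.card_le_card (t := (W.erase []).image fun w =>
    if color (vt (exitEdge vt root d M w)) = c then exitEdge vt root d M w
      else M (exitEdge vt root d M w)) ?_).trans Finset.card_image_le
  intro h hh
  obtain ⟨h1, h2⟩ := Finset.mem_filter.1 hh
  obtain ⟨w, hw, hne, rfl | rfl⟩ := mem_explored.1 h1
  · exact Finset.mem_image.2 ⟨w, Finset.mem_erase.2 ⟨hne, hw⟩, if_pos h2⟩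
  · refine Finset.mem_image.2 ⟨w, Finset.mem_erase.2 ⟨hne, hw⟩, if_neg ?_⟩
    rw [hM.color_apply] at h2
    intro h3
    simp [h3] at h2

/-- The walks whose addresses are a suffix of `u` or of `v`. -/
def suffixes (u v : List ℕ) : Finset (List ℕ) := u.tails.toFinset ∪ v.tails.toFinset

omit [Fintype H] [DecidableEq V] [DecidableEq H] in
theorem mem_suffixes {u v w : List ℕ} : w ∈ suffixes u v ↔ w <:+ u ∨ w <:+ v := by
  simp [suffixes]

theorem card_suffixes_erase_le (u v : List ℕ) :
    ((suffixes u v).erase []).card ≤ u.length + v.length := by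
  have h : ∀ l : List ℕ, (l.tails.toFinset.erase []).card ≤ l.length := fun l => by
    have h1 := List.toFinset_card_le l.tails
    rw [List.length_tails] at h1
    rw [Finset.card_erase_of_mem (by simp)]
    omega
  rw [suffixes, Finset.erase_union_distrib]
  exact (Finset.card_union_le _ _).trans (add_le_add (h u) (h v))

/-- Switching bound for the number of matchings in which the walks `u` and `a :: v` end at the same
vertex, although the vertices visited before are distinct. -/
theorem card_collision_le (𝓜 : Finset (Equiv.Perm H)) (h𝓜 : ∀ M ∈ 𝓜, IsMatching vt color M)
    (hrel : ∀ M ∈ 𝓜, ∀ x y, color (vt x) = color (vt y) → relink x y M ∈ 𝓜)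
    (hdeg : ∀ x, (halfEdgesAt vt x).card = deg (color x)) (hroot : color root = false)
    {N : ℕ} (hN : ∀ c, N ≤ (Finset.univ.filter fun h => color (vt h) = c).card)
    {u v : List ℕ} {a : ℕ} (hu : IsAddress (branching deg) u)
    (hv : IsAddress (branching deg) (a :: v)) (huv : ¬ (a :: v) <:+ u)
    (hpar : u.length.bodd = (a :: v).length.bodd) :
    (N - (u.length + v.length)) *
      (𝓜.filter fun M => Set.InjOn (reached vt root d M) (suffixes u v) ∧
        reached vt root d M (a :: v) = reached vt root d M u).card ≤
      (deg u.length.bodd - 1) * 𝓜.card := by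
  classical
  set W := suffixes u v with hWdef
  have hW : ∀ b w, b :: w ∈ W → w ∈ W := by
    intro b w h
    rcases mem_suffixes.1 h with h | h
    · exact mem_suffixes.2 (Or.inl ((List.suffix_cons b w).trans h))
    · exact mem_suffixes.2 (Or.inr ((List.suffix_cons b w).trans h))
  have huW : u ∈ W := mem_suffixes.2 (Or.inl (List.suffix_refl _))
  have hvW : v ∈ W := mem_suffixes.2 (Or.inr (List.suffix_refl _))
  have hvW' : a :: v ∉ W := by
    intro h
    rcases mem_suffixes.1 h with h | h
    · exact huv h
    · have := h.length_le
      simp at this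
  have hWadd : ∀ w ∈ W, IsAddress (branching deg) w := by
    intro w h
    rcases mem_suffixes.1 h with h | h
    · exact hu.of_suffix h
    · exact IsAddress.of_suffix h hv.2
  set S := 𝓜.filter fun M => Set.InjOn (reached vt root d M) W with hS
  set c := u.length.bodd with hc
  let o : Equiv.Perm H → H := fun M => exitEdge vt root d M (a :: v)
  let O : Equiv.Perm H → Finset H := fun M =>
    halfEdgesAt vt (reached vt root d M u) \ explored vt root d M W
  let U : Equiv.Perm H → Finset H := fun M =>
    (Finset.univ.filter fun h => color (vt h) = c) \ explored vt root d M W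
  -- the exit half-edge of the last walk is unexplored
  have ho : ∀ M ∈ S, o M ∉ explored vt root d M W := by
    intro M hM hmem
    obtain ⟨hM𝓜, hinj⟩ := Finset.mem_filter.1 hM
    have hmat := h𝓜 M hM𝓜
    have h1 := exitEdge_mem_freeEdges (d := d) hmat hdeg hroot hv
    have h2 := vt_exitEdge (d := d) hmat hdeg hroot hv
    -- If it was explored as an exit half-edge, the two walks share their parent and last choice,
    -- which puts `a :: v` in `W`. If it was explored as an arrival half-edge, it is the one removed
    -- from `freeEdges`.
    obtain ⟨w, hw, hne, h3 | h3⟩ := mem_explored.1 hmem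
    · cases w with
      | nil => exact hne rfl
      | cons a' w =>
        have h4 := vt_exitEdge (d := d) hmat hdeg hroot (hWadd _ hw)
        have h5 : v = w := hinj hvW (hW _ _ hw) (by rw [← h2, ← h4]; exact congrArg vt h3)
        subst h5
        have h6 : a = a' := by
          have h7 := (color_reached_and_card_freeEdges (d := d) hmat hdeg hroot hv.2).2
          refine getD_toList_inj (h7 ▸ hv.1) (h7 ▸ (hWadd _ hw).1) (d := d) ?_
          rw [← exitEdge_cons, ← exitEdge_cons]
          exact h3
        subst h6
        exact hvW' hw
    · cases w with
      | nil => exact hne rfl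
      | cons a' w =>
        have h5 : v = a' :: w := hinj hvW hw (by rw [← h2]; exact congrArg vt h3)
        rw [h5, freeEdges] at h1
        refine Finset.ne_of_mem_erase h1 ?_
        rw [← h5]
        rw [← h5] at h3
        exact h3
  have hMo : ∀ M ∈ S, M (o M) ∉ explored vt root d M W := fun M hM hmem =>
    ho M hM (apply_mem_explored (h𝓜 M (Finset.mem_filter.1 hM).1) hmem)
  have hcolMo : ∀ M ∈ S, color (vt (M (o M))) = c := fun M hM => by
    have := (color_reached_and_card_freeEdges (d := d) (h𝓜 M (Finset.mem_filter.1 hM).1)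
      hdeg hroot hv).1
    rw [hpar, ← this, reached]
  have hcolo : ∀ M ∈ S, color (vt (o M)) = !c := fun M hM => by
    have h1 := hcolMo M hM
    rw [(h𝓜 M (Finset.mem_filter.1 hM).1).color_apply] at h1
    rw [← h1, Bool.not_not]
  -- invariance under the switching
  have hinv : ∀ M ∈ S, ∀ x ∈ U M, ∀ y ∈ U M, relink x y M ∈ S ∧ o (relink x y M) = o M ∧
      O (relink x y M) = O M ∧ U (relink x y M) = U M := by
    intro M hM x hx y hy
    obtain ⟨hM𝓜, hinj⟩ := Finset.mem_filter.1 hM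
    simp only [U, Finset.mem_sdiff, Finset.mem_filter, Finset.mem_univ, true_and] at hx hy
    have hre := fun w hw => relink_explored (M := M) (vt := vt) (root := root) (d := d)
      hW hx.2 hy.2 (w := w) hw
    refine ⟨Finset.mem_filter.2 ⟨hrel M hM𝓜 x y (hx.1.trans hy.1.symm), ?_⟩, ?_, ?_, ?_⟩
    · exact hinj.congr fun w hw => ((hre w hw).2.1).symm
    · simp only [o]
      rw [exitEdge_cons, exitEdge_cons, (hre v hvW).2.2.2]
    · simp only [O]
      rw [(hre u huW).2.1, explored_relink hW hx.2 hy.2]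
    · simp only [U]
      rw [explored_relink hW hx.2 hy.2]
  have hMoU : ∀ M ∈ S, M (o M) ∈ U M := fun M hM => by
    simp only [U, Finset.mem_sdiff, Finset.mem_filter, Finset.mem_univ, true_and]
    exact ⟨hcolMo M hM, hMo M hM⟩
  have hrelo : ∀ M ∈ S, ∀ b ∈ U M, relink (M (o M)) b M (o M) = b := by
    intro M hM b hb
    have hb' : color (vt b) = c := by
      simp only [U, Finset.mem_sdiff, Finset.mem_filter, Finset.mem_univ, true_and] at hb
      exact hb.1
    have h1 : o M ≠ M (o M) := fun h => by
      have h2 := hcolMo M hM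
      rw [← h, hcolo M hM] at h2
      simp at h2
    have h3 : o M ≠ b := fun h => by
      rw [← h, hcolo M hM] at hb'
      simp at hb'
    simp only [relink, Equiv.Perm.mul_apply]
    rw [Equiv.swap_apply_of_ne_of_ne h1 h3, Equiv.swap_apply_left]
  -- the double counting
  have hcount : ((S.filter fun M => reached vt root d M (a :: v) = reached vt root d M u).sigma
      U).card ≤ (S.sigma O).card := by
    -- The image records the exchanged matching and the old partner of the exit half-edge, an
    -- unexplored half-edge at the end of `u`. The pair is recovered from it: `b` is the new partner
    -- of the exit half-edge, and the exchange is an involution.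
    refine Finset.card_le_card_of_injOn
      (fun p => ⟨relink (p.1 (o p.1)) p.2 p.1, p.1 (o p.1)⟩) ?_ ?_
    · rintro ⟨M, b⟩ hp
      obtain ⟨h1, h2⟩ := Finset.mem_sigma.1 hp
      obtain ⟨h3, h4⟩ := Finset.mem_filter.1 h1
      obtain ⟨h5, h6, h7, h8⟩ := hinv M h3 _ (hMoU M h3) b h2
      refine Finset.mem_sigma.2 ⟨h5, ?_⟩
      simp only [h7]
      simp only [O, Finset.mem_sdiff, mem_halfEdgesAt]
      exact ⟨by rw [← h4, reached], hMo M h3⟩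
    · rintro ⟨M, b⟩ hp ⟨M', b'⟩ hp' heq
      obtain ⟨h1, h2⟩ := Finset.mem_sigma.1 hp
      obtain ⟨h1', h2'⟩ := Finset.mem_sigma.1 hp'
      have h3 := (Finset.mem_filter.1 h1).1
      have h3' := (Finset.mem_filter.1 h1').1
      simp only [Sigma.mk.injEq, heq_eq_eq] at heq h2 h2' h3 h3'
      obtain ⟨e1, e2⟩ := heq
      have e3 : o M = o M' := by
        rw [← (hinv M h3 _ (hMoU M h3) b h2).2.1, ← (hinv M' h3' _ (hMoU M' h3') b' h2').2.1, e1]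
      have e4 : b = b' := by
        rw [← hrelo M h3 b h2, ← hrelo M' h3' b' h2', e1, e3]
      subst e4
      have e5 : M = M' := by
        rw [← relink_relink (M (o M)) b M, e1, e2, relink_relink]
      subst e5
      rfl
  have hU : ∀ M ∈ S, N - (u.length + v.length) ≤ (U M).card := by
    intro M hM
    have h1 := card_explored_le (root := root) (d := d) (h𝓜 M (Finset.mem_filter.1 hM).1) W c
    have h2 := card_suffixes_erase_le u v
    have h3 : U M = (Finset.univ.filter fun h => color (vt h) = c) \
        (explored vt root d M W).filter fun h => color (vt h) = c := by
      ext h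
      simp only [U, Finset.mem_sdiff, Finset.mem_filter, Finset.mem_univ, true_and]
      tauto
    rw [h3]
    have h4 := Finset.le_card_sdiff ((explored vt root d M W).filter fun h => color (vt h) = c)
      (Finset.univ.filter fun h => color (vt h) = c)
    have h5 := hN c
    rw [← hWdef] at h2
    omega
  have hO : ∀ M ∈ S, (O M).card ≤ deg c - 1 := by
    intro M hM
    have hmat := h𝓜 M (Finset.mem_filter.1 hM).1
    -- One half-edge at the end of `u` is already used, which improves `deg` to `deg - 1`: the
    -- arrival half-edge of `u`, or, at the root, the first exit of `v`, which is nonempty by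
    -- parity.
    obtain ⟨h, hh1, hh2⟩ : ∃ h, vt h = reached vt root d M u ∧ h ∈ explored vt root d M W := by
      cases hu' : u with
      | cons b u' =>
        exact ⟨M (exitEdge vt root d M (b :: u')), rfl,
          apply_exitEdge_mem_explored (hu' ▸ huW) (by simp)⟩
      | nil =>
        have hv0 : v ≠ [] := by
          rintro rfl
          rw [hc, hu'] at hpar
          simp at hpar
        have h1 : [v.getLast hv0] ∈ W :=
          mem_suffixes.2 (Or.inr ⟨v.dropLast, List.dropLast_append_getLast hv0⟩)
        exact ⟨_, vt_exitEdge (d := d) hmat hdeg hroot (hWadd _ h1),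
          exitEdge_mem_explored h1 (by simp)⟩
    have h1 : O M ⊆ (halfEdgesAt vt (reached vt root d M u)).erase h := by
      intro x hx
      obtain ⟨h2, h3⟩ := Finset.mem_sdiff.1 hx
      exact Finset.mem_erase.2 ⟨fun h4 => h3 (h4 ▸ hh2), h2⟩
    refine (Finset.card_le_card h1).trans_eq ?_
    rw [Finset.card_erase_of_mem (mem_halfEdgesAt.2 hh1), hdeg,
      (color_reached_and_card_freeEdges (d := d) hmat hdeg hroot hu).1]
  rw [Finset.card_sigma, Finset.card_sigma] at hcount
  have h1 : (𝓜.filter fun M => Set.InjOn (reached vt root d M) (suffixes u v) ∧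
      reached vt root d M (a :: v) = reached vt root d M u) =
      S.filter fun M => reached vt root d M (a :: v) = reached vt root d M u := by
    rw [hS, Finset.filter_filter]
  rw [h1]
  calc _ = (S.filter fun M => reached vt root d M (a :: v) = reached vt root d M u).card •
        (N - (u.length + v.length)) := by rw [smul_eq_mul, mul_comm]
    _ ≤ ∑ M ∈ S.filter fun M => reached vt root d M (a :: v) = reached vt root d M u, (U M).card :=
        Finset.card_nsmul_le_sum _ _ _ fun M hM => hU M (Finset.mem_filter.1 hM).1
    _ ≤ ∑ M ∈ S, (O M).card := hcount
    _ ≤ S.card • (deg c - 1) := Finset.sum_le_card_nsmul _ _ _ hO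
    _ ≤ (deg c - 1) * 𝓜.card := by
        rw [smul_eq_mul, mul_comm]
        exact Nat.mul_le_mul_left _ (Finset.card_filter_le _ _)

-- Exchanging the two entries identifies increasing with decreasing pairs, and these are disjoint.
-- This saves the factor two in the union bound.
omit [Fintype H] [DecidableEq V] [DecidableEq H] in
theorem two_mul_card_lt_pairs_le {α β : Type*} [LinearOrder β] (f : α → β) (A : Finset α) :
    2 * ((A ×ˢ A).filter fun p => f p.1 < f p.2).card ≤ A.card ^ 2 := by
  classical
  have h1 : ((A ×ˢ A).filter fun p => f p.1 < f p.2).card =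
      ((A ×ˢ A).filter fun p => f p.2 < f p.1).card := by
    refine Finset.card_bij (fun p _ => p.swap) ?_ ?_ ?_
    · rintro ⟨x, y⟩ h
      simpa [and_comm] using h
    · rintro ⟨x, y⟩ _ ⟨x', y'⟩ _ h
      simpa [and_comm] using h
    · rintro ⟨x, y⟩ h
      exact ⟨⟨y, x⟩, by simpa [and_comm] using h, rfl⟩
  have h2 : Disjoint ((A ×ˢ A).filter fun p => f p.1 < f p.2)
      ((A ×ˢ A).filter fun p => f p.2 < f p.1) :=
    Finset.disjoint_filter.2 fun p _ h h' => lt_asymm h h'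
  have h3 := Finset.card_le_card (Finset.union_subset
    (Finset.filter_subset (fun p : α × α => f p.1 < f p.2) (A ×ˢ A))
    (Finset.filter_subset (fun p : α × α => f p.2 < f p.1) (A ×ˢ A)))
  rw [Finset.card_union_of_disjoint h2, Finset.card_product] at h3
  rw [sq]
  omega

/-- Addresses in breadth-first order. -/
def breadthFirst (w : List ℕ) : ℕ ×ₗ List ℕ := toLex (w.length, w)

omit [Fintype H] [DecidableEq V] [DecidableEq H] in
theorem breadthFirst_lt_of_length_lt {u v : List ℕ} (h : u.length < v.length) :
    breadthFirst u < breadthFirst v := Prod.Lex.toLex_lt_toLex.2 (Or.inl h)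

omit [Fintype H] [DecidableEq V] [DecidableEq H] in
theorem length_le_of_breadthFirst_lt {u v : List ℕ} (h : breadthFirst u < breadthFirst v) :
    u.length ≤ v.length := by
  rcases Prod.Lex.toLex_lt_toLex.1 h with h | h
  · exact h.le
  · exact h.1.le

omit [Fintype H] [DecidableEq V] [DecidableEq H] in
theorem breadthFirst_injective : Function.Injective breadthFirst := fun u v h => by
  have := congrArg (fun x => (ofLex x).2) h
  simpa [breadthFirst] using this

omit [Fintype H] [DecidableEq V] [DecidableEq H] in
theorem breadthFirst_le_of_suffix {u v : List ℕ} (h : u <:+ v) :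
    breadthFirst u ≤ breadthFirst v := by
  rcases h.length_le.lt_or_eq with h1 | h1
  · exact (breadthFirst_lt_of_length_lt h1).le
  · rw [h.eq_of_length h1]

/-- If the exploration meets a vertex twice, then two walks collide for the first time. -/
theorem exists_first_collision {T : ℕ} (hM : IsMatching vt color M)
    (hdeg : ∀ x, (halfEdgesAt vt x).card = deg (color x)) (hroot : color root = false)
    (h : ¬ TreeLike vt root d deg T M) :
    ∃ c, ∃ u ∈ parityAddresses (branching deg) T c, ∃ v ∈ parityAddresses (branching deg) T c,
      breadthFirst u < breadthFirst v ∧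
      Set.InjOn (reached vt root d M) (suffixes u v.tail) ∧
      reached vt root d M v = reached vt root d M u := by
  classical
  set A : Finset (List ℕ) := (Finset.univ : Finset Bool).biUnion
    (parityAddresses (branching deg) T) with hA
  have hmem : ∀ w, w ∈ A ↔ IsAddress (branching deg) w ∧ w.length ≤ T := by
    intro w
    simp only [hA, Finset.mem_biUnion, Finset.mem_univ, true_and, mem_parityAddresses]
    constructor
    · rintro ⟨c, h1, h2, -⟩
      exact ⟨h1, h2⟩
    · rintro ⟨h1, h2⟩
      exact ⟨_, h1, h2, rfl⟩
  set B := A.filter fun v => ∃ u ∈ A, breadthFirst u < breadthFirst v ∧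
    reached vt root d M v = reached vt root d M u with hB
  have key : ∀ x ∈ A, ∀ y ∈ A, x ≠ y → reached vt root d M x = reached vt root d M y →
      (x ∈ B ∧ breadthFirst y < breadthFirst x) ∨ (y ∈ B ∧ breadthFirst x < breadthFirst y) := by
    intro x hx y hy hxy he
    rcases lt_or_gt_of_ne (breadthFirst_injective.ne hxy) with h1 | h1
    · exact Or.inr ⟨Finset.mem_filter.2 ⟨hy, x, hx, h1, he.symm⟩, h1⟩
    · exact Or.inl ⟨Finset.mem_filter.2 ⟨hx, y, hy, h1, he⟩, h1⟩
  have hne : B.Nonempty := by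
    rw [TreeLike, Set.InjOn] at h
    push Not at h
    obtain ⟨x, hx, y, hy, h1, h2⟩ := h
    rcases key x ((hmem x).2 hx) y ((hmem y).2 hy) h2 h1 with h3 | h3
    · exact ⟨_, h3.1⟩
    · exact ⟨_, h3.1⟩
  -- The later walk is taken minimal. The ancestors of `u` and the proper ancestors of `v` all
  -- precede `v`, so a collision among them would contradict minimality.
  obtain ⟨v, hvB, hmin⟩ := B.exists_min_image breadthFirst hne
  obtain ⟨hvA, u, huA, huv, he⟩ := Finset.mem_filter.1 hvB
  have hu := (hmem u).1 huA
  have hv := (hmem v).1 hvA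
  have hcu := (color_reached_and_card_freeEdges (d := d) hM hdeg hroot hu.1).1
  have hcv := (color_reached_and_card_freeEdges (d := d) hM hdeg hroot hv.1).1
  refine ⟨u.length.bodd, u, mem_parityAddresses.2 ⟨hu.1, hu.2, rfl⟩, v,
    mem_parityAddresses.2 ⟨hv.1, hv.2, by rw [← hcu, ← hcv, he]⟩, huv, ?_, he⟩
  have hsuf : ∀ w ∈ suffixes u v.tail, w ∈ A ∧ breadthFirst w < breadthFirst v := by
    intro w hw
    rcases mem_suffixes.1 hw with hw | hw
    · exact ⟨(hmem w).2 ⟨hu.1.of_suffix hw, hw.length_le.trans hu.2⟩,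
        (breadthFirst_le_of_suffix hw).trans_lt huv⟩
    · have h1 : w <:+ v := hw.trans (List.tail_suffix v)
      refine ⟨(hmem w).2 ⟨hv.1.of_suffix h1, h1.length_le.trans hv.2⟩, ?_⟩
      cases v with
      | nil =>
        have h2 := length_le_of_breadthFirst_lt huv
        have h3 : u = [] := List.length_eq_zero_iff.1 (by simpa using h2)
        rw [h3] at huv
        exact absurd huv (lt_irrefl _)
      | cons a v =>
        refine breadthFirst_lt_of_length_lt ?_
        have := hw.length_le
        simp only [List.tail_cons] at this
        simp only [List.length_cons]
        omega
  intro x hx y hy hxy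
  by_contra hne
  obtain ⟨hxA, hxv⟩ := hsuf x hx
  obtain ⟨hyA, hyv⟩ := hsuf y hy
  rcases key x hxA y hyA hne hxy with h1 | h1
  · exact absurd (hmin x h1.1) (not_le.2 hxv)
  · exact absurd (hmin y h1.1) (not_le.2 hyv)

/-- In a uniformly random matching, the exploration up to distance `T` is likely to be a tree. -/
theorem card_not_treeLike_le (𝓜 : Finset (Equiv.Perm H)) (h𝓜 : ∀ M ∈ 𝓜, IsMatching vt color M)
    (hrel : ∀ M ∈ 𝓜, ∀ x y, color (vt x) = color (vt y) → relink x y M ∈ 𝓜)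
    (hdeg : ∀ x, (halfEdgesAt vt x).card = deg (color x)) (hroot : color root = false)
    {N : ℕ} (hN : ∀ c, N ≤ (Finset.univ.filter fun h => color (vt h) = c).card) (T : ℕ)
    [DecidablePred (TreeLike vt root d deg T)] :
    2 * (N - (2 * T - 1)) * (𝓜.filter fun M => ¬ TreeLike vt root d deg T M).card ≤
      (∑ c, (deg c - 1) * (parityAddresses (branching deg) T c).card ^ 2) * 𝓜.card := by
  classical
  let P : Bool → Finset (List ℕ × List ℕ) := fun c =>
    (parityAddresses (branching deg) T c ×ˢ parityAddresses (branching deg) T c).filter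
      fun p => breadthFirst p.1 < breadthFirst p.2
  let E : List ℕ × List ℕ → Finset (Equiv.Perm H) := fun p =>
    𝓜.filter fun M => Set.InjOn (reached vt root d M) (suffixes p.1 p.2.tail) ∧
      reached vt root d M p.2 = reached vt root d M p.1
  have h1 : (𝓜.filter fun M => ¬ TreeLike vt root d deg T M) ⊆
      Finset.univ.biUnion fun c => (P c).biUnion E := by
    intro M hM
    obtain ⟨h𝓜M, hT⟩ := Finset.mem_filter.1 hM
    obtain ⟨c, u, hu, v, hv, huv, hinj, he⟩ := exists_first_collision (h𝓜 M h𝓜M) hdeg hroot hT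
    exact Finset.mem_biUnion.2 ⟨c, Finset.mem_univ _, Finset.mem_biUnion.2 ⟨(u, v),
      Finset.mem_filter.2 ⟨Finset.mem_product.2 ⟨hu, hv⟩, huv⟩,
      Finset.mem_filter.2 ⟨h𝓜M, hinj, he⟩⟩⟩
  have h2 : ∀ c, ∀ p ∈ P c, (N - (2 * T - 1)) * (E p).card ≤ (deg c - 1) * 𝓜.card := by
    rintro c ⟨u, v⟩ hp
    obtain ⟨h3, huv⟩ := Finset.mem_filter.1 hp
    obtain ⟨hu, hv⟩ := Finset.mem_product.1 h3
    obtain ⟨hu1, hu2, hu3⟩ := mem_parityAddresses.1 hu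
    obtain ⟨hv1, hv2, hv3⟩ := mem_parityAddresses.1 hv
    have hlen := length_le_of_breadthFirst_lt huv
    cases v with
    | nil =>
      have h3 : u = [] := List.length_eq_zero_iff.1 (by simpa using hlen)
      rw [h3] at huv
      exact absurd huv (lt_irrefl _)
    | cons a v =>
      have h4 := card_collision_le (d := d) 𝓜 h𝓜 hrel hdeg hroot hN hu1 hv1
        (fun h => not_le.2 huv (breadthFirst_le_of_suffix h)) (hu3.trans hv3.symm)
      rw [hu3] at h4
      refine le_trans (Nat.mul_le_mul_right _ ?_) h4
      simp only [List.length_cons] at hlen hv2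
      omega
  -- Union bound over ordered pairs of addresses of one parity. At the first collision `u` has
  -- length at most `T` and the parent of the later walk at most `T - 1`, whence the loss `2 * T -
  -- 1`.
  calc _ ≤ 2 * (N - (2 * T - 1)) * ∑ c, ∑ p ∈ P c, (E p).card := by
        refine Nat.mul_le_mul_left _ ((Finset.card_le_card h1).trans ?_)
        exact Finset.card_biUnion_le.trans (Finset.sum_le_sum fun c _ => Finset.card_biUnion_le)
    _ = 2 * ∑ c, ∑ p ∈ P c, (N - (2 * T - 1)) * (E p).card := by
        simp only [Finset.mul_sum, mul_assoc]
    _ ≤ 2 * ∑ c, (P c).card * ((deg c - 1) * 𝓜.card) := by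
        refine Nat.mul_le_mul_left _ (Finset.sum_le_sum fun c _ => ?_)
        rw [← smul_eq_mul]
        exact Finset.sum_le_card_nsmul _ _ _ (h2 c)
    _ = ∑ c, (2 * (P c).card) * ((deg c - 1) * 𝓜.card) := by
        simp only [Finset.mul_sum, mul_assoc]
    _ ≤ ∑ c, (parityAddresses (branching deg) T c).card ^ 2 * ((deg c - 1) * 𝓜.card) :=
        Finset.sum_le_sum fun c _ => Nat.mul_le_mul_right _ (two_mul_card_lt_pairs_le _ _)
    _ = _ := by
        rw [Finset.sum_mul]
        exact Finset.sum_congr rfl fun c _ => by ring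

end Collisions

/-! ### The configuration model as a random matching. -/

noncomputable section ConfigurationModel

variable {m n ℓ r : ℕ}

/-- The half-edges of the tasks and of the workers. -/
abbrev HalfEdge (m n ℓ r : ℕ) : Type := (Fin m × Fin ℓ) ⊕ (Fin n × Fin r)

/-- The vertex of a half-edge. -/
def endpoint : HalfEdge m n ℓ r → Fin m ⊕ Fin n := Sum.map Prod.fst Prod.fst

/-- The involution of the half-edges given by a pairing. -/
def matching (π : Pairing m n ℓ r) : Equiv.Perm (HalfEdge m n ℓ r) where
  toFun := Sum.elim (fun e => Sum.inr (π e)) (fun f => Sum.inl (π.symm f))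
  invFun := Sum.elim (fun e => Sum.inr (π e)) (fun f => Sum.inl (π.symm f))
  left_inv := by rintro (e | f) <;> simp
  right_inv := by rintro (e | f) <;> simp

@[simp] theorem matching_inl (π : Pairing m n ℓ r) (e : Fin m × Fin ℓ) :
    matching π (Sum.inl e) = Sum.inr (π e) := rfl

@[simp] theorem matching_inr (π : Pairing m n ℓ r) (f : Fin n × Fin r) :
    matching π (Sum.inr f) = Sum.inl (π.symm f) := rfl

theorem matching_injective : Function.Injective (matching (m := m) (n := n) (ℓ := ℓ) (r := r)) := by
  intro π π' h
  ext1 e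
  have := Equiv.congr_fun h (Sum.inl e)
  simpa using this

/-- The degrees of the tasks (`false`) and of the workers (`true`). -/
def degrees (ℓ r : ℕ) (c : Bool) : ℕ := bif c then r else ℓ

theorem isMatching_matching (π : Pairing m n ℓ r) :
    IsMatching endpoint Sum.isRight (matching π) where
  invol := by rintro (e | f) <;> simp
  color_apply := by rintro (e | f) <;> rfl

theorem card_halfEdgesAt_endpoint (x : Fin m ⊕ Fin n) :
    (halfEdgesAt (endpoint (m := m) (n := n) (ℓ := ℓ) (r := r)) x).card =
      degrees ℓ r x.isRight := by
  rcases x with i | j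
  · have h : halfEdgesAt (endpoint (m := m) (n := n) (ℓ := ℓ) (r := r)) (Sum.inl i) =
        Finset.univ.image fun c : Fin ℓ => Sum.inl (i, c) := by
      ext x
      rcases x with ⟨i', c⟩ | ⟨j', c⟩ <;> simp [mem_halfEdgesAt, endpoint, eq_comm]
    rw [h, Finset.card_image_of_injective _ fun c c' h => by simpa using h, Finset.card_univ,
      Fintype.card_fin]
    rfl
  · have h : halfEdgesAt (endpoint (m := m) (n := n) (ℓ := ℓ) (r := r)) (Sum.inr j) =
        Finset.univ.image fun c : Fin r => Sum.inr (j, c) := by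
      ext x
      rcases x with ⟨i', c⟩ | ⟨j', c⟩ <;> simp [mem_halfEdgesAt, endpoint, eq_comm]
    rw [h, Finset.card_image_of_injective _ fun c c' h => by simpa using h, Finset.card_univ,
      Fintype.card_fin]
    rfl

theorem card_halfEdges_of_color (hmn : m * ℓ = n * r) (c : Bool) :
    m * ℓ ≤ (Finset.univ.filter fun h : HalfEdge m n ℓ r => (endpoint h).isRight = c).card := by
  cases c
  · refine le_of_eq_of_le ?_ (Finset.card_le_card (s := Finset.univ.map
      (Function.Embedding.inl : (Fin m × Fin ℓ) ↪ HalfEdge m n ℓ r)) ?_)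
    · simp
    · intro x hx
      obtain ⟨e, -, rfl⟩ := Finset.mem_map.1 hx
      simp [endpoint]
  · refine le_of_eq_of_le ?_ (Finset.card_le_card (s := Finset.univ.map
      (Function.Embedding.inr : (Fin n × Fin r) ↪ HalfEdge m n ℓ r)) ?_)
    · simp [hmn]
    · intro x hx
      obtain ⟨e, -, rfl⟩ := Finset.mem_map.1 hx
      simp [endpoint]

/-- Exchanging task half-edges precomposes the pairing with a transposition, and exchanging worker
half-edges postcomposes it. The matchings of pairings are thus closed under the switchings. -/
theorem exists_matching_eq_relink (π : Pairing m n ℓ r) (x y : HalfEdge m n ℓ r)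
    (h : (endpoint x).isRight = (endpoint y).isRight) :
    ∃ π' : Pairing m n ℓ r, matching π' = relink x y (matching π) := by
  rcases x with a | a <;> rcases y with b | b
  · refine ⟨(Equiv.swap a b).trans π, ?_⟩
    ext1 z
    simp only [relink, Equiv.Perm.mul_apply]
    rcases z with z | z
    · rw [Sum.inl_injective.swap_apply, matching_inl, matching_inl,
        Equiv.swap_apply_of_ne_of_ne Sum.inr_ne_inl Sum.inr_ne_inl]
      simp
    · rw [Equiv.swap_apply_of_ne_of_ne (x := Sum.inr z) Sum.inr_ne_inl Sum.inr_ne_inl,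
        matching_inr, matching_inr, Sum.inl_injective.swap_apply]
      simp
  · simp [endpoint] at h
  · simp [endpoint] at h
  · refine ⟨π.trans (Equiv.swap a b), ?_⟩
    ext1 z
    simp only [relink, Equiv.Perm.mul_apply]
    rcases z with z | z
    · rw [Equiv.swap_apply_of_ne_of_ne (x := Sum.inl z) Sum.inl_ne_inr Sum.inl_ne_inr,
        matching_inl, matching_inl, Sum.inr_injective.swap_apply]
      simp
    · rw [Sum.inr_injective.swap_apply, matching_inr, matching_inr,
        Equiv.swap_apply_of_ne_of_ne Sum.inl_ne_inr Sum.inl_ne_inr]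
      simp

theorem prod_branching_odd (K : ℕ) :
    ∏ s ∈ Finset.range (2 * K + 1), branching (degrees ℓ r) s =
      ℓ * ((ℓ - 1) * (r - 1)) ^ K := by
  induction K with
  | zero => simp [branching, degrees]
  | succ K ih =>
    rw [show 2 * (K + 1) + 1 = 2 * K + 1 + 1 + 1 by ring, Finset.prod_range_succ,
      Finset.prod_range_succ, ih]
    simp [branching, degrees, pow_succ]
    ring

theorem prod_branching_even (K : ℕ) :
    ∏ s ∈ Finset.range (2 * K + 2), branching (degrees ℓ r) s =
      ℓ * (r - 1) * ((ℓ - 1) * (r - 1)) ^ K := by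
  rw [Finset.prod_range_succ, prod_branching_odd]
  simp [branching, degrees]
  ring

/-- The levels of odd depth form a geometric progression of ratio at least two, so their sum is at
most twice the last term. -/
theorem card_workerAddresses_le (hℓ : 0 < ℓ) (hd : 2 ≤ (ℓ - 1) * (r - 1)) (K : ℕ) :
    (parityAddresses (branching (degrees ℓ r)) (2 * K + 1) true).card ≤
      2 * ℓ * ((ℓ - 1) * (r - 1)) ^ K := by
  refine (card_parityAddresses_le _ _ _).trans ?_
  rw [Finset.sum_filter]
  induction K with
  | zero =>
    simp [Finset.sum_range_succ, branching, degrees]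
    omega
  | succ K ih =>
    rw [show 2 * (K + 1) + 1 + 1 = 2 * K + 1 + 1 + 1 + 1 by ring, Finset.sum_range_succ,
      Finset.sum_range_succ, if_neg (by simp), if_pos (by simp),
      show 2 * K + 1 + 1 + 1 = 2 * (K + 1) + 1 by ring, prod_branching_odd]
    have h1 : ((ℓ - 1) * (r - 1)) ^ (K + 1) = ((ℓ - 1) * (r - 1)) ^ K * ((ℓ - 1) * (r - 1)) :=
      pow_succ _ _
    have h2 := Nat.mul_le_mul_left (ℓ * ((ℓ - 1) * (r - 1)) ^ K) hd
    nlinarith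

/-- The same geometric sum for even depths. The last level has depth `2 * K`, one power behind the
workers, and multiplying by the ratio avoids the exponent `K - 1`. -/
theorem mul_card_taskAddresses_le (hℓ : 0 < ℓ) (hd : 2 ≤ (ℓ - 1) * (r - 1)) (K : ℕ) :
    (ℓ - 1) * (r - 1) * (parityAddresses (branching (degrees ℓ r)) (2 * K + 1) false).card ≤
      2 * ℓ * (r - 1) * ((ℓ - 1) * (r - 1)) ^ K := by
  refine (Nat.mul_le_mul_left _ (card_parityAddresses_le _ _ _)).trans ?_
  rw [Finset.sum_filter]
  induction K with
  | zero =>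
    simp [Finset.sum_range_succ]
    refine Nat.mul_le_mul_right _ ?_
    omega
  | succ K ih =>
    rw [show 2 * (K + 1) + 1 + 1 = 2 * K + 1 + 1 + 1 + 1 by ring, Finset.sum_range_succ,
      Finset.sum_range_succ, if_pos (by simp), if_neg (by simp), prod_branching_even]
    have h1 : ((ℓ - 1) * (r - 1)) ^ (K + 1) = ((ℓ - 1) * (r - 1)) ^ K * ((ℓ - 1) * (r - 1)) :=
      pow_succ _ _
    have h2 := Nat.mul_le_mul_left (ℓ * (r - 1) * ((ℓ - 1) * (r - 1)) ^ K) hd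
    generalize (ℓ - 1) * (r - 1) = δ at *
    rw [mul_assoc 2 ℓ (r - 1)] at ih ⊢
    generalize ℓ * (r - 1) = A at *
    rw [h1]
    nlinarith

/-- The pairings for which the neighbourhood of radius `2 k - 1` of the task `i` is a tree. -/
def IsLocalTree (d : HalfEdge m n ℓ r) (k : ℕ) (i : Fin m) (π : Pairing m n ℓ r) : Prop :=
  TreeLike endpoint (Sum.inl i) d (degrees ℓ r) (2 * k - 1) (matching π)

theorem card_not_isLocalTree_le (hℓ : 1 < ℓ) (hr : 2 < r) (hmn : m * ℓ = n * r)
    (d : HalfEdge m n ℓ r) (K : ℕ) (i : Fin m) [DecidablePred (IsLocalTree d (K + 1) i)] :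
    (m * ℓ - (4 * K + 1)) *
      ((Finset.univ : Finset (Pairing m n ℓ r)).filter fun π => ¬ IsLocalTree d (K + 1) i π).card ≤
      3 * ℓ ^ 2 * (r - 1) * ((ℓ - 1) * (r - 1)) ^ (2 * K) * Fintype.card (Pairing m n ℓ r) := by
  classical
  have hd : 2 ≤ (ℓ - 1) * (r - 1) := by
    have : 1 * 2 ≤ (ℓ - 1) * (r - 1) := Nat.mul_le_mul (by omega) (by omega)
    simpa using this
  set 𝓜 : Finset (Equiv.Perm (HalfEdge m n ℓ r)) := Finset.univ.image matching with h𝓜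
  have h1 := card_not_treeLike_le (vt := endpoint) (root := Sum.inl i) (d := d)
    (color := Sum.isRight) (deg := degrees ℓ r) 𝓜
    (by
      intro M hM
      obtain ⟨π, -, rfl⟩ := Finset.mem_image.1 hM
      exact isMatching_matching π)
    (by
      intro M hM x y hxy
      obtain ⟨π, -, rfl⟩ := Finset.mem_image.1 hM
      obtain ⟨π', h⟩ := exists_matching_eq_relink π x y hxy
      exact Finset.mem_image.2 ⟨π', Finset.mem_univ _, h⟩)
    card_halfEdgesAt_endpoint rfl (card_halfEdges_of_color hmn) (2 * K + 1)
  have h2 : (𝓜.filter fun M => ¬ TreeLike endpoint (Sum.inl i) d (degrees ℓ r) (2 * K + 1) M).card =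
      ((Finset.univ : Finset (Pairing m n ℓ r)).filter
        fun π => ¬ IsLocalTree d (K + 1) i π).card := by
    rw [h𝓜, Finset.filter_image, Finset.card_image_of_injective _ matching_injective]
    congr 1
    ext π
    rw [Finset.mem_filter, Finset.mem_filter]
    rfl
  have h3 : 𝓜.card = Fintype.card (Pairing m n ℓ r) := by
    rw [h𝓜, Finset.card_image_of_injective _ matching_injective, Finset.card_univ]
  rw [h2, h3, show 2 * (2 * K + 1) - 1 = 4 * K + 1 by omega] at h1
  have hw := card_workerAddresses_le (r := r) (by omega : 0 < ℓ) hd K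
  have ht := mul_card_taskAddresses_le (r := r) (by omega : 0 < ℓ) hd K
  set Nw := (parityAddresses (branching (degrees ℓ r)) (2 * K + 1) true).card
  set Nt := (parityAddresses (branching (degrees ℓ r)) (2 * K + 1) false).card
  have h4 : ∑ c, (degrees ℓ r c - 1) *
      (parityAddresses (branching (degrees ℓ r)) (2 * K + 1) c).card ^ 2 =
      (r - 1) * Nw ^ 2 + (ℓ - 1) * Nt ^ 2 := by
    rw [Fintype.sum_bool]
    rfl
  rw [h4] at h1
  set p := ℓ - 1
  set q := r - 1
  have hq : 0 < q := by omega
  -- With `B = ℓ² q (pq)^(2K)`, pairs of workers contribute at most `4B` and pairs of tasks at most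
  -- `2B`, the latter by `2 ≤ pq`. Half of `6B` is the constant `3` of the theorem.
  have h5 : q * Nw ^ 2 ≤ 4 * (ℓ ^ 2 * q * (p * q) ^ (2 * K)) := by
    calc q * Nw ^ 2 ≤ q * (2 * ℓ * (p * q) ^ K) ^ 2 :=
          Nat.mul_le_mul_left _ (Nat.pow_le_pow_left hw 2)
      _ = _ := by rw [mul_comm 2 K, pow_mul]; ring
  have h6 : p * Nt ^ 2 ≤ 2 * (ℓ ^ 2 * q * (p * q) ^ (2 * K)) := by
    have h7 : (p * q * q) * (2 * (p * Nt ^ 2)) ≤ (p * q * q) * (4 * (ℓ ^ 2 * q * (p * q) ^ (2 * K))) := by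
      calc (p * q * q) * (2 * (p * Nt ^ 2)) = 2 * (p * q * Nt) ^ 2 := by ring
        _ ≤ (p * q) * (p * q * Nt) ^ 2 := Nat.mul_le_mul_right _ hd
        _ ≤ (p * q) * (2 * ℓ * q * (p * q) ^ K) ^ 2 :=
            Nat.mul_le_mul_left _ (Nat.pow_le_pow_left ht 2)
        _ = _ := by rw [mul_comm 2 K, pow_mul]; ring
    have h8 := Nat.le_of_mul_le_mul_left h7 (Nat.mul_pos (by omega) hq)
    omega
  have h7 : 2 * ((m * ℓ - (4 * K + 1)) * ((Finset.univ : Finset (Pairing m n ℓ r)).filter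
      fun π => ¬ IsLocalTree d (K + 1) i π).card) ≤
      2 * (3 * ℓ ^ 2 * q * (p * q) ^ (2 * K) * Fintype.card (Pairing m n ℓ r)) := by
    calc _ = _ := (mul_assoc _ _ _).symm
      _ ≤ _ := h1
      _ ≤ (4 * (ℓ ^ 2 * q * (p * q) ^ (2 * K)) + 2 * (ℓ ^ 2 * q * (p * q) ^ (2 * K))) *
          Fintype.card (Pairing m n ℓ r) := Nat.mul_le_mul_right _ (add_le_add h5 h6)
      _ = _ := by ring
  omega

theorem nonempty_pairing (hmn : m * ℓ = n * r) : Nonempty (Pairing m n ℓ r) :=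
  ⟨Fintype.equivOfCardEq (by simpa using hmn)⟩

theorem uniformOn_not_isLocalTree_le (hℓ : 1 < ℓ) (hr : 2 < r) (hmn : m * ℓ = n * r)
    (d : HalfEdge m n ℓ r) {k : ℕ} (hk : 1 ≤ k) (i : Fin m) :
    uniformOn (Set.univ : Set (Pairing m n ℓ r)) {π | ¬ IsLocalTree d k i π} ≤
      ENNReal.ofReal (3 * (ℓ : ℝ) * (r : ℝ) / (m : ℝ) *
        (((ℓ : ℝ) - 1) * ((r : ℝ) - 1)) ^ (2 * k - 2)) := by
  classical
  obtain ⟨K, rfl⟩ : ∃ K, k = K + 1 := ⟨k - 1, by omega⟩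
  have := nonempty_pairing hmn
  have : MeasurableSingletonClass (Pairing m n ℓ r) := ⟨fun _ => trivial⟩
  have hmpos : 0 < m := i.pos
  have hd : 2 ≤ (ℓ - 1) * (r - 1) := by
    have : 1 * 2 ≤ (ℓ - 1) * (r - 1) := Nat.mul_le_mul (by omega) (by omega)
    simpa using this
  set D : ℝ := (((ℓ : ℝ) - 1) * ((r : ℝ) - 1)) ^ (2 * (K + 1) - 2) with hD
  have hDcast : D = (((ℓ - 1) * (r - 1)) ^ (2 * K) : ℕ) := by
    rw [hD]
    push_cast [Nat.cast_sub hℓ.le, Nat.cast_sub (show 1 ≤ r by omega)]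
    congr 1
  have hℓ' : (2 : ℝ) ≤ ℓ := by exact_mod_cast hℓ
  have hr' : (3 : ℝ) ≤ r := by exact_mod_cast hr
  have hm' : (0 : ℝ) < m := by exact_mod_cast hmpos
  have hDK : (4 : ℝ) ^ K ≤ D := by
    rw [hDcast]
    have : 4 ^ K ≤ ((ℓ - 1) * (r - 1)) ^ (2 * K) := by
      rw [pow_mul]
      exact Nat.pow_le_pow_left (by nlinarith) K
    exact_mod_cast this
  have hK : (4 * K + 1 : ℝ) ≤ 4 * 4 ^ K := by
    have : K + 1 ≤ 4 ^ K := Nat.lt_pow_self (by norm_num)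
    have h2 : ((K + 1 : ℕ) : ℝ) ≤ ((4 ^ K : ℕ) : ℝ) := by exact_mod_cast this
    push_cast at h2
    linarith
  -- For such small `m` the claimed bound is at least one.
  rcases le_or_gt (m : ℝ) (3 * ℓ * r * D) with hm | hm
  · refine prob_le_one.trans ?_
    rw [← ENNReal.ofReal_one]
    refine ENNReal.ofReal_le_ofReal ?_
    rw [div_mul_eq_mul_div, le_div_iff₀ hm']
    linarith
  · have h1 := card_not_isLocalTree_le hℓ hr hmn d K i
    set bad := ((Finset.univ : Finset (Pairing m n ℓ r)).filter
      fun π => ¬ IsLocalTree d (K + 1) i π) with hbad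
    have hcard : (0 : ℝ) < Fintype.card (Pairing m n ℓ r) := by
      exact_mod_cast Fintype.card_pos
    have h2 : {π : Pairing m n ℓ r | ¬ IsLocalTree d (K + 1) i π} = (bad : Set _) := by
      ext π
      simp [hbad]
    rw [uniformOn_univ, h2, Measure.count_apply_finset]
    have h3 : ((bad.card : ENNReal) / (Fintype.card (Pairing m n ℓ r) : ENNReal)) =
        ENNReal.ofReal ((bad.card : ℝ) / Fintype.card (Pairing m n ℓ r)) := by
      rw [ENNReal.ofReal_div_of_pos hcard, ENNReal.ofReal_natCast, ENNReal.ofReal_natCast]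
    rw [h3]
    refine ENNReal.ofReal_le_ofReal ?_
    -- For large `m` the loss of `4K + 1` half-edges in the denominator is paid for by relaxing `r -
    -- 1` to `r` in the numerator.
    have hre : (r : ℝ) * (4 * K + 1) ≤ m * ℓ := by
      have h5 : (r : ℝ) * (4 * K + 1) ≤ r * (4 * D) :=
        mul_le_mul_of_nonneg_left (hK.trans (by linarith)) (by linarith)
      have hD0 : 0 < D := lt_of_lt_of_le (by positivity) hDK
      have h6 : (3 * ℓ * r * D) * ℓ ≤ m * ℓ := mul_le_mul_of_nonneg_right hm.le (by linarith)
      have h7 : r * D * 4 ≤ r * D * (3 * (ℓ * ℓ)) :=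
        mul_le_mul_of_nonneg_left (by nlinarith) (by positivity)
      linarith
    have h4 : (((m : ℝ) * ℓ - (4 * K + 1)) * bad.card) ≤
        3 * ℓ ^ 2 * ((r : ℝ) - 1) * D * Fintype.card (Pairing m n ℓ r) := by
      have h5 : 4 * K + 1 ≤ m * ℓ := by
        have : (4 * K + 1 : ℝ) ≤ m * ℓ := by nlinarith
        exact_mod_cast this
      have h6 : (((m * ℓ - (4 * K + 1)) * bad.card : ℕ) : ℝ) ≤ _ := Nat.cast_le.2 h1
      push_cast [Nat.cast_sub h5, Nat.cast_sub (show 1 ≤ r by omega)] at h6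
      rw [hDcast]
      push_cast [Nat.cast_sub (show 1 ≤ r by omega)]
      linarith
    rw [div_le_iff₀ hcard, div_mul_eq_mul_div, div_mul_eq_mul_div, le_div_iff₀ hm']
    have h5 : (m : ℝ) * ℓ * (r - 1) ≤ r * (m * ℓ - (4 * K + 1)) := by linarith
    have h6 : (ℓ : ℝ) * (r - 1) * ((bad.card : ℝ) * m) ≤
        ℓ * (r - 1) * (3 * ℓ * r * D * Fintype.card (Pairing m n ℓ r)) := by
      calc (ℓ : ℝ) * (r - 1) * ((bad.card : ℝ) * m) = (m * ℓ * (r - 1)) * bad.card := by ring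
        _ ≤ (r * (m * ℓ - (4 * K + 1))) * bad.card :=
            mul_le_mul_of_nonneg_right h5 (by positivity)
        _ = r * (((m : ℝ) * ℓ - (4 * K + 1)) * bad.card) := by ring
        _ ≤ r * (3 * ℓ ^ 2 * ((r : ℝ) - 1) * D * Fintype.card (Pairing m n ℓ r)) :=
            mul_le_mul_of_nonneg_left h4 (by linarith)
        _ = _ := by ring
    exact le_of_mul_le_mul_left h6 (mul_pos (by linarith) (by linarith))

end ConfigurationModel

/-! ### Marginals of products of functions of disjoint sets of variables -/

section Marginals

variable {δ : Type*} [DecidableEq δ] {X : δ → Type*} [∀ i, MeasurableSpace (X i)]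
  {μ : ∀ i, Measure (X i)}

omit [∀ i, MeasurableSpace (X i)] in
theorem dependsOn_apply_updateFinset {β : Type*} {g : (∀ i, X i) → β} {D : Set δ} {s : Finset δ}
    (hg : DependsOn g D) (hD : Disjoint D s) (x : ∀ i, X i) (y : ∀ i : s, X i) :
    g (Function.updateFinset x s y) = g x := by
  refine hg fun i hi => ?_
  have : i ∉ s := fun h => Set.disjoint_left.1 hD hi h
  simp [Function.updateFinset, this]

theorem dependsOn_lmarginal {f : (∀ i, X i) → ENNReal} {D : Set δ} (hf : DependsOn f D)
    (s : Finset δ) : DependsOn (∫⋯∫⁻_s, f ∂μ) D := by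
  intro x y h
  refine lintegral_congr fun z => hf fun i hi => ?_
  by_cases his : i ∈ s <;> simp [Function.updateFinset, his, h i hi]

theorem lmarginal_mul_left {f g : (∀ i, X i) → ENNReal} (hf : Measurable f) {D : Set δ}
    {s : Finset δ} (hg : DependsOn g D) (hD : Disjoint D s) (x : ∀ i, X i) :
    (∫⋯∫⁻_s, (fun y => g y * f y) ∂μ) x = g x * (∫⋯∫⁻_s, f ∂μ) x := by
  simp only [lmarginal, dependsOn_apply_updateFinset hg hD]
  exact lintegral_const_mul _ (hf.comp measurable_updateFinset)

/-- Conditional independence in integral form. The factors may share variables outside the blocks,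
as sibling subtrees share the quality of their parent; only the blocks integrated out must be
private. -/
theorem lmarginal_biUnion_prod [∀ i, SigmaFinite (μ i)] {κ : Type*} [DecidableEq κ] (t : Finset κ)
    (blk : κ → Finset δ) (D : κ → Set δ) (f : κ → (∀ i, X i) → ENNReal)
    (hf : ∀ a, Measurable (f a)) (hfD : ∀ a, DependsOn (f a) (D a))
    (hblk : ∀ a ∈ t, ∀ b ∈ t, a ≠ b → Disjoint (blk a) (blk b))
    (hD : ∀ a ∈ t, ∀ b ∈ t, a ≠ b → Disjoint (D a) (blk b)) (x : ∀ i, X i) :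
    (∫⋯∫⁻_t.biUnion blk, (fun y => ∏ a ∈ t, f a y) ∂μ) x =
      ∏ a ∈ t, (∫⋯∫⁻_blk a, f a ∂μ) x := by
  induction t using Finset.induction_on generalizing x with
  | empty => simp
  | insert a t ha ih =>
    have hne : ∀ b ∈ t, a ≠ b := fun b hb => (ne_of_mem_of_not_mem hb ha).symm
    have hmt : Measurable fun y => ∏ a ∈ t, f a y := Finset.measurable_fun_prod t fun b _ => hf b
    have h1 : Disjoint (blk a) (t.biUnion blk) := (Finset.disjoint_biUnion_right _ _ _).2
      fun b hb => hblk a (by simp) b (by simp [hb]) (hne b hb)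
    have h2 : Disjoint (D a) (t.biUnion blk : Finset δ) := by
      rw [Finset.coe_biUnion]
      exact Set.disjoint_iUnion₂_right.2
        fun b hb => hD a (by simp) b (by simp [Finset.mem_coe.1 hb]) (hne b hb)
    have ih' := ih (fun a ha b hb => hblk a (by simp [ha]) b (by simp [hb]))
      (fun a ha b hb => hD a (by simp [ha]) b (by simp [hb]))
    simp only [Finset.prod_insert ha, Finset.biUnion_insert]
    rw [lmarginal_union' μ (fun y => f a y * ∏ a ∈ t, f a y) ((hf a).mul hmt) h1]
    have h4 : (∫⋯∫⁻_blk a, (fun y => f a y * ∏ a ∈ t, f a y) ∂μ) =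
        fun y => (∏ a ∈ t, f a y) * (∫⋯∫⁻_blk a, f a ∂μ) y := by
      funext y
      have h5 : DependsOn (fun y => ∏ a ∈ t, f a y) (⋃ b ∈ t, D b) := by
        intro x y h
        exact Finset.prod_congr rfl fun b hb =>
          hfD b fun i hi => h i (Set.mem_iUnion₂.2 ⟨b, hb, hi⟩)
      have h6 : Disjoint (⋃ b ∈ t, D b) (blk a : Set δ) :=
        Set.disjoint_iUnion₂_left.2
          fun b hb => hD b (by simp [hb]) a (by simp) (hne b hb).symm
      rw [← lmarginal_mul_left (hf a) h5 h6]
      simp only [mul_comm]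
    rw [h4]
    have h7 : (fun y => (∏ a ∈ t, f a y) * (∫⋯∫⁻_blk a, f a ∂μ) y) =
        fun y => (∫⋯∫⁻_blk a, f a ∂μ) y * (∏ a ∈ t, f a y) := by
      funext y
      rw [mul_comm]
    rw [h7, lmarginal_mul_left hmt (dependsOn_lmarginal (hfD a) _) h2, ih']

end Marginals

/-! ### Exponential moments -/

section ExponentialMoments

/-- Fourth-order Taylor bound. The constant is small enough that `1/2 + 25/16 * 63/100 ≤ 3/2`, as
`lintegral_node_le` requires. -/
theorem exp_le_one_add_add_sq {x : ℝ} (hx : |x| ≤ 5 / 8) :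
    Real.exp x ≤ 1 + x + 63 / 100 * x ^ 2 := by
  have h1 := (abs_le.1 (Real.exp_bound (x := x) (by linarith) (n := 4) (by norm_num))).2
  simp only [Finset.sum_range_succ, Finset.sum_range_zero, Nat.factorial] at h1
  have h2 : |x| ^ 4 = x ^ 2 * x ^ 2 := by rw [← abs_pow, abs_of_nonneg (by positivity)]; ring
  have h3 := abs_le.1 hx
  have h4 : x ^ 2 ≤ 25 / 64 := by nlinarith
  have h5 : x ^ 2 * x ≤ x ^ 2 * (5 / 8) := mul_le_mul_of_nonneg_left h3.2 (sq_nonneg x)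
  have h6 : x ^ 2 * x ^ 2 ≤ x ^ 2 * (25 / 64) := mul_le_mul_of_nonneg_left h4 (sq_nonneg x)
  rw [h2] at h1
  norm_num at h1
  nlinarith

/-- Hoeffding's bound on the moment generating function. -/
theorem lintegral_exp_le_of_abs_le_one {Ω : Type*} [MeasurableSpace Ω] (ν : Measure Ω)
    [IsProbabilityMeasure ν] {Y : Ω → ℝ} (hY : Measurable Y) (hY1 : ∀ ω, |Y ω| ≤ 1) (y : ℝ) :
    ∫⁻ ω, ENNReal.ofReal (Real.exp (y * Y ω)) ∂ν ≤
      ENNReal.ofReal (Real.exp (y * (∫ ω, Y ω ∂ν) + y ^ 2 / 2)) := by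
  have h := hasSubgaussianMGF_of_mem_Icc (μ := ν) (X := Y) (a := -1) (b := 1) hY.aemeasurable
    (Filter.Eventually.of_forall fun ω => abs_le.1 (hY1 ω))
  have h2 := h.mgf_le y
  have hc : (((‖(1 : ℝ) - -1‖₊ / 2) ^ 2 : NNReal) : ℝ) = 1 := by
    simp only [NNReal.coe_pow, NNReal.coe_div, coe_nnnorm, Real.norm_eq_abs, NNReal.coe_ofNat]
    norm_num
  rw [hc, mgf, one_mul] at h2
  have hint := h.integrable_exp_mul y
  have h3 : ∀ ω, Real.exp (y * Y ω) =
      Real.exp (y * ∫ ω, Y ω ∂ν) * Real.exp (y * (Y ω - ∫ ω, Y ω ∂ν)) := fun ω => by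
    rw [← Real.exp_add]
    ring_nf
  have hint' : Integrable (fun ω => Real.exp (y * Y ω)) ν := by
    simp only [h3]
    exact hint.const_mul _
  rw [← ofReal_integral_eq_lintegral_ofReal hint'
    (Filter.Eventually.of_forall fun ω => (Real.exp_pos _).le)]
  refine ENNReal.ofReal_le_ofReal ?_
  simp only [h3]
  rw [integral_const_mul, Real.exp_add]
  exact mul_le_mul_of_nonneg_left h2 (Real.exp_pos _).le

theorem measurable_response {Ω : Type*} [MeasurableSpace Ω] {f g h : Ω → ℝ} (hf : Measurable f)
    (hg : Measurable g) (hh : Measurable h) : Measurable fun ω => response (f ω) (g ω) (h ω) := by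
  unfold response
  refine Measurable.ite (measurableSet_le hh (by fun_prop)) ?_ ?_ <;> fun_prop

/-- Symmetry lets one recursion treat task and worker nodes alike, with the quality of the child
always listed first. -/
theorem response_comm (q p u : ℝ) : response q p u = response p q u := by
  unfold response
  congr 1
  ring_nf

theorem response_sq (q p u : ℝ) : response q p u ^ 2 = 1 := by
  unfold response
  split_ifs <;> norm_num

theorem abs_response (q p u : ℝ) : |response q p u| = 1 := by
  unfold response
  split_ifs <;> norm_num

theorem integral_response {q p : ℝ} (hq : q ∈ Set.Icc (0 : ℝ) 1) (hp : p ∈ Set.Icc (0 : ℝ) 1) :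
    ∫ u : unitInterval, response q p u = (2 * q - 1) * (2 * p - 1) := by
  set τ : ℝ := q * p + (1 - q) * (1 - p) with hτ
  have hτ0 : 0 ≤ τ := add_nonneg (mul_nonneg hq.1 hp.1)
    (mul_nonneg (sub_nonneg.2 hq.2) (sub_nonneg.2 hp.2))
  have hτ1 : τ ≤ 1 := by
    have h1 := mul_le_of_le_one_right hq.1 hp.2
    have h2 := mul_le_of_le_one_right (sub_nonneg.2 hq.2) (by linarith [hp.1] : 1 - p ≤ 1)
    linarith
  have h1 : ∀ u : unitInterval, response q p u =
      2 * (Set.Iic (⟨τ, hτ0, hτ1⟩ : unitInterval)).indicator (fun _ => (1 : ℝ)) u - 1 := fun u => by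
    have : (u : ℝ) ≤ τ ↔ u ∈ Set.Iic (⟨τ, hτ0, hτ1⟩ : unitInterval) := by
      rw [Set.mem_Iic, ← Subtype.coe_le_coe]
    by_cases hu : (u : ℝ) ≤ τ
    · rw [response, if_pos hu, Set.indicator_of_mem (this.1 hu)]
      norm_num
    · rw [response, if_neg hu, Set.indicator_of_notMem (fun h => hu (this.2 h))]
      norm_num
  simp only [h1]
  have hint : Integrable ((Set.Iic (⟨τ, hτ0, hτ1⟩ : unitInterval)).indicator
      (fun _ => (1 : ℝ))) := (integrable_const 1).indicator measurableSet_Iic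
  rw [integral_sub (hint.const_mul 2) (integrable_const 1), integral_const_mul,
    integral_indicator_const _ measurableSet_Iic, measureReal_def, unitInterval.volume_Iic,
    ENNReal.toReal_ofReal hτ0]
  simp [hτ]
  ring

theorem abs_two_mul_sub_one_le {q : ℝ} (hq : q ∈ Set.Icc (0 : ℝ) 1) : |2 * q - 1| ≤ 1 :=
  abs_le.2 ⟨by linarith [hq.1], by linarith [hq.2]⟩

variable (P : Measure unitInterval) [IsProbabilityMeasure P] {φ : unitInterval → ℝ}

theorem integrable_of_abs_le_one {Ω : Type*} [MeasurableSpace Ω] (ν : Measure Ω)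
    [IsProbabilityMeasure ν] {Y : Ω → ℝ} (hY : Measurable Y) (hY1 : ∀ ω, |Y ω| ≤ 1) :
    Integrable Y ν :=
  Integrable.of_bound hY.aestronglyMeasurable 1 (Filter.Eventually.of_forall hY1)

/-- Exponential moment of the contribution of a leaf with random quality. -/
theorem lintegral_leaf_le (hφ : Measurable φ) (hφ1 : ∀ p, φ p ∈ Set.Icc (0 : ℝ) 1)
    {q : ℝ} (hq : q ∈ Set.Icc (0 : ℝ) 1) (c : ℝ) :
    ∫⁻ p, ∫⁻ u : unitInterval, ∫⁻ z,
        ENNReal.ofReal (Real.exp (c * (response (φ p) q u * z))) ∂gaussianReal 1 1 ∂volume ∂P ≤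
      ENNReal.ofReal (Real.exp ((∫ p, (2 * φ p - 1) ∂P) * (2 * q - 1) * c + c ^ 2)) := by
  -- As the response squares to one, the Gaussian contributes `c² / 2` whatever its sign. Hoeffding
  -- for the response adds another `c² / 2`, which gives the variance proxy `2` at the leaves.
  have h1 : ∀ (p u : unitInterval), ∫⁻ z,
      ENNReal.ofReal (Real.exp (c * (response (φ p) q u * z))) ∂gaussianReal 1 1 =
      ENNReal.ofReal (Real.exp (c ^ 2 / 2)) *
        ENNReal.ofReal (Real.exp (c * response (φ p) q u)) := by
    intro p u
    simp only [← mul_assoc]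
    rw [← ofReal_integral_eq_lintegral_ofReal (integrable_exp_mul_gaussianReal _)
      (Filter.Eventually.of_forall fun ω => (Real.exp_pos _).le)]
    have h2 := congrFun (mgf_fun_id_gaussianReal (μ := 1) (v := 1)) (c * response (φ p) q u)
    rw [mgf] at h2
    rw [h2, ← ENNReal.ofReal_mul (Real.exp_pos _).le, ← Real.exp_add]
    congr 2
    rw [mul_pow, response_sq]
    push_cast
    ring
  have hmeas : Measurable fun x : unitInterval × unitInterval =>
      response (φ x.1) q (x.2 : ℝ) := by
    refine measurable_response ?_ ?_ ?_ <;> fun_prop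
  have h3 : ∫⁻ p, ∫⁻ u : unitInterval, ENNReal.ofReal (Real.exp (c * response (φ p) q u)) ∂volume ∂P =
      ∫⁻ x : unitInterval × unitInterval,
        ENNReal.ofReal (Real.exp (c * response (φ x.1) q (x.2 : ℝ))) ∂P.prod volume := by
    rw [lintegral_prod]
    exact ((hmeas.const_mul c).exp.ennreal_ofReal).aemeasurable
  have h4 := lintegral_exp_le_of_abs_le_one (P.prod volume) hmeas
    (fun x => (abs_response _ _ _).le) c
  have h5 : ∫ x : unitInterval × unitInterval, response (φ x.1) q (x.2 : ℝ) ∂P.prod volume =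
      (∫ p, (2 * φ p - 1) ∂P) * (2 * q - 1) := by
    rw [integral_prod _ (integrable_of_abs_le_one _ hmeas fun x => (abs_response _ _ _).le)]
    simp only [integral_response (hφ1 _) hq]
    rw [integral_mul_const]
  simp only [h1]
  have h6 : ∀ p : unitInterval, Measurable fun u : unitInterval =>
      ENNReal.ofReal (Real.exp (c * response (φ p) q u)) := fun p => by
    have := hmeas.comp (measurable_prodMk_left (x := p))
    simp only [Function.comp_def] at this
    fun_prop
  have h7 : Measurable fun p : unitInterval => ∫⁻ u : unitInterval,
      ENNReal.ofReal (Real.exp (c * response (φ p) q u)) := by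
    refine Measurable.lintegral_prod_right' (f := fun x : unitInterval × unitInterval =>
      ENNReal.ofReal (Real.exp (c * response (φ x.1) q (x.2 : ℝ)))) ?_
    fun_prop
  calc _ = ENNReal.ofReal (Real.exp (c ^ 2 / 2)) *
        ∫⁻ p, ∫⁻ u : unitInterval, ENNReal.ofReal (Real.exp (c * response (φ p) q u)) ∂volume ∂P := by
        rw [← lintegral_const_mul _ h7]
        exact lintegral_congr fun p => lintegral_const_mul _ (h6 p)
    _ ≤ _ := by
        rw [h3]
        refine (mul_le_mul_right h4 _).trans_eq ?_
        rw [h5, ← ENNReal.ofReal_mul (Real.exp_pos _).le, ← Real.exp_add]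
        congr 2
        ring

/-- Exponential moment of the contribution of an inner node with random quality. -/
theorem lintegral_node_le (hφ : Measurable φ) (hφ1 : ∀ p, φ p ∈ Set.Icc (0 : ℝ) 1)
    {q : ℝ} (hq : q ∈ Set.Icc (0 : ℝ) 1) {a c : ℝ} (hac : |c * a| ≤ 1 / 2) :
    ∫⁻ p, ∫⁻ u : unitInterval,
        ENNReal.ofReal (Real.exp (a * (2 * φ p - 1) * (c * response (φ p) q u))) ∂volume ∂P ≤
      ENNReal.ofReal (Real.exp ((∫ p, (2 * φ p - 1) ^ 2 ∂P) *
        (a * (2 * q - 1) * c + 3 / 2 * a ^ 2 * c ^ 2))) := by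
  set θ : ℝ := 2 * q - 1 with hθ
  have hθ1 : |θ| ≤ 1 := abs_two_mul_sub_one_le hq
  -- After Hoeffding's bound for the response the exponent is exactly the squared bias of the node
  -- times `w`. The assumption on `c * a` keeps this within the range `5/8` of the quadratic bound
  -- for `exp`.
  set w : ℝ := θ * (c * a) + (c * a) ^ 2 / 2 with hw
  have hw1 : |w| ≤ |c * a| * (1 + |c * a| / 2) := by
    calc |w| ≤ |θ * (c * a)| + |(c * a) ^ 2 / 2| := abs_add_le _ _
      _ = |θ| * |c * a| + |c * a| ^ 2 / 2 := by
          rw [abs_mul, abs_div, abs_pow, abs_two]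
      _ ≤ 1 * |c * a| + |c * a| ^ 2 / 2 := by
          gcongr
      _ = _ := by ring
  have hw2 : |w| ≤ 5 / 4 * |c * a| := by
    nlinarith [abs_nonneg (c * a)]
  have hw3 : |w| ≤ 5 / 8 := by linarith
  have hw4 : w ^ 2 ≤ 25 / 16 * (c * a) ^ 2 := by
    rw [← sq_abs w, ← sq_abs (c * a)]
    nlinarith [abs_nonneg w, abs_nonneg (c * a)]
  have hYm : Measurable fun p => 2 * φ p - 1 := by fun_prop
  have hY2 : ∀ p, (2 * φ p - 1) ^ 2 ≤ 1 := fun p => by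
    rw [← sq_abs]
    exact pow_le_one₀ (abs_nonneg _) (abs_two_mul_sub_one_le (hφ1 p))
  have hintY : Integrable (fun p => (2 * φ p - 1) ^ 2) P :=
    integrable_of_abs_le_one P (by fun_prop) fun p => by
      rw [abs_of_nonneg (sq_nonneg _)]
      exact hY2 p
  have h1 : ∀ p, ∫⁻ u : unitInterval,
        ENNReal.ofReal (Real.exp (a * (2 * φ p - 1) * (c * response (φ p) q u))) ≤
      ENNReal.ofReal (1 + (2 * φ p - 1) ^ 2 * (w + 63 / 100 * w ^ 2)) := by
    intro p
    have hmeas : Measurable fun u : unitInterval => response (φ p) q (u : ℝ) := by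
      refine measurable_response ?_ ?_ ?_ <;> fun_prop
    have h2 := lintegral_exp_le_of_abs_le_one volume hmeas
      (fun x => (abs_response _ _ _).le) (a * (2 * φ p - 1) * c)
    simp only [mul_assoc] at h2 ⊢
    refine h2.trans (ENNReal.ofReal_le_ofReal ?_)
    rw [integral_response (hφ1 p) hq]
    have h3 : a * ((2 * φ p - 1) * (c * ((2 * φ p - 1) * (2 * q - 1)))) +
        (a * ((2 * φ p - 1) * c)) ^ 2 / 2 = (2 * φ p - 1) ^ 2 * w := by
      rw [hw, hθ]
      ring
    rw [h3]
    have h4 : |(2 * φ p - 1) ^ 2 * w| ≤ 5 / 8 := by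
      rw [abs_mul, abs_of_nonneg (sq_nonneg (2 * φ p - 1))]
      exact (mul_le_of_le_one_left (abs_nonneg _) (hY2 p)).trans hw3
    refine (exp_le_one_add_add_sq h4).trans ?_
    -- The fourth power of the bias is absorbed by its square, so only the second moment enters the
    -- result.
    have h5 : ((2 * φ p - 1) ^ 2) ^ 2 ≤ (2 * φ p - 1) ^ 2 := by
      nlinarith [hY2 p, sq_nonneg (2 * φ p - 1)]
    rw [mul_pow]
    nlinarith [mul_le_mul_of_nonneg_right h5 (sq_nonneg w)]
  have h0 : ∀ p, 0 ≤ 1 + (2 * φ p - 1) ^ 2 * (w + 63 / 100 * w ^ 2) := fun p => by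
    have := (abs_le.1 hw3).1
    have h2 : (2 * φ p - 1) ^ 2 * (-w) ≤ 1 * (5 / 8) := by
      rcases le_total 0 w with h | h
      · nlinarith [sq_nonneg (2 * φ p - 1), mul_nonneg (sq_nonneg (2 * φ p - 1)) h]
      · exact mul_le_mul (hY2 p) (by linarith) (by linarith) (by norm_num)
    nlinarith [mul_nonneg (sq_nonneg (2 * φ p - 1)) (sq_nonneg w)]
  refine (lintegral_mono h1).trans ?_
  have hint2 : Integrable (fun p => 1 + (2 * φ p - 1) ^ 2 * (w + 63 / 100 * w ^ 2)) P :=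
    (integrable_const 1).add (hintY.mul_const _)
  rw [← ofReal_integral_eq_lintegral_ofReal hint2 (Filter.Eventually.of_forall h0)]
  refine ENNReal.ofReal_le_ofReal ?_
  rw [integral_add (integrable_const 1) (hintY.mul_const _), integral_mul_const]
  have hκ : 0 ≤ ∫ p, (2 * φ p - 1) ^ 2 ∂P := integral_nonneg fun p => sq_nonneg _
  set κ := ∫ p, (2 * φ p - 1) ^ 2 ∂P
  simp only [integral_const, probReal_univ, smul_eq_mul, mul_one]
  have h6 : κ * (w + 63 / 100 * w ^ 2) ≤ κ * (a * θ * c + 3 / 2 * a ^ 2 * c ^ 2) := by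
    refine mul_le_mul_of_nonneg_left ?_ hκ
    nlinarith
  have h7 := Real.add_one_le_exp (κ * (a * θ * c + 3 / 2 * a ^ 2 * c ^ 2))
  linarith

end ExponentialMoments

/-! ### Message passing on a tree of independent variables -/

noncomputable section TreeMessages

variable {m n : ℕ}

/-- The independent variables of the model given the pairing: qualities of tasks and workers,
uniform variables, and initial messages. -/
abbrev Coord (m n : ℕ) : Type := (Fin m ⊕ Fin n) ⊕ (Fin m × Fin n) ⊕ (Fin n × Fin m)

/-- The values of the variables. -/
abbrev CoordType : Coord m n → Type
  | Sum.inl _ => unitInterval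
  | Sum.inr (Sum.inl _) => unitInterval
  | Sum.inr (Sum.inr _) => ℝ

instance instMeasurableSpaceCoordType : ∀ v : Coord m n, MeasurableSpace (CoordType v)
  | Sum.inl _ => inferInstanceAs (MeasurableSpace unitInterval)
  | Sum.inr (Sum.inl _) => inferInstanceAs (MeasurableSpace unitInterval)
  | Sum.inr (Sum.inr _) => inferInstanceAs (MeasurableSpace ℝ)

/-- The laws of the variables. -/
def coordLaw (F G : Measure unitInterval) : ∀ v : Coord m n, Measure (CoordType v)
  | Sum.inl (Sum.inl _) => G
  | Sum.inl (Sum.inr _) => F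
  | Sum.inr (Sum.inl _) => (volume : Measure unitInterval)
  | Sum.inr (Sum.inr _) => gaussianReal 1 1

instance instIsProbabilityMeasureCoordLaw (F G : Measure unitInterval) [IsProbabilityMeasure F]
    [IsProbabilityMeasure G] : ∀ v : Coord m n, IsProbabilityMeasure (coordLaw F G v)
  | Sum.inl (Sum.inl _) => inferInstanceAs (IsProbabilityMeasure G)
  | Sum.inl (Sum.inr _) => inferInstanceAs (IsProbabilityMeasure F)
  | Sum.inr (Sum.inl _) => inferInstanceAs (IsProbabilityMeasure (volume : Measure unitInterval))
  | Sum.inr (Sum.inr _) => inferInstanceAs (IsProbabilityMeasure (gaussianReal 1 1))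

/-- Outcomes of all the variables. -/
abbrev Outcome (m n : ℕ) : Type := ∀ v : Coord m n, CoordType v

/-- The value `2 q - 1` for the quality `q` of the vertex `x`. -/
def bias (qual : Fin m ⊕ Fin n → unitInterval → ℝ) (x : Fin m ⊕ Fin n) (ω : Outcome m n) : ℝ :=
  2 * qual x (ω (Sum.inl x)) - 1

/-- The response exchanged along the edge from the node `w` to its parent. -/
def treeResponse (qual : Fin m ⊕ Fin n → unitInterval → ℝ) (vtx : List ℕ → Fin m ⊕ Fin n)
    (ed : List ℕ → Fin m × Fin n) (w : List ℕ) (ω : Outcome m n) : ℝ :=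
  response (qual (vtx w) (ω (Sum.inl (vtx w)))) (qual (vtx w.tail) (ω (Sum.inl (vtx w.tail))))
    ((ω (Sum.inr (Sum.inl (ed w))) : unitInterval) : ℝ)

/-- The message from the node `w` to its parent when the subtree of `w` is explored up to
height `h`. -/
def treeMessage (qual : Fin m ⊕ Fin n → unitInterval → ℝ) (vtx : List ℕ → Fin m ⊕ Fin n)
    (ed : List ℕ → Fin m × Fin n) (b : ℕ → ℕ) : ℕ → List ℕ → Outcome m n → ℝ
  | 0, w, ω => ω (Sum.inr (Sum.inr (ed w).swap))
  | h + 1, w, ω => ∑ a ∈ Finset.range (b w.length),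
      treeResponse qual vtx ed (a :: w) ω * treeMessage qual vtx ed b h (a :: w) ω

/-- The variables attached to a node. -/
def nodeVars (vtx : List ℕ → Fin m ⊕ Fin n) (ed : List ℕ → Fin m × Fin n) (w : List ℕ) :
    Finset (Coord m n) :=
  {Sum.inl (vtx w), Sum.inr (Sum.inl (ed w)), Sum.inr (Sum.inr (ed w).swap)}

/-- The variables attached to the nodes of the subtree of height `h` at `w`. -/
def subtreeVars (vtx : List ℕ → Fin m ⊕ Fin n) (ed : List ℕ → Fin m × Fin n) (b : ℕ → ℕ) :
    ℕ → List ℕ → Finset (Coord m n)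
  | 0, w => nodeVars vtx ed w
  | h + 1, w => nodeVars vtx ed w ∪
      (Finset.range (b w.length)).biUnion fun a => subtreeVars vtx ed b h (a :: w)

/-- The nodes of depth at most `T` carry distinct variables. -/
structure HasDistinctVars (vtx : List ℕ → Fin m ⊕ Fin n) (ed : List ℕ → Fin m × Fin n)
    (b : ℕ → ℕ) (T : ℕ) : Prop where
  vtx_inj : Set.InjOn vtx {w | IsAddress b w ∧ w.length ≤ T}
  edge_inj : Set.InjOn ed {w | IsAddress b w ∧ w.length ≤ T ∧ w ≠ []}

variable {qual : Fin m ⊕ Fin n → unitInterval → ℝ} {vtx : List ℕ → Fin m ⊕ Fin n}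
  {ed : List ℕ → Fin m × Fin n} {b : ℕ → ℕ} {T : ℕ} {F G : Measure unitInterval}

theorem measurable_bias (hqual : ∀ x, Measurable (qual x)) (x : Fin m ⊕ Fin n) :
    Measurable (bias qual x) :=
  (((hqual x).comp (measurable_pi_apply (Sum.inl x))).const_mul 2).sub_const 1

theorem measurable_treeResponse (hqual : ∀ x, Measurable (qual x)) (w : List ℕ) :
    Measurable (treeResponse qual vtx ed w) :=
  measurable_response ((hqual _).comp (measurable_pi_apply (Sum.inl (vtx w))))
    ((hqual _).comp (measurable_pi_apply (Sum.inl (vtx w.tail))))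
    (measurable_subtype_coe.comp (measurable_pi_apply (Sum.inr (Sum.inl (ed w)))))

theorem measurable_treeMessage (hqual : ∀ x, Measurable (qual x)) (h : ℕ) (w : List ℕ) :
    Measurable (treeMessage qual vtx ed b h w) := by
  induction h generalizing w with
  | zero => exact measurable_pi_apply (Sum.inr (Sum.inr (ed w).swap))
  | succ h ih =>
    exact Finset.measurable_fun_sum _ fun a _ => (measurable_treeResponse hqual _).mul (ih _)

theorem nodeVars_subset_subtreeVars (h : ℕ) (w : List ℕ) :
    nodeVars vtx ed w ⊆ subtreeVars vtx ed b h w := by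
  cases h with
  | zero => exact subset_rfl
  | succ h => exact Finset.subset_union_left

theorem dependsOn_treeResponse (w : List ℕ) :
    DependsOn (treeResponse qual vtx ed w)
      ({Sum.inl (vtx w.tail)} ∪ (nodeVars vtx ed w : Set (Coord m n))) := by
  intro x y h
  simp only [treeResponse]
  rw [h (Sum.inl (vtx w)) (Or.inr (by simp [nodeVars])), h (Sum.inl (vtx w.tail)) (Or.inl rfl),
    h (Sum.inr (Sum.inl (ed w))) (Or.inr (by simp [nodeVars]))]

theorem dependsOn_treeMessage (h : ℕ) (w : List ℕ) :
    DependsOn (treeMessage qual vtx ed b h w) (subtreeVars vtx ed b h w : Set (Coord m n)) := by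
  induction h generalizing w with
  | zero =>
    intro x y hxy
    exact hxy (Sum.inr (Sum.inr (ed w).swap)) (by simp [subtreeVars, nodeVars])
  | succ h ih =>
    intro x y hxy
    refine Finset.sum_congr rfl fun a ha => ?_
    have hsub : ∀ i ∈ subtreeVars vtx ed b h (a :: w), i ∈ subtreeVars vtx ed b (h + 1) w :=
      fun i hi => Finset.mem_union_right _ (Finset.mem_biUnion.2 ⟨a, ha, hi⟩)
    congr 1
    · refine dependsOn_treeResponse _ fun i hi => ?_
      rcases hi with rfl | hi
      · exact hxy _ (by simp [subtreeVars, nodeVars])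
      · exact hxy _ (hsub _ (nodeVars_subset_subtreeVars _ _ hi))
    · exact ih _ fun i hi => hxy _ (hsub _ hi)

theorem exists_of_mem_subtreeVars {h : ℕ} {w : List ℕ} (hw : IsAddress b w) {v : Coord m n}
    (hv : v ∈ subtreeVars vtx ed b h w) :
    ∃ w', w <:+ w' ∧ IsAddress b w' ∧ w'.length ≤ w.length + h ∧ v ∈ nodeVars vtx ed w' := by
  induction h generalizing w with
  | zero => exact ⟨w, List.suffix_refl _, hw, le_rfl, hv⟩
  | succ h ih =>
    rcases Finset.mem_union.1 hv with hv | hv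
    · exact ⟨w, List.suffix_refl _, hw, Nat.le_add_right _ _, hv⟩
    · obtain ⟨a, ha, hv⟩ := Finset.mem_biUnion.1 hv
      obtain ⟨w', h1, h2, h3, h4⟩ := ih (w := a :: w) ⟨Finset.mem_range.1 ha, hw⟩ hv
      refine ⟨w', (List.suffix_cons a w).trans h1, h2, ?_, h4⟩
      rw [List.length_cons] at h3
      omega

/-- The root is excluded because it has no edge to a parent: its edge variables carry no meaning and
may coincide with those of another node. -/
theorem HasDistinctVars.eq_of_mem_nodeVars (hd : HasDistinctVars vtx ed b T) {w w' : List ℕ}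
    (hw : IsAddress b w) (hw' : IsAddress b w') (hwT : w.length ≤ T) (hwT' : w'.length ≤ T)
    (hne : w ≠ []) (hne' : w' ≠ []) {v : Coord m n} (hv : v ∈ nodeVars vtx ed w)
    (hv' : v ∈ nodeVars vtx ed w') : w = w' := by
  rcases v with x | e | e
  · simp only [nodeVars, Finset.mem_insert, Finset.mem_singleton, Sum.inl.injEq, reduceCtorEq,
      or_false] at hv hv'
    exact hd.vtx_inj ⟨hw, hwT⟩ ⟨hw', hwT'⟩ (hv.symm.trans hv')
  · simp only [nodeVars, Finset.mem_insert, Finset.mem_singleton, Sum.inr.injEq, Sum.inl.injEq,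
      reduceCtorEq, or_false, false_or] at hv hv'
    exact hd.edge_inj ⟨hw, hwT, hne⟩ ⟨hw', hwT', hne'⟩ (hv.symm.trans hv')
  · simp only [nodeVars, Finset.mem_insert, Finset.mem_singleton, Sum.inr.injEq,
      reduceCtorEq, false_or] at hv hv'
    exact hd.edge_inj ⟨hw, hwT, hne⟩ ⟨hw', hwT', hne'⟩ (Prod.swap_injective (hv.symm.trans hv'))

/-- Used to keep the quality of the parent frozen while the subtree of a child is integrated out. -/
theorem HasDistinctVars.inl_notMem_subtreeVars (hd : HasDistinctVars vtx ed b T) {h a : ℕ}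
    {w : List ℕ} (hw : IsAddress b (a :: w)) (hT : (a :: w).length + h ≤ T) :
    Sum.inl (vtx w) ∉ subtreeVars vtx ed b h (a :: w) := by
  intro hmem
  obtain ⟨w', h1, h2, h3, h4⟩ := exists_of_mem_subtreeVars hw hmem
  simp only [nodeVars, Finset.mem_insert, Finset.mem_singleton, Sum.inl.injEq, reduceCtorEq,
    or_false] at h4
  have h5 := h1.length_le
  simp only [List.length_cons] at h5 hT h3
  have h6 := hd.vtx_inj (x₁ := w) (x₂ := w') ⟨hw.2, by omega⟩ ⟨h2, by omega⟩ h4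
  rw [← h6] at h5
  omega

theorem HasDistinctVars.disjoint_subtreeVars (hd : HasDistinctVars vtx ed b T) {h a a' : ℕ}
    {w : List ℕ} (hw : IsAddress b (a :: w)) (hw' : IsAddress b (a' :: w)) (haa' : a ≠ a')
    (hT : (a :: w).length + h ≤ T) :
    Disjoint (subtreeVars vtx ed b h (a :: w)) (subtreeVars vtx ed b h (a' :: w)) := by
  refine Finset.disjoint_left.2 fun v hv hv' => haa' ?_
  obtain ⟨u, h1, h2, h3, h4⟩ := exists_of_mem_subtreeVars hw hv
  obtain ⟨u', h1', h2', h3', h4'⟩ := exists_of_mem_subtreeVars hw' hv'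
  have h5 := h1.length_le
  have h5' := h1'.length_le
  simp only [List.length_cons] at h5 h5' hT h3 h3'
  have h6 : u = u' := hd.eq_of_mem_nodeVars h2 h2' (by omega) (by omega)
    (List.ne_nil_of_length_pos (by omega)) (List.ne_nil_of_length_pos (by omega)) h4 h4'
  subst h6
  have h7 := List.suffix_of_suffix_length_le h1 h1' (by simp)
  have h8 := h7.eq_of_length (by simp)
  simpa using h8

theorem HasDistinctVars.disjoint_nodeVars (hd : HasDistinctVars vtx ed b T) {h a : ℕ}
    {w : List ℕ} (hw : IsAddress b (a :: w)) (hne : w ≠ []) (hT : (a :: w).length + h ≤ T) :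
    Disjoint (nodeVars vtx ed w) (subtreeVars vtx ed b h (a :: w)) := by
  refine Finset.disjoint_left.2 fun v hv hv' => ?_
  obtain ⟨u', h1', h2', h3', h4'⟩ := exists_of_mem_subtreeVars hw hv'
  have h5' := h1'.length_le
  simp only [List.length_cons] at h5' hT h3'
  have h6 : w = u' := hd.eq_of_mem_nodeVars hw.2 h2' (by omega) (by omega) hne
    (List.ne_nil_of_length_pos (by omega)) hv h4'
  rw [← h6] at h5'
  omega

theorem lmarginal_nodeVars [IsProbabilityMeasure F] [IsProbabilityMeasure G]
    {f : Outcome m n → ENNReal} (hf : Measurable f) (w : List ℕ) (x : Outcome m n) :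
    (∫⋯∫⁻_nodeVars vtx ed w, f ∂coordLaw F G) x =
      ∫⁻ p, ∫⁻ u : unitInterval, ∫⁻ z, f (Function.update (Function.update
        (Function.update x (Sum.inl (vtx w)) p) (Sum.inr (Sum.inl (ed w))) u)
        (Sum.inr (Sum.inr (ed w).swap)) z) ∂gaussianReal 1 1 ∂volume
        ∂(coordLaw F G (Sum.inl (vtx w))) := by
  rw [nodeVars, lmarginal_insert _ hf (by simp)]
  refine lintegral_congr fun p => ?_
  rw [lmarginal_insert _ hf (by simp)]
  refine lintegral_congr fun u => ?_
  rw [lmarginal_singleton]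
  rfl

theorem treeResponse_update {w : List ℕ} (hw : vtx w.tail ≠ vtx w) (x : Outcome m n)
    (p u : unitInterval) (z : ℝ) :
    treeResponse qual vtx ed w (Function.update (Function.update
        (Function.update x (Sum.inl (vtx w)) p) (Sum.inr (Sum.inl (ed w))) u)
        (Sum.inr (Sum.inr (ed w).swap)) z) =
      response (qual (vtx w) p) (qual (vtx w.tail) (x (Sum.inl (vtx w.tail)))) u := by
  have hw' : (Sum.inl (vtx w.tail) : Coord m n) ≠ Sum.inl (vtx w) := fun h => hw (Sum.inl.inj h)
  simp only [treeResponse]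
  congr 2
  · simp
  · simp [Function.update_of_ne hw']
  · simp

theorem bias_update (w : List ℕ) (x : Outcome m n) (p u : unitInterval) (z : ℝ) :
    bias qual (vtx w) (Function.update (Function.update
        (Function.update x (Sum.inl (vtx w)) p) (Sum.inr (Sum.inl (ed w))) u)
        (Sum.inr (Sum.inr (ed w).swap)) z) = 2 * qual (vtx w) p - 1 := by
  simp [bias]

/-- Conditionally on the variables outside the subtrees of its children, the message of a node is a
sum of independent contributions. -/
theorem lmarginal_children_le [IsProbabilityMeasure F] [IsProbabilityMeasure G]
    (hqual : ∀ x, Measurable (qual x)) (hd : HasDistinctVars vtx ed b T) {h : ℕ} {w : List ℕ}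
    (hw : IsAddress b w) (hT : w.length + (h + 1) = T) {A : ℝ → Prop} {e ζ : ℝ}
    (ih : ∀ a < b w.length, ∀ c, A c → ∀ ω, (∫⋯∫⁻_subtreeVars vtx ed b h (a :: w),
      (fun ω => ENNReal.ofReal (Real.exp (c * (treeResponse qual vtx ed (a :: w) ω *
        treeMessage qual vtx ed b h (a :: w) ω)))) ∂coordLaw F G) ω ≤
      ENNReal.ofReal (Real.exp (e * bias qual (vtx w) ω * c + ζ * c ^ 2 / 2)))
    {c : Outcome m n → ℝ} {C : Set (Coord m n)} (hc : DependsOn c C)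
    (hC : ∀ a < b w.length, Disjoint C (subtreeVars vtx ed b h (a :: w)))
    (ω : Outcome m n) (hA : A (c ω)) :
    (∫⋯∫⁻_(Finset.range (b w.length)).biUnion fun a => subtreeVars vtx ed b h (a :: w),
      (fun ω => ENNReal.ofReal (Real.exp (c ω * treeMessage qual vtx ed b (h + 1) w ω)))
        ∂coordLaw F G) ω ≤
      ENNReal.ofReal (Real.exp (b w.length * (e * bias qual (vtx w) ω * c ω +
        ζ * (c ω) ^ 2 / 2))) := by
  set S := (Finset.range (b w.length)).biUnion fun a => subtreeVars vtx ed b h (a :: w) with hS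
  have hadd : ∀ a ∈ Finset.range (b w.length), IsAddress b (a :: w) :=
    fun a ha => ⟨Finset.mem_range.1 ha, hw⟩
  have hlen : ∀ a, (a :: w).length + h ≤ T := fun a => by rw [List.length_cons]; omega
  have h1 : (∫⋯∫⁻_S, (fun ω => ENNReal.ofReal (Real.exp (c ω *
      treeMessage qual vtx ed b (h + 1) w ω))) ∂coordLaw F G) ω =
      (∫⋯∫⁻_S, (fun ω' => ∏ a ∈ Finset.range (b w.length),
        ENNReal.ofReal (Real.exp (c ω * (treeResponse qual vtx ed (a :: w) ω' *
        treeMessage qual vtx ed b h (a :: w) ω')))) ∂coordLaw F G) ω := by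
    refine lintegral_congr fun y => ?_
    -- The coefficient does not see the integrated variables, so it can be replaced by its value at
    -- `ω`.
    have h2 : Disjoint C (S : Set (Coord m n)) := by
      rw [hS, Finset.coe_biUnion]
      exact Set.disjoint_iUnion₂_right.2 fun a ha => hC a (Finset.mem_range.1 ha)
    beta_reduce
    rw [dependsOn_apply_updateFinset hc h2, treeMessage, Finset.mul_sum, Real.exp_sum,
      ENNReal.ofReal_prod_of_nonneg fun a _ => (Real.exp_pos _).le]
  rw [h1, hS]
  -- Different factors have only the quality of `w` in common, and it is not integrated.
  rw [lmarginal_biUnion_prod (Finset.range (b w.length)) (fun a => subtreeVars vtx ed b h (a :: w))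
    (fun a => {Sum.inl (vtx w)} ∪ (subtreeVars vtx ed b h (a :: w) : Set (Coord m n)))
    (fun a ω' => ENNReal.ofReal (Real.exp (c ω * (treeResponse qual vtx ed (a :: w) ω' *
        treeMessage qual vtx ed b h (a :: w) ω'))))]
  · calc _ ≤ ∏ _a ∈ Finset.range (b w.length),
          ENNReal.ofReal (Real.exp (e * bias qual (vtx w) ω * c ω + ζ * (c ω) ^ 2 / 2)) :=
          Finset.prod_le_prod' fun a ha => ih a (Finset.mem_range.1 ha) _ hA ω
      _ = _ := by
          rw [Finset.prod_const, Finset.card_range, ← ENNReal.ofReal_pow (Real.exp_pos _).le,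
            ← Real.exp_nat_mul]
  · intro a
    exact ((((measurable_treeResponse hqual _).mul
      (measurable_treeMessage hqual _ _)).const_mul _).exp).ennreal_ofReal
  · intro a x y hxy
    dsimp only
    have h2 : treeResponse qual vtx ed (a :: w) x = treeResponse qual vtx ed (a :: w) y := by
      refine dependsOn_treeResponse _ fun i hi => hxy i ?_
      rcases hi with hi | hi
      · exact Or.inl hi
      · exact Or.inr (nodeVars_subset_subtreeVars _ _ hi)
    have h3 : treeMessage qual vtx ed b h (a :: w) x = treeMessage qual vtx ed b h (a :: w) y :=
      dependsOn_treeMessage _ _ fun i hi => hxy i (Or.inr hi)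
    rw [h2, h3]
  · intro a ha a' ha' hne
    exact hd.disjoint_subtreeVars (hadd a ha) (hadd a' ha') hne (hlen a)
  · intro a ha a' ha' hne
    refine Set.disjoint_union_left.2 ⟨Set.disjoint_singleton_left.2 ?_, ?_⟩
    · exact hd.inl_notMem_subtreeVars (hadd a' ha') (hlen a')
    · exact Finset.disjoint_coe.2 (hd.disjoint_subtreeVars (hadd a ha) (hadd a' ha') hne (hlen a))

/-- The drift of the messages of height `h`. -/
def drift (μ : ℝ) (κ : ℕ → ℝ) (β : ℕ → ℕ) : ℕ → ℝ
  | 0 => μ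
  | h + 1 => κ (h + 1) * (β (h + 1) * drift μ κ β h)

/-- The variance proxy of the messages of height `h`. -/
def spread (μ : ℝ) (κ : ℕ → ℝ) (β : ℕ → ℕ) : ℕ → ℝ
  | 0 => 2
  | h + 1 => β (h + 1) * spread μ κ β h + 3 * κ (h + 1) * (β (h + 1) * drift μ κ β h) ^ 2

/-- Exponential moments of the messages on the tree. -/
theorem lmarginal_subtreeVars_le [IsProbabilityMeasure F] [IsProbabilityMeasure G]
    (hqual : ∀ x, Measurable (qual x)) (hqual1 : ∀ x p, qual x p ∈ Set.Icc (0 : ℝ) 1)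
    (hd : HasDistinctVars vtx ed b T) {μ : ℝ} {κ : ℕ → ℝ} {β : ℕ → ℕ}
    (hμ : ∀ w, IsAddress b w → w.length = T →
      ∫ p, (2 * qual (vtx w) p - 1) ∂coordLaw F G (Sum.inl (vtx w)) = μ)
    (hκ : ∀ w, IsAddress b w → ∀ h, 1 ≤ h → w.length + h = T →
      ∫ p, (2 * qual (vtx w) p - 1) ^ 2 ∂coordLaw F G (Sum.inl (vtx w)) = κ h)
    (hβ : ∀ t h, 1 ≤ t → 1 ≤ h → t + h = T → b t = β h)
    (h : ℕ) {a : ℕ} {w : List ℕ} (hw : IsAddress b (a :: w)) (hT : (a :: w).length + h = T) (c : ℝ)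
    (hc : ∀ j < h, |c * (β (j + 1) * drift μ κ β j)| ≤ 1 / 2) (ω : Outcome m n) :
    (∫⋯∫⁻_subtreeVars vtx ed b h (a :: w),
      (fun ω => ENNReal.ofReal (Real.exp (c * (treeResponse qual vtx ed (a :: w) ω *
        treeMessage qual vtx ed b h (a :: w) ω)))) ∂coordLaw F G) ω ≤
      ENNReal.ofReal (Real.exp (drift μ κ β h * bias qual (vtx w) ω * c +
        spread μ κ β h * c ^ 2 / 2)) := by
  have hmeas : ∀ h w c, Measurable fun ω => ENNReal.ofReal (Real.exp (c *
      (treeResponse qual vtx ed w ω * treeMessage qual vtx ed b h w ω))) := fun h w c =>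
    ((((measurable_treeResponse hqual _).mul
      (measurable_treeMessage hqual _ _)).const_mul _).exp).ennreal_ofReal
  induction h generalizing a w c ω with
  | zero =>
    have hne : vtx (a :: w).tail ≠ vtx (a :: w) := fun h => by
      rw [List.length_cons] at hT
      have := hd.vtx_inj (x₁ := w) (x₂ := a :: w) ⟨hw.2, by omega⟩
        ⟨hw, by rw [List.length_cons]; omega⟩ h
      simp at this
    have hprob := instIsProbabilityMeasureCoordLaw F G (Sum.inl (vtx (a :: w)) : Coord m n)
    rw [subtreeVars, lmarginal_nodeVars (hmeas 0 (a :: w) c)]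
    simp only [treeResponse_update hne, treeMessage, Function.update_self]
    have h1 := lintegral_leaf_le (coordLaw F G (Sum.inl (vtx (a :: w)) : Coord m n))
      (hqual (vtx (a :: w))) (hqual1 _) (hqual1 (vtx w) (ω (Sum.inl (vtx w)))) c
    refine h1.trans_eq ?_
    rw [hμ _ hw hT]
    simp only [drift, spread, bias]
    congr 2
    ring
  | succ h ih =>
    have hne : vtx (a :: w).tail ≠ vtx (a :: w) := fun h => by
      rw [List.length_cons] at hT
      have := hd.vtx_inj (x₁ := w) (x₂ := a :: w) ⟨hw.2, by omega⟩
        ⟨hw, by rw [List.length_cons]; omega⟩ h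
      simp at this
    have hlen : ∀ a', (a' :: a :: w).length + h ≤ T := fun a' => by
      rw [List.length_cons]
      omega
    have hadd : ∀ a' < b (a :: w).length, IsAddress b (a' :: a :: w) := fun a' ha' => ⟨ha', hw⟩
    have hdisj : Disjoint (nodeVars vtx ed (a :: w)) ((Finset.range (b (a :: w).length)).biUnion
        fun a' => subtreeVars vtx ed b h (a' :: a :: w)) :=
      (Finset.disjoint_biUnion_right _ _ _).2 fun a' ha' =>
        hd.disjoint_nodeVars (hadd a' (Finset.mem_range.1 ha')) (by simp) (hlen a')
    have hbβ : (b (a :: w).length : ℝ) = β (h + 1) := by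
      rw [hβ _ (h + 1) (by simp) (by omega) hT]
    set e := drift μ κ β h with he
    set ζ := spread μ κ β h with hζ
    have hprob := instIsProbabilityMeasureCoordLaw F G (Sum.inl (vtx (a :: w)) : Coord m n)
    rw [subtreeVars, lmarginal_union _ _ (hmeas (h + 1) (a :: w) c) hdisj]
    -- The descendants are integrated first, with the variables of the node frozen. Their
    -- coefficient is `c` times a response `±1`: the smallness condition is inherited unchanged, and
    -- the response drops out of the quadratic term.
    have h1 : ∀ ω, (∫⋯∫⁻_(Finset.range (b (a :: w).length)).biUnion
        fun a' => subtreeVars vtx ed b h (a' :: a :: w),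
        (fun ω => ENNReal.ofReal (Real.exp (c * (treeResponse qual vtx ed (a :: w) ω *
        treeMessage qual vtx ed b (h + 1) (a :: w) ω)))) ∂coordLaw F G) ω ≤
        ENNReal.ofReal (Real.exp (β (h + 1) * ζ * c ^ 2 / 2)) *
          ENNReal.ofReal (Real.exp (β (h + 1) * e * bias qual (vtx (a :: w)) ω *
            (c * treeResponse qual vtx ed (a :: w) ω))) := by
      intro ω
      have habs : ∀ x : ℝ, |c * treeResponse qual vtx ed (a :: w) ω * x| = |c * x| := fun x => by
        rw [treeResponse, abs_mul, abs_mul, abs_response, mul_one, abs_mul]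
      have h2 := lmarginal_children_le (F := F) (G := G) hqual hd hw hT
        (A := fun c => ∀ j < h, |c * (β (j + 1) * drift μ κ β j)| ≤ 1 / 2) (e := e) (ζ := ζ)
        (fun a' ha' c' hA ω' => ih (hadd a' ha') (by
          rw [List.length_cons]
          omega) c' hA ω')
        (c := fun ω => c * treeResponse qual vtx ed (a :: w) ω)
        (C := {Sum.inl (vtx w)} ∪ (nodeVars vtx ed (a :: w) : Set (Coord m n)))
        (fun x y hxy => by
          dsimp only
          rw [dependsOn_treeResponse (a :: w) hxy])
        (fun a' ha' => by
          refine Set.disjoint_union_left.2 ⟨Set.disjoint_singleton_left.2 ?_, ?_⟩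
          · intro hmem
            have hsub : subtreeVars vtx ed b h (a' :: a :: w) ⊆
                subtreeVars vtx ed b (h + 1) (a :: w) := fun i hi =>
              Finset.mem_union_right _ (Finset.mem_biUnion.2 ⟨a', Finset.mem_range.2 ha', hi⟩)
            exact hd.inl_notMem_subtreeVars hw hT.le (hsub hmem)
          · exact Finset.disjoint_coe.2 (hd.disjoint_nodeVars (hadd a' ha') (by simp) (hlen a')))
        ω (fun j hj => by
          rw [habs]
          exact hc j (by omega))
      simp only [mul_assoc] at h2 ⊢
      refine h2.trans_eq ?_
      rw [← ENNReal.ofReal_mul (Real.exp_pos _).le, ← Real.exp_add, hbβ]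
      congr 2
      have h3 : treeResponse qual vtx ed (a :: w) ω ^ 2 = 1 := response_sq _ _ _
      rw [mul_pow, h3]
      ring
    refine (lmarginal_mono h1 ω).trans ?_
    have hmeas2 : Measurable fun ω => ENNReal.ofReal (Real.exp (β (h + 1) * e *
        bias qual (vtx (a :: w)) ω * (c * treeResponse qual vtx ed (a :: w) ω))) :=
      (((measurable_bias hqual _).const_mul _).mul
        ((measurable_treeResponse hqual _).const_mul _)).exp.ennreal_ofReal
    rw [lmarginal_nodeVars (hmeas2.const_mul _)]
    simp only [treeResponse_update hne, bias_update, lintegral_const, measure_univ, mul_one]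
    -- It remains to average over the quality of the node and the response to its parent. The
    -- condition `hc` at index `h` is what this step uses.
    have h4 := lintegral_node_le (coordLaw F G (Sum.inl (vtx (a :: w)) : Coord m n))
      (hqual (vtx (a :: w))) (hqual1 _) (hqual1 (vtx w) (ω (Sum.inl (vtx w))))
      (a := β (h + 1) * e) (c := c) (hc h (by omega))
    have hmeas3 : Measurable fun x : unitInterval × unitInterval =>
        ENNReal.ofReal (Real.exp (β (h + 1) * e * (2 * qual (vtx (a :: w)) x.1 - 1) *
          (c * response (qual (vtx (a :: w)) x.1) (qual (vtx w) (ω (Sum.inl (vtx w))))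
            (x.2 : ℝ)))) := by
      have h5 : Measurable fun x : unitInterval × unitInterval => qual (vtx (a :: w)) x.1 :=
        (hqual _).comp measurable_fst
      have h6 : Measurable fun x : unitInterval × unitInterval => (x.2 : ℝ) := by fun_prop
      exact ((((h5.const_mul 2).sub_const 1).const_mul _).mul
        ((measurable_response h5 measurable_const h6).const_mul _)).exp.ennreal_ofReal
    have h7 : ∀ p : unitInterval, Measurable fun u : unitInterval =>
        ENNReal.ofReal (Real.exp (β (h + 1) * e * (2 * qual (vtx (a :: w)) p - 1) *
          (c * response (qual (vtx (a :: w)) p) (qual (vtx w) (ω (Sum.inl (vtx w))))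
            (u : ℝ)))) := fun p => hmeas3.comp (measurable_prodMk_left (x := p))
    have h8 := hmeas3.lintegral_prod_right' (ν := (volume : Measure unitInterval))
    simp only [List.tail_cons]
    simp only [lintegral_const_mul _ (h7 _)]
    refine (lintegral_const_mul _ h8).trans_le ?_
    refine (mul_le_mul_right h4 _).trans_eq ?_
    rw [← ENNReal.ofReal_mul (Real.exp_pos _).le, ← Real.exp_add, hκ _ hw (h + 1) (by omega) hT]
    simp only [drift, spread, bias, ← he, ← hζ]
    congr 2
    ring

end TreeMessages

/-! ### Neighbours of an explored vertex. -/

section Neighbours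

variable {H V : Type*} [Fintype H] [DecidableEq V] [DecidableEq H]
variable {vt : H → V} {root : V} {d : H} {M : Equiv.Perm H} {color : V → Bool} {deg : Bool → ℕ}

/-- A half-edge at the end of a walk is either free, and then leads to a child, or the arrival
half-edge, which leads back to the parent. No tree hypothesis is involved. -/
theorem exists_halfEdge_iff (hM : IsMatching vt color M)
    (hdeg : ∀ x, (halfEdgesAt vt x).card = deg (color x)) (hroot : color root = false)
    {w : List ℕ} (hw : IsAddress (branching deg) w) (y : V) :
    (∃ h, vt h = reached vt root d M w ∧ vt (M h) = y) ↔
      (w ≠ [] ∧ y = reached vt root d M w.tail) ∨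
        ∃ a < branching deg w.length, y = reached vt root d M (a :: w) := by
  have hcard := (color_reached_and_card_freeEdges (d := d) hM hdeg hroot hw).2
  constructor
  · rintro ⟨h, h1, rfl⟩
    by_cases hf : h ∈ freeEdges vt root d M w
    · obtain ⟨a, ha, rfl⟩ := exists_getD_toList (d := d) hf
      refine Or.inr ⟨a, hcard ▸ ha, ?_⟩
      rw [← exitEdge_cons, reached]
    · cases w with
      | nil => exact absurd (mem_halfEdgesAt.2 h1) hf
      | cons a w =>
        left
        have h2 : h = M (exitEdge vt root d M (a :: w)) := by
          by_contra hne
          exact hf (Finset.mem_erase.2 ⟨hne, mem_halfEdgesAt.2 h1⟩)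
        rw [h2, hM.invol, vt_exitEdge hM hdeg hroot hw]
        simp
  · rintro (⟨hne, rfl⟩ | ⟨a, ha, rfl⟩)
    · cases w with
      | nil => exact absurd rfl hne
      | cons a w =>
        refine ⟨M (exitEdge vt root d M (a :: w)), rfl, ?_⟩
        rw [hM.invol, vt_exitEdge hM hdeg hroot hw, List.tail_cons]
    · exact ⟨_, vt_exitEdge hM hdeg hroot (a := a) ⟨ha, hw⟩, rfl⟩

end Neighbours

/-! ### Identification of the algorithm with the recursion on the tree. -/

noncomputable section Correspondence

variable {m n ℓ r : ℕ}

/-- The vertex reached by a walk from the task `i`. -/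
def walkVertex (π : Pairing m n ℓ r) (d : HalfEdge m n ℓ r) (i : Fin m) (w : List ℕ) :
    Fin m ⊕ Fin n :=
  reached endpoint (Sum.inl i) d (matching π) w

/-- The task and the worker joined by the half-edge `h`. -/
def edgeOf (π : Pairing m n ℓ r) : HalfEdge m n ℓ r → Fin m × Fin n
  | Sum.inl e => (e.1, (π e).1)
  | Sum.inr f => ((π.symm f).1, f.1)

/-- The last edge of a walk from the task `i`. -/
def walkEdge (π : Pairing m n ℓ r) (d : HalfEdge m n ℓ r) (i : Fin m) (w : List ℕ) :
    Fin m × Fin n :=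
  edgeOf π (exitEdge endpoint (Sum.inl i) d (matching π) w)

variable {π : Pairing m n ℓ r} {d : HalfEdge m n ℓ r} {i : Fin m} {k : ℕ}

local notation "br" => branching (degrees ℓ r)

theorem walkVertex_isRight {w : List ℕ} (hw : IsAddress br w) :
    (walkVertex π d i w).isRight = w.length.bodd :=
  (color_reached_and_card_freeEdges (isMatching_matching π) card_halfEdgesAt_endpoint rfl hw).1

theorem walkEdge_cons {a : ℕ} {w : List ℕ} (hw : IsAddress br (a :: w)) :
    (walkVertex π d i (a :: w) = Sum.inl (walkEdge π d i (a :: w)).1 ∧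
      walkVertex π d i w = Sum.inr (walkEdge π d i (a :: w)).2) ∨
    (walkVertex π d i (a :: w) = Sum.inr (walkEdge π d i (a :: w)).2 ∧
      walkVertex π d i w = Sum.inl (walkEdge π d i (a :: w)).1) := by
  have h1 := vt_exitEdge (root := Sum.inl i) (d := d) (isMatching_matching π)
    card_halfEdgesAt_endpoint rfl hw
  rw [walkVertex, walkVertex, walkEdge, ← h1, reached]
  generalize exitEdge endpoint (Sum.inl i) d (matching π) (a :: w) = h
  rcases h with e | f
  · right
    simp [endpoint, edgeOf]
  · left
    simp [endpoint, edgeOf]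

/-- Walks with the same last edge have the same two endpoints. If these correspond in order,
injectivity on vertices concludes; if crosswise, each walk would be one step longer than the other.
-/
theorem IsLocalTree.hasDistinctVars (h : IsLocalTree d k i π) :
    HasDistinctVars (walkVertex π d i) (walkEdge π d i) br (2 * k - 1) where
  vtx_inj := h
  edge_inj := by
    rintro w ⟨hw, hwT, hne⟩ w' ⟨hw', hwT', hne'⟩ he
    cases w with
    | nil => exact absurd rfl hne
    | cons a u =>
      cases w' with
      | nil => exact absurd rfl hne'
      | cons a' u' =>
        have hu : u.length ≤ 2 * k - 1 := by rw [List.length_cons] at hwT; omega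
        have hu' : u'.length ≤ 2 * k - 1 := by rw [List.length_cons] at hwT'; omega
        have hinj : Set.InjOn (walkVertex π d i) _ := h
        rcases walkEdge_cons (π := π) (d := d) (i := i) hw with ⟨h1, h2⟩ | ⟨h1, h2⟩ <;>
          rcases walkEdge_cons (π := π) (d := d) (i := i) hw' with ⟨h1', h2'⟩ | ⟨h1', h2'⟩ <;>
          rw [← he] at h1' h2'
        · exact hinj ⟨hw, hwT⟩ ⟨hw', hwT'⟩ (h1.trans h1'.symm)
        · have h3 := hinj ⟨hw, hwT⟩ ⟨hw'.2, hu'⟩ (h1.trans h2'.symm)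
          have h4 := hinj ⟨hw.2, hu⟩ ⟨hw', hwT'⟩ (h2.trans h1'.symm)
          have h5 := congrArg List.length h3
          have h6 := congrArg List.length h4
          simp only [List.length_cons] at h5 h6
          omega
        · have h3 := hinj ⟨hw, hwT⟩ ⟨hw'.2, hu'⟩ (h1.trans h2'.symm)
          have h4 := hinj ⟨hw.2, hu⟩ ⟨hw', hwT'⟩ (h2.trans h1'.symm)
          have h5 := congrArg List.length h3
          have h6 := congrArg List.length h4
          simp only [List.length_cons] at h5 h6
          omega
        · exact hinj ⟨hw, hwT⟩ ⟨hw', hwT'⟩ (h1.trans h1'.symm)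

theorem mem_edges_iff_inl (i' : Fin m) (j : Fin n) :
    (i', j) ∈ edges π ↔ ∃ h : HalfEdge m n ℓ r, endpoint h = Sum.inl i' ∧
      endpoint (matching π h) = Sum.inr j := by
  simp only [edges, Finset.mem_image, Finset.mem_univ, true_and, Prod.mk.injEq]
  constructor
  · rintro ⟨e, rfl, rfl⟩
    exact ⟨Sum.inl e, rfl, rfl⟩
  · rintro ⟨e | f, h1, h2⟩
    · exact ⟨e, Sum.inl.inj h1, Sum.inr.inj h2⟩
    · simp [endpoint] at h1

theorem mem_edges_iff_inr (i' : Fin m) (j : Fin n) :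
    (i', j) ∈ edges π ↔ ∃ h : HalfEdge m n ℓ r, endpoint h = Sum.inr j ∧
      endpoint (matching π h) = Sum.inl i' := by
  rw [mem_edges_iff_inl]
  constructor
  · rintro ⟨h, h1, h2⟩
    exact ⟨matching π h, h2, by rw [(isMatching_matching π).invol, h1]⟩
  · rintro ⟨h, h1, h2⟩
    exact ⟨matching π h, h2, by rw [(isMatching_matching π).invol, h1]⟩

theorem walkEdge_of_task {a : ℕ} {w : List ℕ} (hw : IsAddress br (a :: w)) {i' : Fin m}
    (h : walkVertex π d i w = Sum.inl i') :
    (walkEdge π d i (a :: w)).1 = i' ∧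
      walkVertex π d i (a :: w) = Sum.inr (walkEdge π d i (a :: w)).2 := by
  rcases walkEdge_cons (π := π) (d := d) (i := i) hw with ⟨h1, h2⟩ | ⟨h1, h2⟩
  · rw [h] at h2
    simp at h2
  · rw [h] at h2
    exact ⟨(Sum.inl.inj h2).symm, h1⟩

theorem walkEdge_of_worker {a : ℕ} {w : List ℕ} (hw : IsAddress br (a :: w)) {j : Fin n}
    (h : walkVertex π d i w = Sum.inr j) :
    (walkEdge π d i (a :: w)).2 = j ∧
      walkVertex π d i (a :: w) = Sum.inl (walkEdge π d i (a :: w)).1 := by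
  rcases walkEdge_cons (π := π) (d := d) (i := i) hw with ⟨h1, h2⟩ | ⟨h1, h2⟩
  · rw [h] at h2
    exact ⟨(Sum.inr.inj h2).symm, h1⟩
  · rw [h] at h2
    simp at h2

theorem mem_workersOf_iff {w : List ℕ} (hw : IsAddress br w) {i' : Fin m}
    (h : walkVertex π d i w = Sum.inl i') (j : Fin n) :
    j ∈ workersOf (edges π) i' ↔ (w ≠ [] ∧ Sum.inr j = walkVertex π d i w.tail) ∨
      ∃ a < br w.length, j = (walkEdge π d i (a :: w)).2 := by
  simp only [workersOf, Finset.mem_filter, Finset.mem_univ, true_and]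
  rw [mem_edges_iff_inl, ← h]
  refine (exists_halfEdge_iff (isMatching_matching π) card_halfEdgesAt_endpoint rfl hw _).trans ?_
  refine or_congr Iff.rfl (exists_congr fun a => and_congr_right fun ha => ?_)
  have h1 := (walkEdge_of_task (a := a) ⟨ha, hw⟩ h).2
  rw [walkVertex] at h1
  rw [h1, Sum.inr.injEq]

theorem mem_tasksOf_iff {w : List ℕ} (hw : IsAddress br w) {j : Fin n}
    (h : walkVertex π d i w = Sum.inr j) (i' : Fin m) :
    i' ∈ tasksOf (edges π) j ↔ (w ≠ [] ∧ Sum.inl i' = walkVertex π d i w.tail) ∨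
      ∃ a < br w.length, i' = (walkEdge π d i (a :: w)).1 := by
  simp only [tasksOf, Finset.mem_filter, Finset.mem_univ, true_and]
  rw [mem_edges_iff_inr, ← h]
  refine (exists_halfEdge_iff (isMatching_matching π) card_halfEdgesAt_endpoint rfl hw _).trans ?_
  refine or_congr Iff.rfl (exists_congr fun a => and_congr_right fun ha => ?_)
  have h1 := (walkEdge_of_worker (a := a) ⟨ha, hw⟩ h).2
  rw [walkVertex] at h1
  rw [h1, Sum.inl.injEq]

theorem IsLocalTree.child_inj (hT : IsLocalTree d k i π) {w : List ℕ} (hw : IsAddress br w)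
    (hlen : w.length + 1 ≤ 2 * k - 1) {a a' : ℕ} (ha : a < br w.length) (ha' : a' < br w.length)
    (h : walkVertex π d i (a :: w) = walkVertex π d i (a' :: w)) : a = a' := by
  have hinj : Set.InjOn (walkVertex π d i) _ := hT
  have := hinj (x₁ := a :: w) (x₂ := a' :: w) ⟨⟨ha, hw⟩, hlen⟩ ⟨⟨ha', hw⟩, hlen⟩ h
  simpa using this

theorem IsLocalTree.child_ne (hT : IsLocalTree d k i π) {w : List ℕ} (hw : IsAddress br w)
    (hlen : w.length + 1 ≤ 2 * k - 1) {a : ℕ} (ha : a < br w.length) :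
    walkVertex π d i (a :: w) ≠ walkVertex π d i w.tail := by
  intro h
  have hinj : Set.InjOn (walkVertex π d i) _ := hT
  have h1 := List.tail_suffix w
  have := congrArg List.length (hinj (x₁ := a :: w) (x₂ := w.tail) ⟨⟨ha, hw⟩, hlen⟩
    ⟨hw.of_suffix h1, by have := h1.length_le; omega⟩ h)
  have := h1.length_le
  simp only [List.length_cons] at *
  omega

/-- Removing the recipient removes exactly the parent. Children are distinct from each other and
from the parent, so no edges were merged and the sum can be indexed by children. -/
theorem IsLocalTree.sum_workersOf_erase (hT : IsLocalTree d k i π) {w : List ℕ}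
    (hw : IsAddress br w) (hlen : w.length + 1 ≤ 2 * k - 1) {i' : Fin m} {j : Fin n}
    (h : walkVertex π d i w = Sum.inl i') (h' : walkVertex π d i w.tail = Sum.inr j)
    (g : Fin n → ℝ) :
    ∑ j' ∈ (workersOf (edges π) i').erase j, g j' =
      ∑ a ∈ Finset.range (br w.length), g (walkEdge π d i (a :: w)).2 := by
  have h1 : ∀ a < br w.length, walkVertex π d i (a :: w) =
      Sum.inr (walkEdge π d i (a :: w)).2 := fun a ha => (walkEdge_of_task ⟨ha, hw⟩ h).2
  have h2 : (workersOf (edges π) i').erase j =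
      (Finset.range (br w.length)).image fun a => (walkEdge π d i (a :: w)).2 := by
    ext j'
    rw [Finset.mem_erase, mem_workersOf_iff hw h, h', Sum.inr.injEq]
    simp only [Finset.mem_image, Finset.mem_range]
    constructor
    · rintro ⟨h3, ⟨-, h4⟩ | ⟨a, ha, rfl⟩⟩
      · exact absurd h4 h3
      · exact ⟨a, ha, rfl⟩
    · rintro ⟨a, ha, rfl⟩
      refine ⟨fun h3 => hT.child_ne hw hlen ha ?_, Or.inr ⟨a, ha, rfl⟩⟩
      rw [h1 a ha, h', h3]
  rw [h2, Finset.sum_image]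
  intro a ha a' ha' h3
  have ha := Finset.mem_range.1 ha
  have ha' := Finset.mem_range.1 ha'
  exact hT.child_inj hw hlen ha ha' (by
    rw [h1 a ha, h1 a' ha']
    exact congrArg _ h3)

theorem IsLocalTree.sum_workersOf_root (hT : IsLocalTree d k i π) (hk : 1 ≤ 2 * k - 1)
    (g : Fin n → ℝ) :
    ∑ j' ∈ workersOf (edges π) i, g j' =
      ∑ a ∈ Finset.range (br 0), g (walkEdge π d i [a]).2 := by
  have hw : IsAddress br [] := trivial
  have h : walkVertex π d i [] = Sum.inl i := rfl
  have h1 : ∀ a < br 0, walkVertex π d i [a] =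
      Sum.inr (walkEdge π d i [a]).2 := fun a ha => (walkEdge_of_task (w := []) ⟨ha, hw⟩ h).2
  have h2 : workersOf (edges π) i =
      (Finset.range (br 0)).image fun a => (walkEdge π d i [a]).2 := by
    ext j'
    rw [mem_workersOf_iff hw h]
    simp [eq_comm]
  rw [h2, Finset.sum_image]
  intro a ha a' ha' h3
  have ha := Finset.mem_range.1 ha
  have ha' := Finset.mem_range.1 ha'
  exact hT.child_inj (w := []) hw hk ha ha' (by
    rw [h1 a ha, h1 a' ha']
    exact congrArg _ h3)

theorem IsLocalTree.sum_tasksOf_erase (hT : IsLocalTree d k i π) {w : List ℕ}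
    (hw : IsAddress br w) (hlen : w.length + 1 ≤ 2 * k - 1) {i' : Fin m} {j : Fin n}
    (h : walkVertex π d i w = Sum.inr j) (h' : walkVertex π d i w.tail = Sum.inl i')
    (g : Fin m → ℝ) :
    ∑ i'' ∈ (tasksOf (edges π) j).erase i', g i'' =
      ∑ a ∈ Finset.range (br w.length), g (walkEdge π d i (a :: w)).1 := by
  have h1 : ∀ a < br w.length, walkVertex π d i (a :: w) =
      Sum.inl (walkEdge π d i (a :: w)).1 := fun a ha => (walkEdge_of_worker ⟨ha, hw⟩ h).2
  have h2 : (tasksOf (edges π) j).erase i' =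
      (Finset.range (br w.length)).image fun a => (walkEdge π d i (a :: w)).1 := by
    ext i''
    rw [Finset.mem_erase, mem_tasksOf_iff hw h, h', Sum.inl.injEq]
    simp only [Finset.mem_image, Finset.mem_range]
    constructor
    · rintro ⟨h3, ⟨-, h4⟩ | ⟨a, ha, rfl⟩⟩
      · exact absurd h4 h3
      · exact ⟨a, ha, rfl⟩
    · rintro ⟨a, ha, rfl⟩
      refine ⟨fun h3 => hT.child_ne hw hlen ha ?_, Or.inr ⟨a, ha, rfl⟩⟩
      rw [h1 a ha, h', h3]
  rw [h2, Finset.sum_image]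
  intro a ha a' ha' h3
  have ha := Finset.mem_range.1 ha
  have ha' := Finset.mem_range.1 ha'
  exact hT.child_inj hw hlen ha ha' (by
    rw [h1 a ha, h1 a' ha']
    exact congrArg _ h3)

/-- The response of the worker `j` to the task `i` as a function of the independent variables. -/
def coordResponse (qual : Fin m ⊕ Fin n → unitInterval → ℝ) (ω : Outcome m n) (i : Fin m)
    (j : Fin n) : ℝ :=
  response (qual (Sum.inl i) (ω (Sum.inl (Sum.inl i)))) (qual (Sum.inr j) (ω (Sum.inl (Sum.inr j))))
    ((ω (Sum.inr (Sum.inl (i, j))) : unitInterval) : ℝ)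

/-- The initial messages as a function of the independent variables. -/
def coordInit (ω : Outcome m n) (j : Fin n) (i : Fin m) : ℝ := ω (Sum.inr (Sum.inr (j, i)))

variable {qual : Fin m ⊕ Fin n → unitInterval → ℝ}

theorem treeResponse_eq_coordResponse {a : ℕ} {w : List ℕ} (hw : IsAddress br (a :: w))
    (ω : Outcome m n) :
    treeResponse qual (walkVertex π d i) (walkEdge π d i) (a :: w) ω =
      coordResponse qual ω (walkEdge π d i (a :: w)).1 (walkEdge π d i (a :: w)).2 := by
  rw [treeResponse, List.tail_cons, coordResponse]
  rcases walkEdge_cons (π := π) (d := d) (i := i) hw with ⟨h1, h2⟩ | ⟨h1, h2⟩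
  · rw [h1, h2]
  · rw [h1, h2, response_comm]

/-- One iteration of the algorithm descends two levels, first to tasks and then to workers. -/
theorem IsLocalTree.workerMessage_eq (hT : IsLocalTree d k i π) (ω : Outcome m n) (s : ℕ)
    {w : List ℕ} (hw : IsAddress br w) (hne : w ≠ []) (hlen : w.length + 2 * s ≤ 2 * k - 1)
    {i' : Fin m} {j : Fin n} (h : walkVertex π d i w = Sum.inr j)
    (h' : walkVertex π d i w.tail = Sum.inl i') :
    workerMessage (edges π) (coordResponse qual ω) (coordInit ω) s j i' =
      treeMessage qual (walkVertex π d i) (walkEdge π d i) br (2 * s) w ω := by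
  induction s generalizing w i' j with
  | zero =>
    cases w with
    | nil => exact absurd rfl hne
    | cons a w =>
      obtain ⟨h1, h2⟩ := walkEdge_of_task hw h'
      rw [h] at h2
      have h3 : (walkEdge π d i (a :: w)).swap = (j, i') := Prod.ext (Sum.inr.inj h2).symm h1
      rw [Nat.mul_zero, treeMessage, h3]
      rfl
  | succ s ih =>
    rw [workerMessage, workerUpdate,
      hT.sum_tasksOf_erase hw (by omega) h h' (fun i'' => coordResponse qual ω i'' j *
        taskUpdate (edges π) (coordResponse qual ω)
          (workerMessage (edges π) (coordResponse qual ω) (coordInit ω) s) i'' j),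
      show 2 * (s + 1) = 2 * s + 1 + 1 by ring, treeMessage]
    refine Finset.sum_congr rfl fun a ha => ?_
    have haw : IsAddress br (a :: w) := ⟨Finset.mem_range.1 ha, hw⟩
    obtain ⟨h1, h2⟩ := walkEdge_of_worker haw h
    rw [treeResponse_eq_coordResponse haw, h1]
    congr 1
    rw [taskUpdate, hT.sum_workersOf_erase haw (by rw [List.length_cons]; omega) h2
      (by rw [List.tail_cons, h]) (fun j' => coordResponse qual ω (walkEdge π d i (a :: w)).1 j' *
        workerMessage (edges π) (coordResponse qual ω) (coordInit ω) s j'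
          (walkEdge π d i (a :: w)).1), treeMessage]
    refine Finset.sum_congr rfl fun a' ha' => ?_
    have haw' : IsAddress br (a' :: a :: w) := ⟨Finset.mem_range.1 ha', haw⟩
    obtain ⟨h3, h4⟩ := walkEdge_of_task haw' h2
    rw [treeResponse_eq_coordResponse haw', h3,
      ih haw' (by simp) (by simp only [List.length_cons]; omega) h4 (by rw [List.tail_cons, h2])]

/-- The output of the algorithm at a task with tree-like neighbourhood. -/
theorem IsLocalTree.score_eq (hT : IsLocalTree d k i π) (hk : 1 ≤ k) (ω : Outcome m n) :
    score (edges π) (coordResponse qual ω) (coordInit ω) k i =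
      treeMessage qual (walkVertex π d i) (walkEdge π d i) br (2 * (k - 1) + 1) [] ω := by
  rw [score, hT.sum_workersOf_root (by omega) (fun j => coordResponse qual ω i j *
    workerMessage (edges π) (coordResponse qual ω) (coordInit ω) (k - 1) j i), treeMessage]
  refine Finset.sum_congr rfl fun a ha => ?_
  have haw : IsAddress br [a] := ⟨Finset.mem_range.1 ha, trivial⟩
  obtain ⟨h1, h2⟩ := walkEdge_of_task haw (π := π) (d := d) (i := i) (w := []) rfl
  rw [treeResponse_eq_coordResponse haw, h1,
    hT.workerMessage_eq ω (k - 1) haw (by simp) (by simp; omega) h2 rfl]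

end Correspondence

/-! ### Solution of the recursion for drift and variance proxy. -/

noncomputable section Parameters

/-- The second moment of `2 q - 1` at a node of height `h` (tasks have odd height). -/
def nodeMoment (ρ2 σ2 : ℝ) (h : ℕ) : ℝ := bif h.bodd then ρ2 else σ2

/-- The number of children of a node of height `h`. -/
def nodeChildren (L R : ℕ) (h : ℕ) : ℕ := bif h.bodd then L else R

variable {μ ρ2 σ2 : ℝ} {L R : ℕ}

theorem drift_odd (s : ℕ) :
    drift μ (nodeMoment ρ2 σ2) (nodeChildren L R) (2 * s + 1) =
      ρ2 * (L * drift μ (nodeMoment ρ2 σ2) (nodeChildren L R) (2 * s)) := by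
  rw [drift]
  simp [nodeMoment, nodeChildren]

theorem drift_even (s : ℕ) :
    drift μ (nodeMoment ρ2 σ2) (nodeChildren L R) (2 * (s + 1)) =
      σ2 * (R * (ρ2 * (L * drift μ (nodeMoment ρ2 σ2) (nodeChildren L R) (2 * s)))) := by
  rw [← drift_odd, show 2 * (s + 1) = 2 * s + 1 + 1 by ring, drift]
  simp [nodeMoment, nodeChildren]

theorem spread_even (s : ℕ) :
    spread μ (nodeMoment ρ2 σ2) (nodeChildren L R) (2 * (s + 1)) =
      R * (L * spread μ (nodeMoment ρ2 σ2) (nodeChildren L R) (2 * s) +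
        3 * ρ2 * (L * drift μ (nodeMoment ρ2 σ2) (nodeChildren L R) (2 * s)) ^ 2) +
      3 * σ2 * (R * (ρ2 * (L * drift μ (nodeMoment ρ2 σ2) (nodeChildren L R) (2 * s)))) ^ 2 := by
  rw [← drift_odd, show 2 * (s + 1) = 2 * s + 1 + 1 by ring, spread, spread]
  simp [nodeMoment, nodeChildren]

theorem drift_pos (hμ : 0 < μ) (hρ : 0 < ρ2) (hσ : 0 < σ2) (hL : 0 < L) (hR : 0 < R) (s : ℕ) :
    0 < drift μ (nodeMoment ρ2 σ2) (nodeChildren L R) (2 * s) := by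
  induction s with
  | zero => exact hμ
  | succ s ih =>
    rw [drift_even]
    positivity

theorem spread_pos (hρ : 0 < ρ2) (hσ : 0 < σ2) (hL : 0 < L) (hR : 0 < R) (s : ℕ) :
    0 < spread μ (nodeMoment ρ2 σ2) (nodeChildren L R) (2 * s) := by
  induction s with
  | zero => exact two_pos
  | succ s ih =>
    rw [spread_even]
    positivity

theorem drift_even_mono (hμ : 0 < μ) (hρ : 0 < ρ2) (hσ : 0 < σ2) (hL : 0 < L) (hR : 0 < R)
    (hY : 1 ≤ (L : ℝ) * R * (ρ2 * σ2)) {s t : ℕ} (hst : s ≤ t) :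
    drift μ (nodeMoment ρ2 σ2) (nodeChildren L R) (2 * s) ≤
      drift μ (nodeMoment ρ2 σ2) (nodeChildren L R) (2 * t) := by
  induction t, hst using Nat.le_induction with
  | base => exact le_rfl
  | succ t _ ih =>
    refine ih.trans ?_
    rw [drift_even]
    have := mul_le_mul_of_nonneg_right hY
      (drift_pos (μ := μ) hμ hρ hσ hL hR t).le
    linarith

/-- The Chernoff coefficient at the root is small at all heights at once: drifts increase with
height, and the variance proxy at the top already contains the square of the largest of them. -/
theorem abs_mul_drift_le (hμ : 0 < μ) (hρ : 0 < ρ2) (hσ : 0 < σ2) (hL : 0 < L) (hR : 0 < R)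
    (hY : 1 ≤ (L : ℝ) * R * (ρ2 * σ2)) (hRρ : 1 ≤ R * ρ2) {K j : ℕ} (hj : j < 2 * K) {c : ℝ}
    (hc : |c| ≤ drift μ (nodeMoment ρ2 σ2) (nodeChildren L R) (2 * K) /
      spread μ (nodeMoment ρ2 σ2) (nodeChildren L R) (2 * K)) :
    |c * (nodeChildren L R (j + 1) * drift μ (nodeMoment ρ2 σ2) (nodeChildren L R) j)| ≤ 1 / 2 := by
  obtain ⟨K, rfl⟩ : ∃ K', K = K' + 1 := ⟨K - 1, by omega⟩
  set e := drift μ (nodeMoment ρ2 σ2) (nodeChildren L R) (2 * K) with he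
  set g := R * (ρ2 * (L * e)) with hg
  have he0 : 0 < e := drift_pos hμ hρ hσ hL hR K
  have hg0 : 0 < g := by positivity
  -- For even `j` the bound by `g` uses monotonicity and `1 ≤ R * ρ2`; for odd `j` monotonicity
  -- suffices.
  have h1 : 0 ≤ nodeChildren L R (j + 1) * drift μ (nodeMoment ρ2 σ2) (nodeChildren L R) j ∧
      nodeChildren L R (j + 1) * drift μ (nodeMoment ρ2 σ2) (nodeChildren L R) j ≤ g := by
    have hmono : ∀ s ≤ K, L * drift μ (nodeMoment ρ2 σ2) (nodeChildren L R) (2 * s) ≤ L * e :=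
      fun s hs => mul_le_mul_of_nonneg_left (drift_even_mono hμ hρ hσ hL hR hY hs)
        (Nat.cast_nonneg L)
    have hpos := fun s => drift_pos (μ := μ) hμ hρ hσ hL hR s
    rcases Nat.even_or_odd' j with ⟨s, rfl | rfl⟩
    · have h2 : nodeChildren L R (2 * s + 1) = L := by simp [nodeChildren]
      rw [h2]
      refine ⟨mul_nonneg (Nat.cast_nonneg _) (hpos s).le, (hmono s (by omega)).trans ?_⟩
      have := mul_le_mul_of_nonneg_right hRρ (by positivity : 0 ≤ L * e)
      rw [hg]
      linarith
    · have h2 : nodeChildren L R (2 * s + 1 + 1) = R := by simp [nodeChildren]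
      rw [h2, drift_odd]
      refine ⟨by have := hpos s; positivity, ?_⟩
      rw [hg]
      have := hmono s (by omega)
      gcongr
  rw [drift_even, ← he, ← hg] at hc
  -- The top drift is `σ2 * g`, so this single term gives `|c| * g ≤ 1/3`.
  have hζ : 3 * σ2 * g ^ 2 ≤ spread μ (nodeMoment ρ2 σ2) (nodeChildren L R) (2 * (K + 1)) := by
    rw [spread_even, ← he, ← hg]
    have := spread_pos (μ := μ) hρ hσ hL hR K
    have : 0 ≤ R * (L * spread μ (nodeMoment ρ2 σ2) (nodeChildren L R) (2 * K) +
        3 * ρ2 * (L * e) ^ 2) := by positivity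
    linarith
  have hζ0 := spread_pos (μ := μ) hρ hσ hL hR (K + 1)
  rw [abs_mul, abs_of_nonneg h1.1]
  calc _ ≤ (σ2 * g / spread μ (nodeMoment ρ2 σ2) (nodeChildren L R) (2 * (K + 1))) * g :=
        mul_le_mul hc h1.2 h1.1 (by positivity)
    _ = σ2 * g ^ 2 / spread μ (nodeMoment ρ2 σ2) (nodeChildren L R) (2 * (K + 1)) := by ring
    _ ≤ 1 / 2 := by
        rw [div_le_iff₀ hζ0]
        have : 0 ≤ σ2 * g ^ 2 := by positivity
        linarith

/-- Two levels of the recursion act on this ratio by the affine map `f ↦ f / X + 3 (1 + 1 / (R ρ2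
σ2))` with `X = L R (ρ2 σ2)²`, started from `2 σ2 / μ²`. The right side sums the geometric series.
-/
theorem spread_div_drift_sq (hμ : 0 < μ) (hρ : 0 < ρ2) (hσ : 0 < σ2) (hL : 0 < L) (hR : 0 < R)
    (hX : (L : ℝ) * R * (ρ2 * σ2) ^ 2 ≠ 1) (s : ℕ) :
    σ2 * spread μ (nodeMoment ρ2 σ2) (nodeChildren L R) (2 * s) /
        drift μ (nodeMoment ρ2 σ2) (nodeChildren L R) (2 * s) ^ 2 =
      2 * σ2 / (μ ^ 2 * ((L : ℝ) * R * (ρ2 * σ2) ^ 2) ^ s) +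
        3 * (1 + 1 / (R * ρ2 * σ2)) * ((1 - 1 / ((L : ℝ) * R * (ρ2 * σ2) ^ 2) ^ s) /
          (1 - 1 / ((L : ℝ) * R * (ρ2 * σ2) ^ 2))) := by
  have hL' : (0 : ℝ) < L := by exact_mod_cast hL
  have hR' : (0 : ℝ) < R := by exact_mod_cast hR
  set X := (L : ℝ) * R * (ρ2 * σ2) ^ 2 with hXdef
  have hX0 : 0 < X := by positivity
  have hX1 : 1 - 1 / X ≠ 0 := by
    rw [sub_ne_zero]
    intro h
    rw [eq_div_iff hX0.ne', one_mul] at h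
    exact hX h
  induction s with
  | zero => simp [spread, drift]; ring
  | succ s ih =>
    have he := drift_pos (μ := μ) hμ hρ hσ hL hR s
    have h1 : σ2 * spread μ (nodeMoment ρ2 σ2) (nodeChildren L R) (2 * (s + 1)) /
        drift μ (nodeMoment ρ2 σ2) (nodeChildren L R) (2 * (s + 1)) ^ 2 =
        (σ2 * spread μ (nodeMoment ρ2 σ2) (nodeChildren L R) (2 * s) /
          drift μ (nodeMoment ρ2 σ2) (nodeChildren L R) (2 * s) ^ 2) / X +
          3 * (1 + 1 / (R * ρ2 * σ2)) := by
      rw [spread_even, drift_even, hXdef]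
      field_simp
      ring
    rw [h1, ih]
    have h2 : (1 - 1 / X ^ (s + 1)) / (1 - 1 / X) = (1 - 1 / X ^ s) / (1 - 1 / X) / X + 1 := by
      rw [pow_succ]
      have hX2 : X - 1 ≠ 0 := sub_ne_zero.2 hX
      field_simp
      ring
    rw [h2, pow_succ]
    field_simp
    ring

end Parameters

/-! ### Chernoff bound at a task with tree-like neighbourhood. -/

noncomputable section LocalError

variable {m n ℓ r : ℕ} {π : Pairing m n ℓ r} {d : HalfEdge m n ℓ r} {i : Fin m} {k : ℕ}
  {qual : Fin m ⊕ Fin n → unitInterval → ℝ} {F G : Measure unitInterval} {μ ρ2 σ2 : ℝ}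

/-- Exponential moment of the output at a task with tree-like neighbourhood. -/
theorem IsLocalTree.lmarginal_exp_le [IsProbabilityMeasure F] [IsProbabilityMeasure G]
    (hT : IsLocalTree d k i π) (hk : 1 ≤ k) (hℓ : 1 < ℓ) (hr : 1 < r)
    (hqual : ∀ x, Measurable (qual x)) (hqual1 : ∀ x p, qual x p ∈ Set.Icc (0 : ℝ) 1)
    (hqμ : ∀ j, ∫ p, (2 * qual (Sum.inr j) p - 1) ∂F = μ)
    (hqσ : ∀ j, ∫ p, (2 * qual (Sum.inr j) p - 1) ^ 2 ∂F = σ2)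
    (hqρ : ∀ i, ∫ p, (2 * qual (Sum.inl i) p - 1) ^ 2 ∂G = ρ2)
    (hμ : 0 < μ) (hρ : 0 < ρ2) (hσ : 0 < σ2)
    (hY : 1 ≤ ((ℓ - 1 : ℕ) : ℝ) * (r - 1 : ℕ) * (ρ2 * σ2)) (hRρ : 1 ≤ (r - 1 : ℕ) * ρ2)
    {e ζ : ℝ}
    (he : e = drift μ (nodeMoment ρ2 σ2) (nodeChildren (ℓ - 1) (r - 1)) (2 * (k - 1)))
    (hζ : ζ = spread μ (nodeMoment ρ2 σ2) (nodeChildren (ℓ - 1) (r - 1)) (2 * (k - 1)))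
    (ω : Outcome m n) :
    (∫⋯∫⁻_(Finset.range ℓ).biUnion fun a => subtreeVars (walkVertex π d i) (walkEdge π d i)
        (branching (degrees ℓ r)) (2 * (k - 1)) [a],
      (fun ω => ENNReal.ofReal (Real.exp (-(e / ζ * bias qual (Sum.inl i) ω) *
        score (edges π) (coordResponse qual ω) (coordInit ω) k i))) ∂coordLaw F G) ω ≤
      ENNReal.ofReal (Real.exp (-(ℓ * e ^ 2 / (2 * ζ)) * bias qual (Sum.inl i) ω ^ 2)) := by
  have hL : 0 < ℓ - 1 := by omega
  have hR : 0 < r - 1 := by omega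
  have he0 : 0 < e := he ▸ drift_pos hμ hρ hσ hL hR _
  have hζ0 : 0 < ζ := hζ ▸ spread_pos hρ hσ hL hR _
  have hroot : walkVertex π d i [] = Sum.inl i := rfl
  have hb0 : branching (degrees ℓ r) ([] : List ℕ).length = ℓ := rfl
  have hd := hT.hasDistinctVars
  have hworker : ∀ w, IsAddress (branching (degrees ℓ r)) w → w.length.bodd = true →
      ∃ j, walkVertex π d i w = Sum.inr j := fun w hw hodd => by
    have h1 := walkVertex_isRight (π := π) (d := d) (i := i) hw
    rw [hodd] at h1
    exact ⟨_, (Sum.inr_getRight _ h1).symm⟩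
  have htask : ∀ w, IsAddress (branching (degrees ℓ r)) w → w.length.bodd = false →
      ∃ j, walkVertex π d i w = Sum.inl j := fun w hw hodd => by
    have h1 := walkVertex_isRight (π := π) (d := d) (i := i) hw
    rw [hodd] at h1
    exact ⟨_, (Sum.inl_getLeft _ (by simpa using h1)).symm⟩
  -- The total height is odd, so depth and height have opposite parity: workers sit at odd depth and
  -- even height, and in particular the leaves are workers.
  have hparity : ∀ t h, t + h = 2 * k - 1 → t.bodd = !h.bodd := fun t h hth => by
    have h1 : (t + h).bodd = true := by
      rw [hth, show 2 * k - 1 = 2 * (k - 1) + 1 by omega]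
      simp
    rw [Nat.bodd_add] at h1
    cases hh : h.bodd <;> cases ht : t.bodd <;> simp_all
  have h1 := lmarginal_children_le (F := F) (G := G) hqual hd (h := 2 * (k - 1)) (w := [])
    trivial (by simp; omega) (A := fun c => |c| ≤ e / ζ) (e := e) (ζ := ζ)
    (fun a ha c hc ω => by
      rw [he, hζ]
      refine lmarginal_subtreeVars_le hqual hqual1 hd ?_ ?_ ?_ (2 * (k - 1)) (a := a) (w := [])
        ⟨ha, trivial⟩ (by simp; omega) c ?_ ω
      · intro w hw hlen
        obtain ⟨j, hj⟩ := hworker w hw (by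
          simpa using hparity w.length 0 (by omega))
        rw [hj]
        exact hqμ j
      · intro w hw h hh hlen
        rcases hodd : h.bodd with _ | _
        · obtain ⟨j, hj⟩ := hworker w hw (by simpa [hodd] using hparity w.length h hlen)
          rw [hj, nodeMoment, hodd]
          exact hqσ j
        · obtain ⟨j, hj⟩ := htask w hw (by simpa [hodd] using hparity w.length h hlen)
          rw [hj, nodeMoment, hodd]
          exact hqρ j
      · intro t h ht hh hth
        rw [branching, if_neg (by omega), nodeChildren, degrees, hparity t h hth]
        cases h.bodd <;> rfl
      · intro j hj
        exact abs_mul_drift_le hμ hρ hσ hL hR hY hRρ hj (by rw [← he, ← hζ]; exact hc))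
    -- With `θ` the root bias, this value of `c` minimises `e θ c + ζ c² / 2`. It depends on the
    -- quality of the root only, and `|θ| ≤ 1` makes it admissible.
    (c := fun ω => -(e / ζ * bias qual (Sum.inl i) ω)) (C := {Sum.inl (Sum.inl i)})
    (fun x y hxy => by
      dsimp only [bias]
      rw [hxy (Sum.inl (Sum.inl i)) rfl])
    (fun a ha => Set.disjoint_singleton_left.2 fun hmem =>
      hd.inl_notMem_subtreeVars (w := []) ⟨ha, trivial⟩ (by simp; omega) hmem) ω
    (by
      rw [abs_neg, abs_mul, abs_of_pos (div_pos he0 hζ0)]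
      exact mul_le_of_le_one_right (div_pos he0 hζ0).le
        (abs_two_mul_sub_one_le (hqual1 _ _)))
  rw [hb0, hroot] at h1
  simp only [hT.score_eq hk]
  refine h1.trans_eq ?_
  congr 2
  field_simp
  ring

/-- The probability of an error at a task with tree-like neighbourhood. -/
theorem IsLocalTree.measure_error_le [IsProbabilityMeasure F] [IsProbabilityMeasure G]
    (hT : IsLocalTree d k i π) (hk : 1 ≤ k) (hℓ : 1 < ℓ) (hr : 1 < r)
    (hqual : ∀ x, Measurable (qual x)) (hqual1 : ∀ x p, qual x p ∈ Set.Icc (0 : ℝ) 1)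
    (hqμ : ∀ j, ∫ p, (2 * qual (Sum.inr j) p - 1) ∂F = μ)
    (hqσ : ∀ j, ∫ p, (2 * qual (Sum.inr j) p - 1) ^ 2 ∂F = σ2)
    (hqρ : ∀ i, ∫ p, (2 * qual (Sum.inl i) p - 1) ^ 2 ∂G = ρ2)
    (hμ : 0 < μ) (hρ : 0 < ρ2) (hσ : 0 < σ2)
    (hY : 1 ≤ ((ℓ - 1 : ℕ) : ℝ) * (r - 1 : ℕ) * (ρ2 * σ2)) (hRρ : 1 ≤ (r - 1 : ℕ) * ρ2)
    {e ζ : ℝ}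
    (he : e = drift μ (nodeMoment ρ2 σ2) (nodeChildren (ℓ - 1) (r - 1)) (2 * (k - 1)))
    (hζ : ζ = spread μ (nodeMoment ρ2 σ2) (nodeChildren (ℓ - 1) (r - 1)) (2 * (k - 1)))
    {B : Set unitInterval} (hB : MeasurableSet B) :
    Measure.pi (coordLaw F G) {ω : Outcome m n | ω (Sum.inl (Sum.inl i)) ∈ B ∧
        bias qual (Sum.inl i) ω *
          score (edges π) (coordResponse qual ω) (coordInit ω) k i ≤ 0} ≤
      ∫⁻ ω : Outcome m n, B.indicator 1 (ω (Sum.inl (Sum.inl i))) *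
        ENNReal.ofReal (Real.exp (-(ℓ * e ^ 2 / (2 * ζ)) * bias qual (Sum.inl i) ω ^ 2))
        ∂Measure.pi (coordLaw F G) := by
  have hL : 0 < ℓ - 1 := by omega
  have hR : 0 < r - 1 := by omega
  have he0 : 0 < e := he ▸ drift_pos hμ hρ hσ hL hR _
  have hζ0 : 0 < ζ := hζ ▸ spread_pos hρ hσ hL hR _
  have hd := hT.hasDistinctVars
  have hmscore : Measurable fun ω : Outcome m n =>
      score (edges π) (coordResponse qual ω) (coordInit ω) k i := by
    simp only [hT.score_eq hk]
    exact measurable_treeMessage hqual _ _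
  have hmind : Measurable fun ω : Outcome m n =>
      B.indicator (1 : unitInterval → ENNReal) (ω (Sum.inl (Sum.inl i))) :=
    (measurable_one.indicator hB).comp (measurable_pi_apply (Sum.inl (Sum.inl i)))
  have hmexp : Measurable fun ω : Outcome m n => ENNReal.ofReal (Real.exp
      (-(e / ζ * bias qual (Sum.inl i) ω) *
        score (edges π) (coordResponse qual ω) (coordInit ω) k i)) :=
    ((((measurable_bias hqual _).const_mul _).neg.mul hmscore).exp).ennreal_ofReal
  have hmexp2 : Measurable fun ω : Outcome m n => ENNReal.ofReal (Real.exp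
      (-(ℓ * e ^ 2 / (2 * ζ)) * bias qual (Sum.inl i) ω ^ 2)) :=
    ((((measurable_bias hqual _).pow_const 2).const_mul _).exp).ennreal_ofReal
  set S := (Finset.range ℓ).biUnion fun a => subtreeVars (walkVertex π d i) (walkEdge π d i)
        (branching (degrees ℓ r)) (2 * (k - 1)) [a] with hS
  have hnot : Disjoint ({Sum.inl (Sum.inl i)} : Set (Coord m n)) S := by
    refine Set.disjoint_singleton_left.2 fun hmem => ?_
    obtain ⟨a, ha, hmem⟩ := Finset.mem_biUnion.1 (Finset.mem_coe.1 hmem)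
    exact hd.inl_notMem_subtreeVars (w := []) ⟨Finset.mem_range.1 ha, trivial⟩
      (by simp; omega) hmem
  have hdep : ∀ φ : unitInterval → ENNReal,
      DependsOn (fun ω : Outcome m n => φ (ω (Sum.inl (Sum.inl i)))) {Sum.inl (Sum.inl i)} :=
    fun φ x y hxy => congrArg φ (hxy (Sum.inl (Sum.inl i)) rfl)
  have hset : MeasurableSet {ω : Outcome m n | ω (Sum.inl (Sum.inl i)) ∈ B ∧
      bias qual (Sum.inl i) ω *
        score (edges π) (coordResponse qual ω) (coordInit ω) k i ≤ 0} :=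
    (measurable_pi_apply (Sum.inl (Sum.inl i)) hB).inter
      (measurableSet_le ((measurable_bias hqual _).mul hmscore) measurable_const)
  rw [← lintegral_indicator_one hset]
  calc _ ≤ ∫⁻ ω : Outcome m n, B.indicator 1 (ω (Sum.inl (Sum.inl i))) *
        ENNReal.ofReal (Real.exp (-(e / ζ * bias qual (Sum.inl i) ω) *
          score (edges π) (coordResponse qual ω) (coordInit ω) k i))
          ∂Measure.pi (coordLaw F G) := by
        refine lintegral_mono fun ω => ?_
        by_cases hω : ω ∈ {ω : Outcome m n | ω (Sum.inl (Sum.inl i)) ∈ B ∧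
            bias qual (Sum.inl i) ω *
              score (edges π) (coordResponse qual ω) (coordInit ω) k i ≤ 0}
        · rw [Set.indicator_of_mem hω, Set.indicator_of_mem hω.1, Pi.one_apply, Pi.one_apply,
            one_mul, ENNReal.one_le_ofReal]
          refine Real.one_le_exp ?_
          have h1 := mul_nonneg (div_pos he0 hζ0).le (neg_nonneg.2 hω.2)
          linarith
        · rw [Set.indicator_of_notMem hω]
          exact zero_le
    _ ≤ _ := by
        -- Only the variables below the root are integrated here. The indicator of `B` and the final
        -- bound depend on the root quality alone and factor out.
        refine lintegral_le_of_lmarginal_le S (hmind.mul hmexp) (hmind.mul hmexp2) fun ω => ?_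
        rw [lmarginal_mul_left hmexp (hdep (B.indicator 1)) hnot,
          lmarginal_mul_left hmexp2 (hdep (B.indicator 1)) hnot]
        refine mul_le_mul_right ?_ _
        refine (hT.lmarginal_exp_le hk hℓ hr hqual hqual1 hqμ hqσ hqρ hμ hρ hσ hY hRρ he hζ
          ω).trans_eq ?_
        have h2 := lmarginal_mul_left (μ := coordLaw F G) (f := fun _ => 1) measurable_const
          (g := fun ω : Outcome m n => ENNReal.ofReal (Real.exp
            (-(ℓ * e ^ 2 / (2 * ζ)) * bias qual (Sum.inl i) ω ^ 2)))
          (hdep fun q => ENNReal.ofReal (Real.exp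
            (-(ℓ * e ^ 2 / (2 * ζ)) * (2 * qual (Sum.inl i) q - 1) ^ 2))) hnot ω
        simp only [mul_one] at h2
        rw [h2]
        simp [lmarginal]

end LocalError

/-! ### The law of the model as a product over all variables. -/

noncomputable section JointLaw

variable {m n ℓ r : ℕ} {F G : Measure unitInterval}

/-- The random quantities of the model other than the pairing. -/
abbrev Noise (m n : ℕ) : Type :=
  (Fin m → unitInterval) × (Fin n → unitInterval) ×
    (Fin m → Fin n → unitInterval) × (Fin n → Fin m → ℝ)

/-- The law of the model given the pairing. -/
def noiseLaw (m n : ℕ) (F G : Measure unitInterval) : Measure (Noise m n) :=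
  (Measure.pi fun _ : Fin m => G).prod
    ((Measure.pi fun _ : Fin n => F).prod
      ((Measure.pi fun _ : Fin m => Measure.pi fun _ : Fin n =>
          (volume : Measure unitInterval)).prod
        (Measure.pi fun _ : Fin n => Measure.pi fun _ : Fin m => gaussianReal 1 1)))

theorem law_eq : law m n ℓ r F G =
    (uniformOn (Set.univ : Set (Pairing m n ℓ r))).prod (noiseLaw m n F G) := rfl

instance instIsProbabilityMeasureNoiseLaw [IsProbabilityMeasure F] [IsProbabilityMeasure G] :
    IsProbabilityMeasure (noiseLaw m n F G) := by
  unfold noiseLaw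
  infer_instance

/-- The random quantities as a single family of independent variables. -/
def toOutcome (x : Noise m n) : Outcome m n
  | Sum.inl (Sum.inl i) => x.1 i
  | Sum.inl (Sum.inr j) => x.2.1 j
  | Sum.inr (Sum.inl e) => x.2.2.1 e.1 e.2
  | Sum.inr (Sum.inr e) => x.2.2.2 e.1 e.2

theorem measurable_toOutcome : Measurable (toOutcome : Noise m n → Outcome m n) := by
  refine measurable_pi_lambda _ fun v => ?_
  rcases v with (i | j) | e | e
  · exact (measurable_pi_apply i).comp measurable_fst
  · exact (measurable_pi_apply j).comp (measurable_fst.comp measurable_snd)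
  · exact (measurable_pi_apply e.2).comp ((measurable_pi_apply e.1).comp
      (measurable_fst.comp (measurable_snd.comp measurable_snd)))
  · exact (measurable_pi_apply e.2).comp ((measurable_pi_apply e.1).comp
      (measurable_snd.comp (measurable_snd.comp measurable_snd)))

/-- A product measure is determined by its values on boxes, and the preimage of a box is a product
of boxes. -/
theorem map_toOutcome [IsProbabilityMeasure F] [IsProbabilityMeasure G] :
    (noiseLaw m n F G).map toOutcome = Measure.pi (coordLaw F G) := by
  refine (Measure.pi_eq fun s hs => ?_).symm
  rw [Measure.map_apply measurable_toOutcome (MeasurableSet.univ_pi hs)]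
  have h1 : (toOutcome : Noise m n → Outcome m n) ⁻¹' Set.univ.pi s =
      (Set.univ.pi fun i => s (Sum.inl (Sum.inl i))) ×ˢ
      (Set.univ.pi fun j => s (Sum.inl (Sum.inr j))) ×ˢ
      (Set.univ.pi fun i => Set.univ.pi fun j => s (Sum.inr (Sum.inl (i, j)))) ×ˢ
      (Set.univ.pi fun j => Set.univ.pi fun i => s (Sum.inr (Sum.inr (j, i)))) := by
    ext x
    simp only [Set.mem_preimage, Set.mem_univ_pi, Set.mem_prod, Sum.forall, Prod.forall,
      and_assoc]
    rfl
  rw [h1, noiseLaw, Measure.prod_prod, Measure.prod_prod, Measure.prod_prod]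
  simp only [Measure.pi_pi, Fintype.prod_sum_type, Fintype.prod_prod_type, mul_assoc]
  rfl

theorem measurable_score {Ω : Type*} [MeasurableSpace Ω] (E : Finset (Fin m × Fin n))
    {A : Ω → Fin m → Fin n → ℝ} {z : Ω → Fin n → Fin m → ℝ}
    (hA : ∀ i j, Measurable fun ω => A ω i j) (hz : ∀ j i, Measurable fun ω => z ω j i)
    (k : ℕ) (i : Fin m) : Measurable fun ω => score E (A ω) (z ω) k i := by
  have h1 : ∀ s j i, Measurable fun ω => workerMessage E (A ω) (z ω) s j i := by
    intro s
    induction s with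
    | zero => exact hz
    | succ s ih =>
      intro j i
      simp only [workerMessage, workerUpdate, taskUpdate]
      exact Finset.measurable_fun_sum _ fun i' _ => (hA i' j).mul
        (Finset.measurable_fun_sum _ fun j' _ => (hA i' j').mul (ih j' i'))
  exact Finset.measurable_fun_sum _ fun j _ => (hA i j).mul (h1 _ j i)

theorem measurable_sign : Measurable Real.sign := by
  unfold Real.sign
  exact Measurable.ite (measurableSet_lt measurable_id measurable_const) measurable_const
    (Measurable.ite (measurableSet_lt measurable_const measurable_id) measurable_const
      measurable_const)

/-- The difference of the sign of a number and that of another forces the product to be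
nonpositive. -/
theorem mul_nonpos_of_sign_ne {x y : ℝ} (h : Real.sign x ≠ Real.sign y) : x * y ≤ 0 := by
  by_contra! hxy
  rcases pos_and_pos_or_neg_and_neg_of_mul_pos hxy with ⟨hx, hy⟩ | ⟨hx, hy⟩
  · exact h (by rw [Real.sign_of_pos hx, Real.sign_of_pos hy])
  · exact h (by rw [Real.sign_of_neg hx, Real.sign_of_neg hy])

end JointLaw

/-! ### Averaging over the pairing. -/

noncomputable section ErrorProbability

variable {m n ℓ r k : ℕ} {F G : Measure unitInterval}

theorem measurable_difficulty : Measurable difficulty := by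
  unfold difficulty
  fun_prop

theorem difficulty_le_one (q : unitInterval) : difficulty q ≤ 1 := by
  rw [difficulty, ← sq_abs]
  exact pow_le_one₀ (abs_nonneg _) (abs_two_mul_sub_one_le q.2)

theorem difficulty_nonneg (q : ℝ) : 0 ≤ difficulty q := sq_nonneg _

theorem integrable_difficulty [IsProbabilityMeasure G] :
    Integrable (fun q : unitInterval => difficulty q) G :=
  integrable_of_abs_le_one G (measurable_difficulty.comp measurable_subtype_coe) fun q => by
    rw [abs_of_nonneg (difficulty_nonneg _)]
    exact difficulty_le_one q

theorem meanDifficulty_le_one [IsProbabilityMeasure G] : meanDifficulty G ≤ 1 := by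
  refine (integral_mono integrable_difficulty (integrable_const 1) difficulty_le_one).trans_eq ?_
  simp

theorem meanDifficulty_nonneg : 0 ≤ meanDifficulty G :=
  integral_nonneg fun _ => difficulty_nonneg _

theorem crowdQuality_eq_meanDifficulty : crowdQuality F = meanDifficulty F := rfl

/-- There are finitely many pairings, so measurability can be checked with the pairing fixed. -/
theorem measurableSet_of_forall_slice {α β : Type*} [MeasurableSpace α] [Countable α]
    [MeasurableSingletonClass α] [MeasurableSpace β] {S : Set (α × β)}
    (h : ∀ a, MeasurableSet (Prod.mk a ⁻¹' S)) : MeasurableSet S := by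
  have h1 : S = ⋃ a, {a} ×ˢ (Prod.mk a ⁻¹' S) := by
    ext ⟨a, b⟩
    simp
  rw [h1]
  exact MeasurableSet.iUnion fun a => (measurableSet_singleton a).prod (h a)

/-- Measurability of the score when the tasks have qualities `q`. -/
theorem measurable_score_sample {q : Sample m n ℓ r → Fin m → ℝ}
    (hq : ∀ π : Pairing m n ℓ r, ∀ i, Measurable fun x : Noise m n => q (π, x) i)
    (π : Pairing m n ℓ r) (i : Fin m) :
    Measurable fun x : Noise m n => score (edges π)
      (fun i j => response (q (π, x) i) (x.2.1 j) (x.2.2.1 i j)) x.2.2.2 k i := by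
  refine measurable_score (edges π) (A := fun x : Noise m n => fun i j =>
    response (q (π, x) i) (x.2.1 j) (x.2.2.1 i j)) (z := fun x : Noise m n => x.2.2.2)
    (fun i j => measurable_response (hq π i) ?_ ?_) (fun j i => ?_) k i <;> fun_prop

theorem measurableSet_sign_ne_estimate {q : Sample m n ℓ r → Fin m → ℝ}
    (hq : ∀ π : Pairing m n ℓ r, ∀ i, Measurable fun x : Noise m n => q (π, x) i)
    {t : Sample m n ℓ r → ℝ} (ht : ∀ π : Pairing m n ℓ r, Measurable fun x : Noise m n => t (π, x))
    (i : Fin m) : MeasurableSet {ω : Sample m n ℓ r | t ω ≠ estimate (q ω) k ω i} :=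
  measurableSet_of_forall_slice fun π =>
    (measurableSet_eq_fun (ht π) (measurable_sign.comp (measurable_score_sample hq π i))).compl

theorem isProbabilityMeasure_uniformOn_pairing (hmn : m * ℓ = n * r) :
    IsProbabilityMeasure (uniformOn (Set.univ : Set (Pairing m n ℓ r))) := by
  have := nonempty_pairing hmn
  exact isProbabilityMeasure_uniformOn Set.finite_univ Set.univ_nonempty

theorem isProbabilityMeasure_law [IsProbabilityMeasure F] [IsProbabilityMeasure G]
    (hmn : m * ℓ = n * r) : IsProbabilityMeasure (law m n ℓ r F G) := by
  have := isProbabilityMeasure_uniformOn_pairing hmn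
  rw [law_eq]
  infer_instance

theorem measurePreserving_noise_taskQuality [IsProbabilityMeasure F] [IsProbabilityMeasure G]
    (i : Fin m) : MeasurePreserving (fun x : Noise m n => x.1 i) (noiseLaw m n F G) G :=
  (measurePreserving_eval (fun _ : Fin m => G) i).comp measurePreserving_fst

theorem measurePreserving_law_taskQuality [IsProbabilityMeasure F] [IsProbabilityMeasure G]
    (hmn : m * ℓ = n * r) (i : Fin m) :
    MeasurePreserving (fun ω : Sample m n ℓ r => ω.2.1 i) (law m n ℓ r F G) G := by
  have := isProbabilityMeasure_uniformOn_pairing hmn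
  exact (measurePreserving_noise_taskQuality i).comp measurePreserving_snd

/-- The assumptions on the parameters of the model. -/
structure Supercritical (m n ℓ r : ℕ) (F G : Measure unitInterval) : Prop where
  one_lt_left : 1 < ℓ
  one_lt_right : 1 < r
  balanced : m * ℓ = n * r
  crowdMean_pos : 0 < crowdMean F
  one_lt_growth : 1 < ((ℓ : ℝ) - 1) * ((r : ℝ) - 1) * meanDifficulty G ^ 2 * crowdQuality F ^ 2
  one_lt_task : 1 < ((r : ℝ) - 1) * meanDifficulty G

namespace Supercritical

theorem meanDifficulty_pos (h : Supercritical m n ℓ r F G) : 0 < meanDifficulty G := by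
  refine meanDifficulty_nonneg.lt_of_ne fun h0 => ?_
  have := h.one_lt_task
  rw [← h0] at this
  norm_num at this

theorem crowdQuality_pos (h : Supercritical m n ℓ r F G) : 0 < crowdQuality F := by
  refine (meanDifficulty_nonneg (G := F)).lt_of_ne fun h0 => ?_
  have := h.one_lt_growth
  rw [crowdQuality_eq_meanDifficulty, ← h0] at this
  norm_num at this

/-- Since the mean difficulty is at most one, `one_lt_task` forces `r - 1 > 1`. This supplies the
branching ratio at least two needed for the tree estimate. -/
theorem two_lt_right [IsProbabilityMeasure G] (h : Supercritical m n ℓ r F G) : 2 < r := by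
  have h1 := h.one_lt_task
  have h2 : ((r : ℝ) - 1) * meanDifficulty G ≤ ((r : ℝ) - 1) * 1 :=
    mul_le_mul_of_nonneg_left meanDifficulty_le_one
      (sub_nonneg.2 (by exact_mod_cast h.one_lt_right.le))
  have h3 : (2 : ℝ) < r := by linarith
  exact_mod_cast h3

theorem cast_left (h : Supercritical m n ℓ r F G) : ((ℓ - 1 : ℕ) : ℝ) = (ℓ : ℝ) - 1 := by
  rw [Nat.cast_sub h.one_lt_left.le, Nat.cast_one]

theorem cast_right (h : Supercritical m n ℓ r F G) : ((r - 1 : ℕ) : ℝ) = (r : ℝ) - 1 := by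
  rw [Nat.cast_sub h.one_lt_right.le, Nat.cast_one]

theorem one_lt_growth' (h : Supercritical m n ℓ r F G) :
    1 < ((ℓ - 1 : ℕ) : ℝ) * (r - 1 : ℕ) * (meanDifficulty G * crowdQuality F) ^ 2 := by
  have := h.one_lt_growth
  rw [h.cast_left, h.cast_right, mul_pow]
  linarith

/-- Both second moments are at most one, so dropping a factor of their product only increases the
growth rate. This is the condition for monotone drifts. -/
theorem one_le_growth_sqrt [IsProbabilityMeasure F] [IsProbabilityMeasure G]
    (h : Supercritical m n ℓ r F G) :
    1 ≤ ((ℓ - 1 : ℕ) : ℝ) * (r - 1 : ℕ) * (meanDifficulty G * crowdQuality F) := by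
  refine h.one_lt_growth'.le.trans (mul_le_mul_of_nonneg_left ?_ (by positivity))
  have h0 : 0 ≤ meanDifficulty G * crowdQuality F :=
    mul_nonneg h.meanDifficulty_pos.le h.crowdQuality_pos.le
  refine pow_le_of_le_one h0 ?_ two_ne_zero
  exact mul_le_one₀ meanDifficulty_le_one h.crowdQuality_pos.le
    (meanDifficulty_le_one (G := F))

/-- The effective variance in terms of the drift and the spread of the messages. -/
theorem effVariance_eq (h : Supercritical m n ℓ r F G) :
    effVariance ℓ r k F G = crowdQuality F *
        spread (crowdMean F) (nodeMoment (meanDifficulty G) (crowdQuality F))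
          (nodeChildren (ℓ - 1) (r - 1)) (2 * (k - 1)) /
        drift (crowdMean F) (nodeMoment (meanDifficulty G) (crowdQuality F))
          (nodeChildren (ℓ - 1) (r - 1)) (2 * (k - 1)) ^ 2 := by
  rw [spread_div_drift_sq h.crowdMean_pos h.meanDifficulty_pos h.crowdQuality_pos
    (by have := h.one_lt_left; omega) (by have := h.one_lt_right; omega) h.one_lt_growth'.ne',
    h.cast_left, h.cast_right, effVariance]

theorem effVariance_pos (h : Supercritical m n ℓ r F G) : 0 < effVariance ℓ r k F G := by
  have hL : 0 < ℓ - 1 := by have := h.one_lt_left; omega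
  have hR : 0 < r - 1 := by have := h.one_lt_right; omega
  rw [h.effVariance_eq]
  have h1 := h.crowdQuality_pos
  have h2 := spread_pos (μ := crowdMean F) h.meanDifficulty_pos h1 hL hR (k - 1)
  have h3 := drift_pos h.crowdMean_pos h.meanDifficulty_pos h1 hL hR (k - 1)
  positivity

/-- The probability that the task `i` is misclassified and that its quality lies in `B`. -/
theorem law_inter_le [IsProbabilityMeasure F] [IsProbabilityMeasure G]
    (h : Supercritical m n ℓ r F G) (hk : 1 ≤ k) {q : Fin m → unitInterval → ℝ}
    (hqm : ∀ i, Measurable (q i)) (hq1 : ∀ i p, q i p ∈ Set.Icc (0 : ℝ) 1)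
    (hq2 : ∀ i (p : unitInterval), (2 * q i p - 1) ^ 2 = difficulty p) (i : Fin m)
    {E : Set (Sample m n ℓ r)} (hE : MeasurableSet E)
    (hEi : ∀ ω ∈ E, (2 * q i (ω.2.1 i) - 1) * score (edges ω.1)
      (fun i j => response (q i (ω.2.1 i)) (ω.2.2.1 j) (ω.2.2.2.1 i j)) ω.2.2.2.2 k i ≤ 0)
    {B : Set unitInterval} (hB : MeasurableSet B) :
    law m n ℓ r F G (E ∩ (fun ω => ω.2.1 i) ⁻¹' B) ≤
      ∫⁻ ω in (fun ω => ω.2.1 i) ⁻¹' B,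
        ENNReal.ofReal (errorBound m ℓ r k F G (difficulty (quality ω i)))
        ∂law m n ℓ r F G := by
  have hprob := isProbabilityMeasure_uniformOn_pairing h.balanced
  have hL : 0 < ℓ - 1 := by have := h.one_lt_left; omega
  have hR : 0 < r - 1 := by have := h.one_lt_right; omega
  set ρ2 := meanDifficulty G with hρ2
  set σ2 := crowdQuality F with hσ2
  set e := drift (crowdMean F) (nodeMoment ρ2 σ2) (nodeChildren (ℓ - 1) (r - 1)) (2 * (k - 1))
    with he
  set ζ := spread (crowdMean F) (nodeMoment ρ2 σ2) (nodeChildren (ℓ - 1) (r - 1)) (2 * (k - 1))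
    with hζ
  have hσ0 : 0 < σ2 := h.crowdQuality_pos
  have he0 : 0 < e := drift_pos h.crowdMean_pos h.meanDifficulty_pos hσ0 hL hR _
  have hζ0 : 0 < ζ := spread_pos h.meanDifficulty_pos hσ0 hL hR _
  set δ : ℝ := 3 * (ℓ : ℝ) * (r : ℝ) / (m : ℝ) * (((ℓ : ℝ) - 1) * ((r : ℝ) - 1)) ^ (2 * k - 2)
    with hδ
  have hδ0 : 0 ≤ δ := by
    rw [hδ, ← h.cast_left, ← h.cast_right]
    positivity
  set φ : unitInterval → ENNReal := fun p =>
    ENNReal.ofReal (Real.exp (-(ℓ * e ^ 2 / (2 * ζ)) * difficulty p)) with hφ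
  have hφm : Measurable φ :=
    (((measurable_difficulty.comp measurable_subtype_coe).const_mul _).exp).ennreal_ofReal
  have hbound : ∀ p : unitInterval, ENNReal.ofReal (errorBound m ℓ r k F G (difficulty p)) =
      φ p + ENNReal.ofReal δ := fun p => by
    rw [errorBound, ENNReal.ofReal_add (Real.exp_pos _).le hδ0, hφ, h.effVariance_eq]
    congr 3
    rw [← hρ2, ← hσ2, ← he, ← hζ]
    field_simp
  have hBi : MeasurableSet ((fun ω : Sample m n ℓ r => ω.2.1 i) ⁻¹' B) :=
    (measurePreserving_law_taskQuality (F := F) (G := G) h.balanced i).measurable hB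
  have hrhs : ∫⁻ ω in (fun ω => ω.2.1 i) ⁻¹' B,
      ENNReal.ofReal (errorBound m ℓ r k F G (difficulty (quality ω i))) ∂law m n ℓ r F G =
      ∫⁻ p, B.indicator 1 p * φ p ∂G + ENNReal.ofReal δ * G B := by
    have h1 := (measurePreserving_law_taskQuality (F := F) (G := G) h.balanced
      i).setLIntegral_comp_preimage hB (f := fun p => φ p + ENNReal.ofReal δ)
      (hφm.add_const _)
    simp only [quality, hbound]
    rw [h1, lintegral_add_right _ measurable_const, setLIntegral_const]
    congr 1
    rw [← lintegral_indicator hB]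
    refine lintegral_congr fun p => ?_
    by_cases hp : p ∈ B <;> simp [hp]
  rw [hrhs, law_eq, Measure.prod_apply (hE.inter hBi)]
  -- The default half-edge; its choice is immaterial.
  set d : HalfEdge m n ℓ r := Sum.inl (i, ⟨0, by have := h.one_lt_left; omega⟩) with hd
  -- For a tree-like pairing the Chernoff bound applies. For any other only the event on the quality
  -- is kept; its probability `G B` does not depend on the pairing, so the tree estimate remains as
  -- a factor.
  have hslice : ∀ π : Pairing m n ℓ r,
      noiseLaw m n F G (Prod.mk π ⁻¹' (E ∩ (fun ω => ω.2.1 i) ⁻¹' B)) ≤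
      ∫⁻ p, B.indicator 1 p * φ p ∂G +
        {π : Pairing m n ℓ r | ¬ IsLocalTree d k i π}.indicator 1 π * G B := by
    intro π
    by_cases hπ : IsLocalTree d k i π
    · refine le_trans ?_ le_self_add
      set qual : Fin m ⊕ Fin n → unitInterval → ℝ := Sum.elim q fun _ => (↑) with hqual
      have hmeas : ∀ x, Measurable (qual x) := by
        rintro (i | j)
        · exact hqm i
        · exact measurable_subtype_coe
      have hIcc : ∀ x p, qual x p ∈ Set.Icc (0 : ℝ) 1 := by
        rintro (i | j) p
        · exact hq1 i p
        · exact p.2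
      have h1 := hπ.measure_error_le (F := F) (G := G) hk h.one_lt_left h.one_lt_right hmeas hIcc
        (μ := crowdMean F) (ρ2 := ρ2) (σ2 := σ2)
        (fun _ => rfl) (fun _ => rfl) (fun i => integral_congr_ae
          (Filter.Eventually.of_forall (hq2 i))) h.crowdMean_pos h.meanDifficulty_pos hσ0
        h.one_le_growth_sqrt (by rw [h.cast_right]; exact h.one_lt_task.le) he hζ hB
      rw [← map_toOutcome] at h1
      refine (measure_mono ?_).trans
        ((Measure.le_map_apply measurable_toOutcome.aemeasurable _).trans (h1.trans_eq ?_))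
      · intro x hx
        exact ⟨hx.2, hEi _ hx.1⟩
      · rw [map_toOutcome]
        have h2 := (measurePreserving_eval (coordLaw F G)
          (Sum.inl (Sum.inl i) : Coord m n)).lintegral_comp
          (f := fun p : unitInterval => B.indicator 1 p * φ p)
          ((measurable_one.indicator hB).mul hφm)
        refine Eq.trans (lintegral_congr fun ω => ?_) h2
        simp only [hφ, bias, Function.eval]
        rw [← hq2 i]
        rfl
    · refine le_trans (measure_mono (t := (fun x : Noise m n => x.1 i) ⁻¹' B)
        fun x hx => hx.2) (le_trans ?_ le_add_self)
      rw [Set.indicator_of_mem hπ, Pi.one_apply, one_mul,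
        (measurePreserving_noise_taskQuality i).measure_preimage hB.nullMeasurableSet]
  refine (lintegral_mono hslice).trans ?_
  rw [lintegral_add_left measurable_const, lintegral_const, measure_univ, mul_one,
    lintegral_mul_const _ (measurable_of_countable _), lintegral_indicator_one MeasurableSpace.measurableSet_top]
  gcongr
  exact uniformOn_not_isLocalTree_le h.one_lt_left h.two_lt_right h.balanced d hk i

end Supercritical

end ErrorProbability

/-! ### From bounds on events to conditional probabilities. -/

noncomputable section ConditionalError

/-- Both functions are measurable for the smaller σ-algebra, so they can be compared through
integrals over its sets, after restricting the measure to it. -/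
theorem condProb_le_of_measure_inter_le {Ω : Type*} {m m₀ : MeasurableSpace Ω} (hm : m ≤ m₀)
    {P : Measure Ω} [IsProbabilityMeasure P] {E : Set Ω} (hE : MeasurableSet[m₀] E) {f : Ω → ℝ}
    (hf : Measurable[m] f) (hfint : Integrable f P) (hf0 : ∀ ω, 0 ≤ f ω)
    (h : ∀ s, MeasurableSet[m] s → P (E ∩ s) ≤ ∫⁻ ω in s, ENNReal.ofReal (f ω) ∂P) :
    P⟦E | m⟧ ≤ᵐ[P] f := by
  have hfs : StronglyMeasurable[m] f := hf.stronglyMeasurable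
  refine ae_le_of_ae_le_trim (hm := hm) ?_
  refine ae_le_of_forall_setIntegral_le
    (integrable_condExp.trim hm stronglyMeasurable_condExp) (hfint.trim hm hfs) fun s hs _ => ?_
  rw [← setIntegral_trim hm stronglyMeasurable_condExp hs, ← setIntegral_trim hm hfs hs,
    setIntegral_condExp hm ((integrable_const 1).indicator hE) hs,
    setIntegral_indicator hE, setIntegral_const, smul_eq_mul, mul_one, Set.inter_comm,
    measureReal_def]
  refine ENNReal.toReal_le_of_le_ofReal (integral_nonneg fun ω => hf0 ω) ((h s hs).trans_eq ?_)
  rw [ofReal_integral_eq_lintegral_ofReal hfint.integrableOn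
    (Filter.Eventually.of_forall fun ω => hf0 ω)]

variable {m n ℓ r k : ℕ} {F G : Measure unitInterval}

theorem measurable_quality (i : Fin m) : Measurable fun ω : Sample m n ℓ r => quality ω i :=
  measurable_subtype_coe.comp ((measurable_pi_apply i).comp (measurable_fst.comp measurable_snd))

theorem measurable_errorBound : Measurable (errorBound m ℓ r k F G) := by
  unfold errorBound
  fun_prop

theorem measurableSet_errorEvent (i : Fin m) :
    MeasurableSet (errorEvent (n := n) (ℓ := ℓ) (r := r) k i) :=
  measurableSet_sign_ne_estimate (q := quality)
    (t := fun ω => Real.sign (2 * quality ω i - 1))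
    (fun π i => (measurable_quality (r := r) i).comp (measurable_prodMk_left (x := π)))
    (fun π => measurable_sign.comp ((((measurable_quality (r := r) i).comp
      (measurable_prodMk_left (x := π))).const_mul 2).sub_const 1)) i

theorem measurableSet_labelledErrorEvent (t : Fin m → ℝ) (i : Fin m) :
    MeasurableSet (labelledErrorEvent (n := n) (ℓ := ℓ) (r := r) t k i) :=
  measurableSet_sign_ne_estimate (q := labelledQuality t) (t := fun _ => t i)
    (fun π i => (((((measurable_difficulty.comp
      ((measurable_quality (r := r) i).comp (measurable_prodMk_left (x := π)))).sqrt).const_mul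
        (t i)).const_add 1).div_const 2)) (fun _ => measurable_const) i

namespace Supercritical

theorem errorBound_nonneg (h : Supercritical m n ℓ r F G) (x : ℝ) :
    0 ≤ errorBound m ℓ r k F G x := by
  rw [errorBound, ← h.cast_left, ← h.cast_right]
  positivity

theorem errorBound_le (h : Supercritical m n ℓ r F G) {x : ℝ} (hx : 0 ≤ x) :
    errorBound m ℓ r k F G x ≤ errorBound m ℓ r k F G 0 := by
  have h1 := h.effVariance_pos (k := k)
  have h2 := h.crowdQuality_pos
  rw [errorBound, errorBound, mul_zero, neg_zero, zero_div]
  gcongr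
  exact div_nonpos_of_nonpos_of_nonneg (neg_nonpos.2 (by positivity)) (by positivity)

/-- The conditioning variable `g` is either the difficulty or the quality itself. That `φ` recovers
the difficulty from it makes the bound measurable. The assumption on `q` fixes squared biases only,
which admits prescribed labels. -/
theorem condProb_le [IsProbabilityMeasure F] [IsProbabilityMeasure G]
    (h : Supercritical m n ℓ r F G) (hk : 1 ≤ k) {q : Fin m → unitInterval → ℝ}
    (hqm : ∀ i, Measurable (q i)) (hq1 : ∀ i p, q i p ∈ Set.Icc (0 : ℝ) 1)
    (hq2 : ∀ i (p : unitInterval), (2 * q i p - 1) ^ 2 = difficulty p) (i : Fin m)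
    {E : Set (Sample m n ℓ r)} (hE : MeasurableSet E)
    (hEi : ∀ ω ∈ E, (2 * q i (ω.2.1 i) - 1) * score (edges ω.1)
      (fun i j => response (q i (ω.2.1 i)) (ω.2.2.1 j) (ω.2.2.2.1 i j)) ω.2.2.2.2 k i ≤ 0)
    {g φ : ℝ → ℝ} (hg : Measurable g) (hφ : Measurable φ) (hgφ : ∀ x, difficulty x = φ (g x)) :
    (law m n ℓ r F G)⟦E | MeasurableSpace.comap (fun ω => g (quality ω i)) inferInstance⟧
      ≤ᵐ[law m n ℓ r F G] fun ω => errorBound m ℓ r k F G (difficulty (quality ω i)) := by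
  have := isProbabilityMeasure_law (F := F) (G := G) h.balanced
  have hgm : Measurable fun ω : Sample m n ℓ r => g (quality ω i) := hg.comp (measurable_quality i)
  refine condProb_le_of_measure_inter_le hgm.comap_le hE ?_ ?_ (fun ω => h.errorBound_nonneg _) ?_
  · simp only [hgφ]
    exact (measurable_errorBound.comp hφ).comp (comap_measurable _)
  · refine Integrable.of_bound (measurable_errorBound.comp
      (measurable_difficulty.comp (measurable_quality i))).aestronglyMeasurable
      (errorBound m ℓ r k F G 0) (Filter.Eventually.of_forall fun ω => ?_)
    rw [Real.norm_eq_abs, abs_of_nonneg (h.errorBound_nonneg _)]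
    exact h.errorBound_le (difficulty_nonneg _)
  · rintro s ⟨B, hB, rfl⟩
    exact h.law_inter_le hk hqm hq1 hq2 i hE hEi (B := (fun p : unitInterval => g p) ⁻¹' B)
      ((hg.comp measurable_subtype_coe) hB)

end Supercritical

theorem mul_score_nonpos_of_mem_errorEvent {i : Fin m} {ω : Sample m n ℓ r}
    (hω : ω ∈ errorEvent k i) : (2 * (ω.2.1 i : ℝ) - 1) * score (edges ω.1)
      (fun i j => response (ω.2.1 i) (ω.2.2.1 j) (ω.2.2.2.1 i j)) ω.2.2.2.2 k i ≤ 0 :=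
  mul_nonpos_of_sign_ne hω

/-- The task quality with label `s` and the difficulty of `p`. -/
def relabel (s : ℝ) (p : unitInterval) : ℝ := (1 + s * √(difficulty p)) / 2

theorem measurable_relabel (s : ℝ) : Measurable (relabel s) :=
  ((((measurable_difficulty.comp measurable_subtype_coe).sqrt).const_mul s).const_add 1).div_const 2

theorem two_mul_relabel_sub_one (s : ℝ) (p : unitInterval) :
    2 * relabel s p - 1 = s * √(difficulty p) := by
  rw [relabel]
  ring

theorem two_mul_relabel_sub_one_sq {s : ℝ} (hs : s = 1 ∨ s = -1) (p : unitInterval) :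
    (2 * relabel s p - 1) ^ 2 = difficulty p := by
  rw [two_mul_relabel_sub_one, mul_pow, Real.sq_sqrt (difficulty_nonneg _)]
  rcases hs with rfl | rfl <;> norm_num

theorem relabel_mem_Icc {s : ℝ} (hs : s = 1 ∨ s = -1) (p : unitInterval) :
    relabel s p ∈ Set.Icc (0 : ℝ) 1 := by
  have h1 : |2 * relabel s p - 1| ≤ 1 := by
    rw [← sq_le_one_iff_abs_le_one, two_mul_relabel_sub_one_sq hs]
    exact difficulty_le_one p
  obtain ⟨h2, h3⟩ := abs_le.1 h1
  constructor <;> linarith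

/-- The prescribed label need not be the sign of the bias when the difficulty vanishes, but then the
product is zero. A positive product forces the score to have the sign of the label. -/
theorem mul_score_nonpos_of_mem_labelledErrorEvent {t : Fin m → ℝ}
    (ht : ∀ i, t i = 1 ∨ t i = -1) {i : Fin m} {ω : Sample m n ℓ r}
    (hω : ω ∈ labelledErrorEvent t k i) :
    (2 * relabel (t i) (ω.2.1 i) - 1) * score (edges ω.1)
      (fun i j => response (relabel (t i) (ω.2.1 i)) (ω.2.2.1 j) (ω.2.2.2.1 i j))
        ω.2.2.2.2 k i ≤ 0 := by
  by_contra! h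
  refine hω (Eq.symm ?_)
  rw [two_mul_relabel_sub_one] at h
  change Real.sign (score (edges ω.1)
    (fun i j => response (relabel (t i) (ω.2.1 i)) (ω.2.2.1 j) (ω.2.2.2.1 i j)) ω.2.2.2.2 k i) = t i
  have h0 := Real.sqrt_nonneg (difficulty (ω.2.1 i : ℝ))
  rcases ht i with h1 | h1
  · rw [h1, one_mul] at h
    rw [h1, Real.sign_of_pos (pos_of_mul_pos_right h h0)]
  · rw [h1, neg_one_mul, neg_mul_comm] at h
    rw [h1, Real.sign_of_neg (neg_pos.1 (pos_of_mul_pos_right h h0))]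

end ConditionalError

/-! ### Budget sufficient for a given average error. -/

noncomputable section Budget

variable {m n ℓ r k : ℕ} {F G : Measure unitInterval}

theorem le_meanDifficulty [IsProbabilityMeasure G] {lamMin : ℝ}
    (h : ∀ᵐ q : unitInterval ∂G, lamMin ≤ difficulty q) : lamMin ≤ meanDifficulty G := by
  have := integral_mono_ae (integrable_const lamMin) integrable_difficulty h
  simpa [meanDifficulty] using this

/-- The initial term is at most `1` after enough iterations; in the second, `1 + 1/b ≤ 2` and the
geometric factor is at most `2`. Thus `13 = 1 + 3 * 2 * 2`. -/
theorem effVariance_le (hμ : 0 < crowdMean F) (hσ : crowdQuality F ≤ 1)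
    (hb : 1 ≤ ((r : ℝ) - 1) * meanDifficulty G * crowdQuality F)
    (hX : 2 ≤ ((ℓ : ℝ) - 1) * ((r : ℝ) - 1) * (meanDifficulty G * crowdQuality F) ^ 2)
    (hk : 2 / crowdMean F ^ 2 ≤ 2 ^ (k - 1)) : effVariance ℓ r k F G ≤ 13 := by
  rw [effVariance]
  set X := ((ℓ : ℝ) - 1) * ((r : ℝ) - 1) * (meanDifficulty G * crowdQuality F) ^ 2
  set b := ((r : ℝ) - 1) * meanDifficulty G * crowdQuality F
  have hX0 : 0 < X := by linarith
  have h1 : 2 * crowdQuality F / (crowdMean F ^ 2 * X ^ (k - 1)) ≤ 1 := by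
    rw [div_le_one (by positivity)]
    rw [div_le_iff₀ (by positivity)] at hk
    have h2 : (2 : ℝ) ^ (k - 1) ≤ X ^ (k - 1) := pow_le_pow_left₀ zero_le_two hX _
    have h3 := mul_le_mul_of_nonneg_right h2 (sq_nonneg (crowdMean F))
    linarith
  have h4 : 1 / b ≤ 1 := by
    rw [div_le_one (by linarith)]
    exact hb
  have h4' : 0 ≤ 1 / b := by positivity
  have h5 : 1 / X ≤ 1 / 2 := one_div_le_one_div_of_le two_pos hX
  have h6 : (1 - 1 / X ^ (k - 1)) / (1 - 1 / X) ≤ 2 := by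
    rw [div_le_iff₀ (by linarith)]
    have : 0 ≤ 1 / X ^ (k - 1) := by positivity
    linarith
  have h7 : 3 * (1 + 1 / b) * ((1 - 1 / X ^ (k - 1)) / (1 - 1 / X)) ≤ 3 * (1 + 1) * 2 := by
    calc _ ≤ 3 * (1 + 1 / b) * 2 := mul_le_mul_of_nonneg_left h6 (by positivity)
      _ ≤ _ := by linarith
  linarith

/-- The growth rate of the signal-to-noise ratio exceeds a multiple of `ℓ`. -/
theorem growth_ge {a c ρ2 σ2 lamMin : ℝ} (ha : 1 ≤ a) (hlam : 0 < lamMin) (hσ : 0 < σ2)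
    (hρ : lamMin ≤ ρ2) (hb : 1 ≤ c * ρ2 * σ2) :
    (a + 1) / 2 * (lamMin * σ2) ≤ a * c * (ρ2 * σ2) ^ 2 := by
  have h1 : lamMin * σ2 ≤ ρ2 * σ2 := mul_le_mul_of_nonneg_right hρ hσ.le
  have h2 : 0 < lamMin * σ2 := mul_pos hlam hσ
  calc (a + 1) / 2 * (lamMin * σ2) ≤ a * (ρ2 * σ2) :=
        mul_le_mul (by linarith) h1 h2.le (by linarith)
    _ ≤ a * (ρ2 * σ2) * (c * ρ2 * σ2) :=
        le_mul_of_one_le_right (mul_nonneg (by linarith) (h2.le.trans h1)) hb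
    _ = _ := by ring

theorem Supercritical.measureReal_errorEvent_le [IsProbabilityMeasure F] [IsProbabilityMeasure G]
    (h : Supercritical m n ℓ r F G) (hk : 1 ≤ k) (i : Fin m) {lamMin : ℝ}
    (hlam : ∀ᵐ q : unitInterval ∂G, lamMin ≤ difficulty q) :
    (law m n ℓ r F G).real (errorEvent k i) ≤ errorBound m ℓ r k F G lamMin := by
  have := isProbabilityMeasure_law (F := F) (G := G) h.balanced
  refine ENNReal.toReal_le_of_le_ofReal (h.errorBound_nonneg _) ?_
  have h1 := h.law_inter_le hk (q := fun _ => (↑)) (fun _ => measurable_subtype_coe)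
    (fun _ p => p.2) (fun _ _ => rfl) i (measurableSet_errorEvent i)
    (fun ω hω => mul_score_nonpos_of_mem_errorEvent hω) MeasurableSet.univ
  rw [Set.preimage_univ, Set.inter_univ, setLIntegral_univ] at h1
  refine h1.trans ?_
  have h2 := (measurePreserving_law_taskQuality (F := F) (G := G) h.balanced
    i).quasiMeasurePreserving.ae hlam
  refine (lintegral_mono_ae (g := fun _ => ENNReal.ofReal (errorBound m ℓ r k F G lamMin))
    (h2.mono fun ω hω => ENNReal.ofReal_le_ofReal ?_)).trans_eq (by simp)
  have h3 := h.effVariance_pos (k := k)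
  have h4 := h.crowdQuality_pos
  rw [errorBound, errorBound]
  gcongr
  exact hω

end Budget

end Crowdsourcing

open Crowdsourcing in
theorem theorem3 :
    (∀ (ℓ r m n k : ℕ) (F G : Measure unitInterval)
        [IsProbabilityMeasure F] [IsProbabilityMeasure G],
      1 < ℓ → 1 < r → m * ℓ = n * r → 1 ≤ k →
      0 < crowdMean F →
      1 < ((ℓ : ℝ) - 1) * ((r : ℝ) - 1) * meanDifficulty G ^ 2 * crowdQuality F ^ 2 →
      1 < ((r : ℝ) - 1) * meanDifficulty G →
      -- i.i.d. qualities, conditionally on the difficulty of the task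
      (∀ i : Fin m,
        (law m n ℓ r F G)⟦errorEvent k i | MeasurableSpace.comap
            (fun ω => difficulty (quality ω i)) inferInstance⟧
          ≤ᵐ[law m n ℓ r F G] fun ω => errorBound m ℓ r k F G (difficulty (quality ω i))) ∧
      -- i.i.d. qualities, conditionally on the difficulty and the label of the task
      (∀ i : Fin m,
        (law m n ℓ r F G)⟦errorEvent k i | MeasurableSpace.comap
            (fun ω => quality ω i) inferInstance⟧
          ≤ᵐ[law m n ℓ r F G] fun ω => errorBound m ℓ r k F G (difficulty (quality ω i))) ∧
      -- arbitrary labels, i.i.d. difficulties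
      (∀ t : Fin m → ℝ, (∀ i, t i = 1 ∨ t i = -1) → ∀ i : Fin m,
        (law m n ℓ r F G)⟦labelledErrorEvent t k i | MeasurableSpace.comap
            (fun ω => difficulty (quality ω i)) inferInstance⟧
          ≤ᵐ[law m n ℓ r F G] fun ω => errorBound m ℓ r k F G (difficulty (quality ω i)))) ∧
    -- a budget `m ℓ` of order `m / (λ_min σ²) * log (1 / ε)` suffices for average error `ε`
    (∃ C : ℝ, 0 < C ∧
      ∀ (ℓ r : ℕ) (F G : Measure unitInterval)
        [IsProbabilityMeasure F] [IsProbabilityMeasure G] (lamMin ε : ℝ),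
      1 < ℓ → 1 < r →
      0 < crowdMean F →
      0 < lamMin → (∀ᵐ q : unitInterval ∂G, lamMin ≤ difficulty (q : ℝ)) →
      1 < ((r : ℝ) - 1) * meanDifficulty G →
      1 ≤ ((r : ℝ) - 1) * meanDifficulty G * crowdQuality F →
      0 < ε → ε ≤ 1 / 2 →
      C / (lamMin * crowdQuality F) * Real.log (1 / ε) ≤ (ℓ : ℝ) →
      ∃ K : ℕ, ∀ k : ℕ, K ≤ k → ∃ M : ℕ, ∀ m n : ℕ, M ≤ m → m * ℓ = n * r →
        (∑ i : Fin m, (law m n ℓ r F G).real (errorEvent k i)) / (m : ℝ) ≤ ε) := by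
  constructor
  · intro ℓ r m n k F G _ _ hℓ hr hmn hk hμ hX hρ
    have h : Supercritical m n ℓ r F G := ⟨hℓ, hr, hmn, hμ, hX, hρ⟩
    refine ⟨fun i => ?_, fun i => ?_, fun t ht i => ?_⟩
    · exact h.condProb_le hk (q := fun _ => (↑)) (fun _ => measurable_subtype_coe)
        (fun _ p => p.2) (fun _ _ => rfl) i (measurableSet_errorEvent i)
        (fun ω hω => mul_score_nonpos_of_mem_errorEvent hω) measurable_difficulty
        measurable_id fun _ => rfl
    · exact h.condProb_le hk (q := fun _ => (↑)) (fun _ => measurable_subtype_coe)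
        (fun _ p => p.2) (fun _ _ => rfl) i (measurableSet_errorEvent i)
        (fun ω hω => mul_score_nonpos_of_mem_errorEvent hω) measurable_id
        measurable_difficulty fun _ => rfl
    · exact h.condProb_le hk (q := fun i => relabel (t i)) (fun i => measurable_relabel (t i))
        (fun i => relabel_mem_Icc (ht i)) (fun i => two_mul_relabel_sub_one_sq (ht i)) i
        (measurableSet_labelledErrorEvent t i)
        (fun ω hω => mul_score_nonpos_of_mem_labelledErrorEvent ht hω) measurable_difficulty
        measurable_id fun _ => rfl
  -- The effective variance is at most `13`, and the exponent, with its denominator `2 * 13`, has to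
  -- reach `2 * log (1 / ε)`.
  · refine ⟨52, by norm_num, ?_⟩
    intro ℓ r F G _ _ lamMin ε hℓ hr hμ hlam hlamG hρ hb hε hε2 hC
    have hℓ' : (2 : ℝ) ≤ ℓ := by exact_mod_cast hℓ
    have hσ0 : 0 < crowdQuality F := by
      refine (meanDifficulty_nonneg (G := F)).lt_of_ne fun h0 => ?_
      rw [crowdQuality_eq_meanDifficulty, ← h0] at hb
      norm_num at hb
    have hlog : Real.log 2 ≤ Real.log (1 / ε) := by
      refine Real.log_le_log two_pos ?_
      rw [le_div_iff₀ hε]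
      linarith
    have hlog2 := Real.log_two_gt_d9
    have hbudget : 52 * Real.log (1 / ε) ≤ ℓ * (lamMin * crowdQuality F) := by
      rwa [div_mul_eq_mul_div, div_le_iff₀ (by positivity)] at hC
    -- The growth rate is at least `ℓ λ_min σ² / 2 ≥ 26 log 2`, which exceeds `2`.
    have hX : 2 ≤ ((ℓ : ℝ) - 1) * ((r : ℝ) - 1) * (meanDifficulty G * crowdQuality F) ^ 2 := by
      have := growth_ge (a := (ℓ : ℝ) - 1) (by linarith) hlam hσ0 (le_meanDifficulty hlamG) hb
      linarith
    obtain ⟨K, hK⟩ := pow_unbounded_of_one_lt (2 / crowdMean F ^ 2) one_lt_two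
    refine ⟨K + 1, fun k hk => ?_⟩
    have hvar : effVariance ℓ r k F G ≤ 13 :=
      effVariance_le hμ (meanDifficulty_le_one (G := F)) hb hX
        (hK.le.trans (pow_le_pow_right₀ one_le_two (by omega)))
    obtain ⟨M, hM⟩ := exists_nat_ge
      (3 * (ℓ : ℝ) * r * (((ℓ : ℝ) - 1) * ((r : ℝ) - 1)) ^ (2 * k - 2) / ε ^ 2)
    refine ⟨M, fun m n hm hmn => ?_⟩
    -- Without tasks the average is `0 / 0 = 0`.
    rcases Nat.eq_zero_or_pos m with rfl | hm0
    · simpa using hε.le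
    have h : Supercritical m n ℓ r F G := ⟨hℓ, hr, hmn, hμ, by
      rw [mul_assoc, ← mul_pow]
      linarith, hρ⟩
    have hm0' : (0 : ℝ) < m := by exact_mod_cast hm0
    -- Each of the two terms is at most `ε ^ 2`, and `2 * ε ^ 2 ≤ ε` because `ε ≤ 1 / 2`.
    have hbound : errorBound m ℓ r k F G lamMin ≤ ε := by
      have h1 : Real.exp (-((ℓ : ℝ) * crowdQuality F * lamMin) / (2 * effVariance ℓ r k F G)) ≤
          ε ^ 2 := by
        rw [← Real.le_log_iff_exp_le (by positivity), Real.log_pow,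
          div_le_iff₀ (by have := h.effVariance_pos (k := k); positivity)]
        rw [one_div, Real.log_inv] at hlog hbudget
        have h2 : -Real.log ε * effVariance ℓ r k F G ≤ -Real.log ε * 13 :=
          mul_le_mul_of_nonneg_left hvar (by linarith)
        push_cast
        linarith
      have h3 : 3 * (ℓ : ℝ) * (r : ℝ) / (m : ℝ) *
          (((ℓ : ℝ) - 1) * ((r : ℝ) - 1)) ^ (2 * k - 2) ≤ ε ^ 2 := by
        have h4 := hM.trans (Nat.cast_le.2 hm)
        rw [div_le_iff₀ (by positivity)] at h4
        rw [div_mul_eq_mul_div, div_le_iff₀ hm0', mul_comm (ε ^ 2)]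
        exact h4
      rw [errorBound]
      nlinarith
    rw [div_le_iff₀ hm0']
    refine (Finset.sum_le_card_nsmul _ _ ε fun i _ =>
      (h.measureReal_errorEvent_le (by omega) i hlamG).trans hbound).trans_eq ?_
    rw [Finset.card_univ, Fintype.card_fin, nsmul_eq_mul, mul_comm]
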